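/- Let $q\in\mathbb{C}\setminus\{0\}$ be not a root of unity and put $\theta=q-q^{-1}$. Let $\mathbb{V}$ be the braided vector space of diagonal type with basis $x_1,x_2$ and braiding matrix $(q_{ij})=\begin{pmatrix} q & q^{-1}\\ q^{-1} & -q\end{pmatrix}$, let $\chi$ be the bicharacter on $\mathbb{Z}^2$ with $\chi(\alpha_i,\alpha_j)=q_{ij}$, let $B(\mathbb{V})=\bigoplus_{\alpha\in\mathbb{N}_0^2}B^\alpha(\mathbb{V})$ be the Nichols algebra of $\mathbb{V}$ with its grading $\deg x_i=\alpha_i$, and let $\Delta$ be its (braided) comultiplication. Write $[u,v]=uv-\chi(\deg u,\deg v)\,vu$ for homogeneous $u,v$. For $n\ge 1$ let $X_n$ and $Y_n$ be the super-letters (iterated braided brackets along the decomposition of a Lyndon word into two Lyndon words with shortest first factor) of the Lyndon words $x_1(x_1x_2)^{n-1}$ and $(x_1x_2)^{n-1}x_2$, where $x_1<x_2$. In $B(\mathbb{V})$ put $L_n=[X_1,Y_n]$ for $n\ge1$, $L'_n=[X_2,Y_{n-1}]$ for $n\ge2$, $L'_1=L_1$, and $L_0=L_0'=1/\theta$. Let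 $B_{\ge1}$ (resp. $B_{>1}$) be the sum of the components of degree $a_1\alpha_1+a_2\alpha_2$ with $a_1\ge a_2$ (resp. $a_1>a_2$), and put $$K_{\ge1}=\{x\in B(\mathbb{V}) : \Delta(x)\in B_{\ge1}\otimes B(\mathbb{V})\},\qquad K_{>1}=K_{\ge1}\cap B_{>1}.$$ Then all $L_n$ and $L'_n$ lie in $K_{\ge1}$, and $\Delta$ induces a unique linear map, again denoted $\Delta$, from $K_{\ge1}/K_{>1}$ to $(K_{\ge1}/K_{>1})\otimes(K_{\ge1}/K_{>1})$, in the sense that for every $x\in K_{\ge1}$ the value at the class of $x$ and the element $\Delta(x)$ have the same image in $(B(\mathbb{V})/K_{>1})\otimes(B(\mathbb{V})/K_{>1})$. In $K_{\ge1}/K_{>1}$ the comultiplication is given by $$\Delta(L_{2n})=L_{2n}\otimes1-\sum_{j=1}^{n}\theta L'_{2n-(2j-1)}\otimes L_{2j-1}+\sum_{j=1}^{n-1}\theta L_{2n-2j}\otimes L_{2j}+1\otimes L_{2n}\qquad(n\ge1),$$ $$\Delta(L'_{2n})=L'_{2n}\otimes1-\sum_{j=1}^{n}\theta L_{2n-(2j-1)}\otimes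 L'_{2j-1}+\sum_{j=1}^{n-1}\theta L'_{2n-2j}\otimes L'_{2j}+1\otimes L'_{2n}\qquad(n\ge1),$$ $$\Delta(L_{2n+1})=L_{2n+1}\otimes1+\sum_{j=1}^{n}\theta L'_{2n+1-(2j-1)}\otimes L_{2j-1}+\sum_{j=1}^{n}\theta L_{2n+1-2j}\otimes L_{2j}+1\otimes L_{2n+1}\qquad(n\ge0),$$ $$\Delta(L'_{2n+1})=L'_{2n+1}\otimes1+\sum_{j=1}^{n}\theta L_{2n+1-(2j-1)}\otimes L'_{2j-1}+\sum_{j=1}^{n}\theta L'_{2n+1-2j}\otimes L'_{2j}+1\otimes L'_{2n+1}\qquad(n\ge0).$$ -/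

import Mathlib

open scoped TensorProduct

noncomputable section

namespace Nichols

/-! ### The free algebra on `s` letters as a braided Hopf algebra of diagonal type -/

/-- The tensor algebra `T(V)` of a vector space `V` with basis `x_0, …, x_{s-1}`, identified with
the linear span of all words in the letters `x_i`. -/
abbrev TAlg (k : Type*) [Field k] (s : ℕ) : Type _ := MonoidAlgebra k (FreeMonoid (Fin s))

section General

variable {k : Type*} [Field k] {s : ℕ}

/-- A word, as an element of `T(V)`. -/
def word (w : List (Fin s)) : TAlg k s := MonoidAlgebra.of k (FreeMonoid (Fin s)) (FreeMonoid.ofList w)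

/-- The basis vector `x_i` of `V`, in `T(V)`. -/
def letter (i : Fin s) : TAlg k s := word [i]

/-- The basis of `T(V)` consisting of all words. -/
def wordBasis (k : Type*) [Field k] (s : ℕ) : Module.Basis (FreeMonoid (Fin s)) k (TAlg k s) :=
  MonoidAlgebra.basis (FreeMonoid (Fin s)) k

/-- The multidegree of a word: the numbers of occurrences of the letters. -/
def wordDeg (w : List (Fin s)) : Fin s → ℕ := fun i => w.count i

/-- The bicharacter with `χ(α_i, α_j) = Q i j`. -/
def chi (Q : Matrix (Fin s) (Fin s) k) (a b : Fin s → ℕ) : k := ∏ i, ∏ j, Q i j ^ (a i * b j)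

/-- The braiding of `T(V)`: `c(u ⊗ v) = χ(deg u, deg v) v ⊗ u` for words `u`, `v`. -/
def braiding (Q : Matrix (Fin s) (Fin s) k) :
    TAlg k s ⊗[k] TAlg k s →ₗ[k] TAlg k s ⊗[k] TAlg k s :=
  ((wordBasis k s).tensorProduct (wordBasis k s)).constr k fun p =>
    chi Q (wordDeg p.1.toList) (wordDeg p.2.toList) • (word p.2.toList ⊗ₜ[k] word p.1.toList)

/-- The braided bracket `[a, b] = m ∘ (id - c) (a ⊗ b)`. -/
def bracket (Q : Matrix (Fin s) (Fin s) k) (a b : TAlg k s) : TAlg k s :=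
  LinearMap.mul' k (TAlg k s) (a ⊗ₜ[k] b - braiding Q (a ⊗ₜ[k] b))

/-- The multiplication `(m ⊗ m) ∘ (id ⊗ c ⊗ id)` of the braided tensor product algebra
`T(V) ⊗ T(V)`. -/
def braidedMul (Q : Matrix (Fin s) (Fin s) k) :
    (TAlg k s ⊗[k] TAlg k s) ⊗[k] (TAlg k s ⊗[k] TAlg k s) →ₗ[k] TAlg k s ⊗[k] TAlg k s :=
  TensorProduct.map (LinearMap.mul' k (TAlg k s)) (LinearMap.mul' k (TAlg k s)) ∘ₗ
    (TensorProduct.assoc k (TAlg k s) (TAlg k s) (TAlg k s ⊗[k] TAlg k s)).symm.toLinearMap ∘ₗ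
    LinearMap.lTensor (TAlg k s)
      ((TensorProduct.assoc k (TAlg k s) (TAlg k s) (TAlg k s)).toLinearMap ∘ₗ
        LinearMap.rTensor (TAlg k s) (braiding Q) ∘ₗ
        (TensorProduct.assoc k (TAlg k s) (TAlg k s) (TAlg k s)).symm.toLinearMap) ∘ₗ
    (TensorProduct.assoc k (TAlg k s) (TAlg k s) (TAlg k s ⊗[k] TAlg k s)).toLinearMap

/-- The comultiplication of a word: the product of the `x_i ⊗ 1 + 1 ⊗ x_i` over its letters, in the
braided tensor product algebra. -/
def comulWord (Q : Matrix (Fin s) (Fin s) k) : List (Fin s) → TAlg k s ⊗[k] TAlg k s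
  | [] => 1 ⊗ₜ[k] 1
  | i :: w =>
      braidedMul Q ((letter i ⊗ₜ[k] 1 + 1 ⊗ₜ[k] letter i) ⊗ₜ[k] comulWord Q w)

/-- The comultiplication of the braided Hopf algebra `T(V)`: the algebra map to the braided tensor
product algebra with `x_i ↦ x_i ⊗ 1 + 1 ⊗ x_i`. -/
def comulT (Q : Matrix (Fin s) (Fin s) k) : TAlg k s →ₗ[k] TAlg k s ⊗[k] TAlg k s :=
  (wordBasis k s).constr k fun w => comulWord Q w.toList

/-- The homogeneous component `T^n(V)`, spanned by the words of length `n`. -/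
def lengthPart (k : Type*) [Field k] (s n : ℕ) : Submodule k (TAlg k s) :=
  Submodule.span k {t | ∃ w : List (Fin s), w.length = n ∧ t = word w}

/-- The `ℕ^s`-homogeneous component of `T(V)` of degree `a`. -/
def degPart (k : Type*) [Field k] {s : ℕ} (a : Fin s → ℕ) : Submodule k (TAlg k s) :=
  Submodule.span k {t | ∃ w : List (Fin s), wordDeg w = a ∧ t = word w}

/-- The subspace `J ⊗ A + A ⊗ J` of `A ⊗ A`. -/
def coidealSpace {A : Type*} [AddCommGroup A] [Module k A] (J : Submodule k A) :
    Submodule k (A ⊗[k] A) :=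
  LinearMap.range (TensorProduct.map J.subtype (LinearMap.id : A →ₗ[k] A)) ⊔
    LinearMap.range (TensorProduct.map (LinearMap.id : A →ₗ[k] A) J.subtype)

/-- A two-sided ideal of `T(V)` that is homogeneous, is contained in `⨁_{n ≥ 2} T^n(V)`, and is a
coideal. -/
structure IsHopfIdeal (Q : Matrix (Fin s) (Fin s) k) (J : Ideal (TAlg k s)) : Prop where
  twoSided : J.IsTwoSided
  homogeneous : J.restrictScalars k ≤ ⨆ n : ℕ, J.restrictScalars k ⊓ lengthPart k s n
  degree : J.restrictScalars k ≤ ⨆ n : ℕ, ⨆ _ : 2 ≤ n, lengthPart k s n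
  coideal : ∀ x ∈ J, comulT Q x ∈ coidealSpace (J.restrictScalars k)

/-- The defining ideal of the Nichols algebra: the sum of all ideals as above. -/
def nicholsIdeal (Q : Matrix (Fin s) (Fin s) k) : Ideal (TAlg k s) :=
  sSup {J | IsHopfIdeal Q J}

instance nicholsIdeal_isTwoSided (Q : Matrix (Fin s) (Fin s) k) :
    (nicholsIdeal Q).IsTwoSided := by
  refine ⟨fun {a} b ha => ?_⟩
  unfold nicholsIdeal at ha ⊢
  rw [sSup_eq_iSup'] at ha ⊢
  induction ha using Submodule.iSup_induction' with
  | mem J x hx =>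
      have := J.2.twoSided
      exact Submodule.mem_iSup_of_mem J (Ideal.mul_mem_right b J.1 hx)
  | zero => simp
  | add x y _ _ hx hy =>
      rw [add_mul]
      exact Submodule.add_mem _ hx hy

/-- The Nichols algebra of the braided vector space of diagonal type with braiding matrix `Q`. -/
abbrev NicholsAlg (Q : Matrix (Fin s) (Fin s) k) : Type _ := TAlg k s ⧸ nicholsIdeal Q

/-- The projection of `T(V)` onto the Nichols algebra. -/
def proj (Q : Matrix (Fin s) (Fin s) k) : TAlg k s →ₗ[k] NicholsAlg Q :=
  (Ideal.Quotient.mkₐ k (nicholsIdeal Q)).toLinearMap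

theorem map_proj_comulT_eq_zero (Q : Matrix (Fin s) (Fin s) k) (x : TAlg k s)
    (hx : x ∈ nicholsIdeal Q) :
    TensorProduct.map (proj Q) (proj Q) (comulT Q x) = 0 := by
  unfold nicholsIdeal at hx
  rw [sSup_eq_iSup'] at hx
  induction hx using Submodule.iSup_induction' with
  | mem J x hx =>
      have hJ : ∀ y : J.1.restrictScalars k, proj Q y = 0 := fun y =>
        Ideal.Quotient.eq_zero_iff_mem.2 (le_sSup (a := J.1) J.2 y.2)
      have hz : proj Q ∘ₗ (J.1.restrictScalars k).subtype = 0 := LinearMap.ext hJ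
      have h := J.2.coideal x hx
      have hle : coidealSpace (J.1.restrictScalars k) ≤
          LinearMap.ker (TensorProduct.map (proj Q) (proj Q)) := by
        refine sup_le ?_ ?_
        · rw [LinearMap.range_le_ker_iff, ← TensorProduct.map_comp, hz]
          simp
        · rw [LinearMap.range_le_ker_iff, ← TensorProduct.map_comp, hz]
          simp
      exact hle h
  | zero => simp
  | add x y _ _ hx hy => rw [map_add, map_add, hx, hy, add_zero]

/-- The comultiplication of the Nichols algebra, induced by that of `T(V)`. -/
def comul (Q : Matrix (Fin s) (Fin s) k) :
    NicholsAlg Q →ₗ[k] NicholsAlg Q ⊗[k] NicholsAlg Q :=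
  (((nicholsIdeal Q).restrictScalars k).liftQ
      (TensorProduct.map (proj Q) (proj Q) ∘ₗ comulT Q)
      (fun x hx => map_proj_comulT_eq_zero Q x hx)) ∘ₗ
    (Submodule.Quotient.restrictScalarsEquiv k (nicholsIdeal Q)).symm.toLinearMap

theorem comul_proj (Q : Matrix (Fin s) (Fin s) k) (x : TAlg k s) :
    comul Q (proj Q x) = TensorProduct.map (proj Q) (proj Q) (comulT Q x) := rfl

/-- The homogeneous component of degree `a` of the Nichols algebra. -/
def nicholsDegPart (Q : Matrix (Fin s) (Fin s) k) (a : Fin s → ℕ) : Submodule k (NicholsAlg Q) :=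
  (degPart k a).map (proj Q)

/-! ### Lyndon words and super-letters -/

/-- A nonempty word which is lexicographically smaller than each of its proper nonempty
suffixes. -/
def IsLyndon (u : List (Fin s)) : Prop :=
  u ≠ [] ∧ ∀ v w : List (Fin s), v ≠ [] → w ≠ [] → u = v ++ w → u < w

/-- Cutting `u` after `n` letters decomposes it into two Lyndon words. -/
def IsLyndonCut (u : List (Fin s)) (n : ℕ) : Prop :=
  0 < n ∧ n < u.length ∧ IsLyndon (u.take n) ∧ IsLyndon (u.drop n)

open Classical in
/-- The super-letter `[u] ∈ T(V)` of a Lyndon word `u`: `[x_i] = x_i`, and `[u] = [[v], [w]]` for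
the decomposition `u = v w` into two Lyndon words with `v` of minimal length. (A word that has no
such decomposition is returned unchanged.) -/
def superLetter (Q : Matrix (Fin s) (Fin s) k) (u : List (Fin s)) : TAlg k s :=
  if h : ∃ n, IsLyndonCut u n then
    bracket Q (superLetter Q (u.take (Nat.find h))) (superLetter Q (u.drop (Nat.find h)))
  else word u
termination_by u.length
decreasing_by
  · have := Nat.find_spec h
    simp only [List.length_take]
    exact lt_of_le_of_lt (min_le_left _ _) this.2.1
  · have := Nat.find_spec h
    have h1 := this.1
    have h2 := this.2.1
    simp only [List.length_drop]
    omega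

end General

/-! ### The rank two Nichols algebra -/

/-- The braiding matrix. -/
def braidMat (q : ℂ) : Matrix (Fin 2) (Fin 2) ℂ := !![q, q⁻¹; q⁻¹, -q]

/-- `θ = q - q⁻¹`. -/
def theta (q : ℂ) : ℂ := q - q⁻¹

/-- The Nichols algebra `B(𝕍)`. -/
abbrev B (q : ℂ) : Type := NicholsAlg (braidMat q)

/-- The comultiplication of `B(𝕍)`. -/
abbrev comulB (q : ℂ) : B q →ₗ[ℂ] B q ⊗[ℂ] B q := comul (braidMat q)

/-- The sum of the components of `B(𝕍)` of degrees `a_1 α_1 + a_2 α_2` with `a_1 ≥ a_2`. -/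
def BGe (q : ℂ) : Submodule ℂ (B q) :=
  ⨆ a : Fin 2 → ℕ, ⨆ _ : a 0 ≥ a 1, nicholsDegPart (braidMat q) a

/-- The sum of the components of `B(𝕍)` of degrees `a_1 α_1 + a_2 α_2` with `a_1 > a_2`. -/
def BGt (q : ℂ) : Submodule ℂ (B q) :=
  ⨆ a : Fin 2 → ℕ, ⨆ _ : a 0 > a 1, nicholsDegPart (braidMat q) a

/-- `K_{≥1} = {x | Δ(x) ∈ B_{≥1} ⊗ B(𝕍)}`. -/
def KGe (q : ℂ) : Submodule ℂ (B q) :=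
  (LinearMap.range
    (TensorProduct.map (BGe q).subtype (LinearMap.id : B q →ₗ[ℂ] B q))).comap (comulB q)

/-- `K_{>1} = K_{≥1} ∩ B_{>1}`. -/
def KGt (q : ℂ) : Submodule ℂ (B q) := KGe q ⊓ BGt q

/-- The subquotient `K_{≥1} / K_{>1}`. -/
abbrev SubQ (q : ℂ) : Type := KGe q ⧸ (KGt q).comap (KGe q).subtype

/-- The class in `K_{≥1} / K_{>1}` of an element of `K_{≥1}`. -/
def cls (q : ℂ) (x : B q) (hx : x ∈ KGe q) : SubQ q :=
  Submodule.Quotient.mk ⟨x, hx⟩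

/-- The inclusion of `K_{≥1} / K_{>1}` into `B(𝕍) / K_{>1}`. -/
def subQIncl (q : ℂ) : SubQ q →ₗ[ℂ] B q ⧸ KGt q :=
  Submodule.mapQ _ _ (KGe q).subtype le_rfl

/-- `δ` is the comultiplication of `K_{≥1} / K_{>1}` induced by the comultiplication `Δ` of
`B(𝕍)`: for `x ∈ K_{≥1}`, the elements `δ(x mod K_{>1})` and `Δ(x)` have the same image in
`B(𝕍) / K_{>1} ⊗ B(𝕍) / K_{>1}`, which contains `K_{≥1} / K_{>1} ⊗ K_{≥1} / K_{>1}`. -/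
def IsInducedComul (q : ℂ) (δ : SubQ q →ₗ[ℂ] SubQ q ⊗[ℂ] SubQ q) : Prop :=
  ∀ (x : B q) (hx : x ∈ KGe q),
    TensorProduct.map (subQIncl q) (subQIncl q) (δ (cls q x hx)) =
      TensorProduct.map (KGt q).mkQ (KGt q).mkQ (comulB q x)

/-- `X_n` (`n ≥ 1`): the super-letter of the Lyndon word `x_1 (x_1 x_2)^{n-1}`. -/
def X (q : ℂ) (n : ℕ) : TAlg ℂ 2 :=
  superLetter (braidMat q) (0 :: (List.replicate (n - 1) [0, 1]).flatten)

/-- `Y_n` (`n ≥ 1`): the super-letter of the Lyndon word `(x_1 x_2)^{n-1} x_2`. -/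
def Y (q : ℂ) (n : ℕ) : TAlg ℂ 2 :=
  superLetter (braidMat q) ((List.replicate (n - 1) [0, 1]).flatten ++ [1])

/-- `L_n = [X_1, Y_n]` for `n ≥ 1`, and `L_0 = 1/θ`; as elements of `T(𝕍)`. -/
def preL (q : ℂ) : ℕ → TAlg ℂ 2
  | 0 => (1 / theta q) • (1 : TAlg ℂ 2)
  | n + 1 => bracket (braidMat q) (X q 1) (Y q (n + 1))

/-- `L'_n = [X_2, Y_{n-1}]` for `n ≥ 2`, `L'_1 = [X_1, Y_1]` and `L'_0 = 1/θ`; as elements of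
`T(𝕍)`. -/
def preL' (q : ℂ) : ℕ → TAlg ℂ 2
  | 0 => (1 / theta q) • (1 : TAlg ℂ 2)
  | 1 => bracket (braidMat q) (X q 1) (Y q 1)
  | n + 2 => bracket (braidMat q) (X q 2) (Y q (n + 1))

/-- `L_n ∈ B(𝕍)`. -/
def L (q : ℂ) (n : ℕ) : B q := proj (braidMat q) (preL q n)

/-- `L'_n ∈ B(𝕍)`. -/
def L' (q : ℂ) (n : ℕ) : B q := proj (braidMat q) (preL' q n)

theorem one_mem_KGe (q : ℂ) : (1 : B q) ∈ KGe q := by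
  have h1 : proj (braidMat q) (word []) = (1 : B q) :=
    map_one (Ideal.Quotient.mkₐ ℂ (nicholsIdeal (braidMat q)))
  have hT : (word [] : TAlg ℂ 2) = wordBasis ℂ 2 (FreeMonoid.ofList []) := by
    simp [wordBasis, word]
  have hc : comulB q (1 : B q) = (1 : B q) ⊗ₜ[ℂ] (1 : B q) := by
    rw [← h1, comulB, comul_proj]
    conv_lhs => rw [hT]
    rw [comulT, Module.Basis.constr_basis]
    exact TensorProduct.map_tmul _ _ _ _
  have hB : (1 : B q) ∈ BGe q := by
    refine Submodule.mem_iSup_of_mem (wordDeg []) (Submodule.mem_iSup_of_mem (by simp [wordDeg]) ?_)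
    exact ⟨word [], Submodule.subset_span ⟨[], rfl, rfl⟩, h1⟩
  rw [KGe, Submodule.mem_comap, hc]
  exact ⟨⟨1, hB⟩ ⊗ₜ[ℂ] 1, by simp⟩

/-- The class of `1`. -/
def oneQ (q : ℂ) : SubQ q := cls q 1 (one_mem_KGe q)

end Nichols

end

/-! The Nichols algebra is handled through skew derivations. The largest admissible ideal is the
common kernel of all functionals that apply a string of derivations ∂_i and then the counit
(`nicholsIdeal_eq_derivRadical`), and under these functionals Δ is dual to concatenation of words
(`nFun_comul`). This has two uses. An element of B(𝕍) without constant term is zero once ∂_1 and ∂_2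
kill it, which proves the basic relations. And K_{≥1}, K_{>1} become annihilators of sets of words,
so the existence of the induced comultiplication reduces to the behaviour of these sets under
concatenation.

For the formulas put u = [x_1, x_2] (`br`). Bracketing with u is a commutator or an anticommutator,
Y_{n+1} = [u, Y_n], and L_{n+1} = L'_{n+1} + [u, L_n]. The essential relation is that u² commutes
with every L_n (`commute_br_sq_L`): then [u, [u, L_n]] = 0, so [u, L'_n] = [u, L_n], and the
recursions close up within the two sequences L and L'.

The comultiplication is computed modulo K_{>1} ⊗ B(𝕍). In Δ(u) = u⊗1 + (1 - q⁻²) x_1⊗x_2 + 1⊗u the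
middle term disappears on left factors in K_{≥1}, because multiplication by x_1 sends K_{≥1} into
K_{>1}; on Y_n ⊗ 1 it produces a multiple of L_n ⊗ x_2. By induction Δ(Y_{n+1}) ≡ Y_{n+1}⊗1 +
Σ_{j+m=n} c_{j,m} ⊗ Y_{j+1}, with c_{j,m} = θ(-1)^m L'_m for even j and θ L_m for odd j
(`modGt_comulB_bY`). Bracketing with x_1 or X_2 gives the formulas for L and L'. Since the formula
for L_{n+1} needs only L_0, …, L_n ∈ K_{≥1}, it also proves L_{n+1} ∈ K_{≥1}. Splitting by the
parity of j yields the two sums of the theorem. -/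

noncomputable section

namespace Nichols

variable {q : ℂ}

section General

variable {k : Type*} [Field k] {s : ℕ}

/-! ### Words -/

theorem word_nil : (word [] : TAlg k s) = 1 := rfl

theorem word_append (v w : List (Fin s)) : (word (v ++ w) : TAlg k s) = word v * word w := by
  simp only [word, FreeMonoid.ofList_append, map_mul]

theorem word_cons (i : Fin s) (w : List (Fin s)) :
    (word (i :: w) : TAlg k s) = letter i * word w :=
  word_append [i] w

theorem wordBasis_apply (w : FreeMonoid (Fin s)) : wordBasis k s w = word w.toList := by
  simp [wordBasis, word]

/-- The linear map on `T(V)` with given values on the words. -/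
def wordLift {M : Type*} [AddCommGroup M] [Module k M] (f : List (Fin s) → M) :
    TAlg k s →ₗ[k] M :=
  (wordBasis k s).constr k fun w => f w.toList

@[simp] theorem wordLift_word {M : Type*} [AddCommGroup M] [Module k M] (f : List (Fin s) → M)
    (w : List (Fin s)) : wordLift f (word w : TAlg k s) = f w := by
  have h := (wordBasis k s).constr_basis k (fun w => f w.toList) (FreeMonoid.ofList w)
  rwa [wordBasis_apply] at h

theorem span_word : Submodule.span k (Set.range (word : List (Fin s) → TAlg k s)) = ⊤ := by
  rw [← (wordBasis k s).span_eq]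
  congr 1

theorem word_induction {p : TAlg k s → Prop} (hw : ∀ w, p (word w)) (h0 : p 0)
    (ha : ∀ x y, p x → p y → p (x + y)) (hs : ∀ (c : k) x, p x → p (c • x)) (t : TAlg k s) :
    p t := by
  have ht : t ∈ Submodule.span k (Set.range (word : List (Fin s) → TAlg k s)) := by
    rw [span_word]; trivial
  induction ht using Submodule.span_induction with
  | mem x hx => obtain ⟨w, rfl⟩ := hx; exact hw w
  | zero => exact h0
  | add x y _ _ hx hy => exact ha x y hx hy
  | smul c x _ hx => exact hs c x hx

/-! ### Algebra maps on `T(V)` -/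

/-- The algebra map on `T(V)` with given values on the letters. -/
def letterLift {A : Type*} [Ring A] [Algebra k A] (f : Fin s → A) : TAlg k s →ₐ[k] A :=
  MonoidAlgebra.lift k A (FreeMonoid (Fin s)) (FreeMonoid.lift f)

@[simp] theorem letterLift_letter {A : Type*} [Ring A] [Algebra k A] (f : Fin s → A) (i : Fin s) :
    letterLift f (letter i : TAlg k s) = f i := by
  rw [letterLift, letter, word, MonoidAlgebra.lift_of]
  exact FreeMonoid.lift_eval_of f i

/-- The diagonal automorphism of `T(V)` by which `x_i` acts: `x_j ↦ Q i j • x_j`. -/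
def sigma (Q : Matrix (Fin s) (Fin s) k) (i : Fin s) : TAlg k s →ₐ[k] TAlg k s :=
  letterLift fun j => Q i j • letter j

@[simp] theorem sigma_letter (Q : Matrix (Fin s) (Fin s) k) (i j : Fin s) :
    sigma Q i (letter j) = Q i j • letter j :=
  letterLift_letter _ _

/-- The counit of `T(V)`. -/
def counit (k : Type*) [Field k] (s : ℕ) : TAlg k s →ₐ[k] k := letterLift fun _ => 0

@[simp] theorem counit_letter (j : Fin s) : counit k s (letter j) = 0 := letterLift_letter _ _

/-- The product of the scalars `Q i j` over the letters `j` of a word. -/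
def weight (Q : Matrix (Fin s) (Fin s) k) (i : Fin s) (w : List (Fin s)) : k :=
  (w.map (Q i)).prod

@[simp] theorem weight_nil (Q : Matrix (Fin s) (Fin s) k) (i : Fin s) : weight Q i [] = 1 := rfl

@[simp] theorem weight_cons (Q : Matrix (Fin s) (Fin s) k) (i j : Fin s) (w : List (Fin s)) :
    weight Q i (j :: w) = Q i j * weight Q i w := by simp [weight]

theorem sigma_word (Q : Matrix (Fin s) (Fin s) k) (i : Fin s) (w : List (Fin s)) :
    sigma Q i (word w) = weight Q i w • word w := by
  induction w with
  | nil => rw [word_nil, map_one, weight_nil, one_smul]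
  | cons j w ih =>
    rw [word_cons, map_mul, sigma_letter, ih, weight_cons, smul_mul_smul_comm]

theorem wordDeg_cons (j : Fin s) (w : List (Fin s)) :
    wordDeg (j :: w) = wordDeg [j] + wordDeg w := by
  funext i
  simp only [wordDeg, Pi.add_apply]
  rw [List.count_cons, List.count_singleton, add_comm]

theorem wordDeg_append (v w : List (Fin s)) : wordDeg (v ++ w) = wordDeg v + wordDeg w := by
  funext i
  simp [wordDeg, List.count_append]

theorem chi_add_right (Q : Matrix (Fin s) (Fin s) k) (a b c : Fin s → ℕ) :
    chi Q a (b + c) = chi Q a b * chi Q a c := by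
  simp only [chi, Pi.add_apply, mul_add, pow_add, Finset.prod_mul_distrib]

theorem chi_nil_left (Q : Matrix (Fin s) (Fin s) k) (b : Fin s → ℕ) :
    chi Q (wordDeg []) b = 1 := by
  simp [chi, wordDeg]

theorem chi_nil_right (Q : Matrix (Fin s) (Fin s) k) (b : Fin s → ℕ) :
    chi Q b (wordDeg []) = 1 := by
  simp [chi, wordDeg]

theorem chi_letter_letter (Q : Matrix (Fin s) (Fin s) k) (i j : Fin s) :
    chi Q (wordDeg [i]) (wordDeg [j]) = Q i j := by
  unfold chi wordDeg
  rw [Finset.prod_eq_single i, Finset.prod_eq_single j]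
  · simp
  · intro b _ hb
    simp [hb.symm]
  · simp
  · intro b _ hb
    simp [hb.symm]
  · simp

theorem chi_letter_word (Q : Matrix (Fin s) (Fin s) k) (i : Fin s) (w : List (Fin s)) :
    chi Q (wordDeg [i]) (wordDeg w) = weight Q i w := by
  induction w with
  | nil => simp [chi_nil_right]
  | cons j w ih => rw [wordDeg_cons j w, chi_add_right, chi_letter_letter, ih, weight_cons]

/-! ### The braided product and the comultiplication -/

theorem braiding_word_word (Q : Matrix (Fin s) (Fin s) k) (v w : List (Fin s)) :
    braiding Q (word v ⊗ₜ[k] word w) =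
      chi Q (wordDeg v) (wordDeg w) • (word w ⊗ₜ[k] word v) := by
  have h := ((wordBasis k s).tensorProduct (wordBasis k s)).constr_basis k
    (fun p => chi Q (wordDeg p.1.toList) (wordDeg p.2.toList) •
      ((word p.2.toList : TAlg k s) ⊗ₜ[k] (word p.1.toList : TAlg k s)))
    (FreeMonoid.ofList v, FreeMonoid.ofList w)
  rwa [Module.Basis.tensorProduct_apply, wordBasis_apply, wordBasis_apply] at h

theorem braiding_letter_tmul (Q : Matrix (Fin s) (Fin s) k) (i : Fin s) (t : TAlg k s) :
    braiding Q (letter i ⊗ₜ[k] t) = sigma Q i t ⊗ₜ[k] letter i := by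
  induction t using word_induction with
  | hw w =>
    rw [letter, braiding_word_word, chi_letter_word, sigma_word, TensorProduct.smul_tmul']
  | h0 => simp
  | ha x y hx hy => rw [TensorProduct.tmul_add, map_add, hx, hy, map_add, TensorProduct.add_tmul]
  | hs c x hx =>
    rw [TensorProduct.tmul_smul, map_smul, hx, map_smul, TensorProduct.smul_tmul']

theorem braiding_one_tmul (Q : Matrix (Fin s) (Fin s) k) (t : TAlg k s) :
    braiding Q (1 ⊗ₜ[k] t) = t ⊗ₜ[k] 1 := by
  induction t using word_induction with
  | hw w => rw [← word_nil, braiding_word_word, chi_nil_left, one_smul]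
  | h0 => simp
  | ha x y hx hy => rw [TensorProduct.tmul_add, map_add, hx, hy, TensorProduct.add_tmul]
  | hs c x hx => rw [TensorProduct.tmul_smul, map_smul, hx, TensorProduct.smul_tmul']

/-- Left multiplication by `x_i ⊗ 1 + 1 ⊗ x_i` in the braided tensor product algebra. -/
def leftMul (Q : Matrix (Fin s) (Fin s) k) (i : Fin s) :
    TAlg k s ⊗[k] TAlg k s →ₗ[k] TAlg k s ⊗[k] TAlg k s :=
  TensorProduct.map (LinearMap.mulLeft k (letter i)) LinearMap.id +
    TensorProduct.map (sigma Q i).toLinearMap (LinearMap.mulLeft k (letter i))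

theorem leftMul_tmul (Q : Matrix (Fin s) (Fin s) k) (i : Fin s) (a b : TAlg k s) :
    leftMul Q i (a ⊗ₜ b) = (letter i * a) ⊗ₜ b + sigma Q i a ⊗ₜ (letter i * b) := rfl

/-- Right multiplication by `x_i ⊗ 1 + 1 ⊗ x_i` in the braided tensor product algebra. -/
def rightMul (Q : Matrix (Fin s) (Fin s) k) (i : Fin s) :
    TAlg k s ⊗[k] TAlg k s →ₗ[k] TAlg k s ⊗[k] TAlg k s :=
  TensorProduct.map (LinearMap.mulRight k (letter i)) (sigma Q.transpose i).toLinearMap +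
    TensorProduct.map LinearMap.id (LinearMap.mulRight k (letter i))

theorem rightMul_tmul (Q : Matrix (Fin s) (Fin s) k) (i : Fin s) (a b : TAlg k s) :
    rightMul Q i (a ⊗ₜ b) = (a * letter i) ⊗ₜ sigma Q.transpose i b + a ⊗ₜ (b * letter i) := rfl

theorem braidedMul_letter (Q : Matrix (Fin s) (Fin s) k) (i : Fin s)
    (y : TAlg k s ⊗[k] TAlg k s) :
    braidedMul Q ((letter i ⊗ₜ[k] 1 + 1 ⊗ₜ[k] letter i) ⊗ₜ[k] y) = leftMul Q i y := by
  induction y with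
  | zero => simp
  | add x y hx hy => rw [TensorProduct.tmul_add, map_add, hx, hy, map_add]
  | tmul a b =>
    rw [TensorProduct.add_tmul, map_add, leftMul_tmul]
    simp [braidedMul, braiding_letter_tmul, braiding_one_tmul]

theorem comulT_word (Q : Matrix (Fin s) (Fin s) k) (w : List (Fin s)) :
    comulT Q (word w) = comulWord Q w :=
  wordLift_word _ w

theorem comulT_one (Q : Matrix (Fin s) (Fin s) k) : comulT Q 1 = 1 ⊗ₜ 1 := comulT_word Q []

theorem comulT_letter_mul (Q : Matrix (Fin s) (Fin s) k) (i : Fin s) (t : TAlg k s) :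
    comulT Q (letter i * t) = leftMul Q i (comulT Q t) := by
  induction t using word_induction with
  | hw w => rw [← word_cons, comulT_word, comulT_word, comulWord, braidedMul_letter]
  | h0 => simp
  | ha x y hx hy => rw [mul_add, map_add, hx, hy, map_add, map_add]
  | hs c x hx => rw [mul_smul_comm, map_smul, hx, map_smul, map_smul]

/-- This is the only associativity of the braided tensor square that is needed; it gives the
coproduct of `t * letter i` although Δ is defined by multiplying from the left. -/
theorem leftMul_rightMul (Q : Matrix (Fin s) (Fin s) k) (i j : Fin s)
    (y : TAlg k s ⊗[k] TAlg k s) :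
    leftMul Q i (rightMul Q j y) = rightMul Q j (leftMul Q i y) := by
  induction y with
  | zero => simp
  | add x y hx hy => rw [map_add, map_add, hx, hy, map_add, map_add]
  | tmul a b =>
    simp only [leftMul_tmul, rightMul_tmul, map_add, map_mul, sigma_letter,
      Matrix.transpose_apply, mul_assoc, mul_smul_comm, smul_mul_assoc, TensorProduct.smul_tmul, TensorProduct.tmul_smul]
    abel

theorem word_induction_left {p : TAlg k s → Prop} (h1 : p 1) (hl : ∀ i x, p x → p (letter i * x))
    (h0 : p 0) (ha : ∀ x y, p x → p y → p (x + y)) (hs : ∀ (c : k) x, p x → p (c • x))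
    (t : TAlg k s) : p t := by
  induction t using word_induction with
  | hw w =>
    induction w with
    | nil => exact h1
    | cons i w ih => rw [word_cons]; exact hl i _ ih
  | h0 => exact h0
  | ha x y hx hy => exact ha x y hx hy
  | hs c x hx => exact hs c x hx

theorem comulT_mul_letter (Q : Matrix (Fin s) (Fin s) k) (i : Fin s) (t : TAlg k s) :
    comulT Q (t * letter i) = rightMul Q i (comulT Q t) := by
  induction t using word_induction_left with
  | h1 =>
    have h := comulT_letter_mul Q i 1
    rw [mul_one, comulT_one] at h
    rw [one_mul, h, comulT_one, leftMul_tmul, rightMul_tmul]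
    simp
  | hl j x hx => rw [mul_assoc, comulT_letter_mul, hx, comulT_letter_mul, leftMul_rightMul]
  | h0 => simp
  | ha x y hx hy => rw [add_mul, map_add, hx, hy, map_add, map_add]
  | hs c x hx => rw [smul_mul_assoc, map_smul, hx, map_smul, map_smul]

/-! ### Coassociativity of the comultiplication of `T(V)` -/

theorem sigma_sigma (Q R : Matrix (Fin s) (Fin s) k) (i j : Fin s) (t : TAlg k s) :
    sigma Q i (sigma R j t) = sigma R j (sigma Q i t) := by
  induction t using word_induction_left with
  | h1 => simp
  | hl l x hx => simp only [map_mul, sigma_letter, map_smul, hx, smul_comm (Q i l)]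
  | h0 => simp
  | ha x y hx hy => simp only [map_add, hx, hy]
  | hs c x hx => simp only [map_smul, hx]

theorem map_sigma_leftMul (Q : Matrix (Fin s) (Fin s) k) (i j : Fin s)
    (y : TAlg k s ⊗[k] TAlg k s) :
    TensorProduct.map (sigma Q i).toLinearMap (sigma Q i).toLinearMap (leftMul Q j y) =
      Q i j • leftMul Q j
        (TensorProduct.map (sigma Q i).toLinearMap (sigma Q i).toLinearMap y) := by
  induction y with
  | zero => simp
  | add x y hx hy => simp only [map_add, hx, hy, smul_add]
  | tmul a b =>
    simp only [leftMul_tmul, map_add, TensorProduct.map_tmul, AlgHom.toLinearMap_apply, map_mul,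
      sigma_letter, smul_mul_assoc, TensorProduct.smul_tmul, TensorProduct.tmul_smul, smul_add,
      sigma_sigma Q Q i j]

/-- Needed for coassociativity: `leftMul` twists the left tensor factor by σ_i, and Δ ⊗ id then
expands that factor. -/
theorem comulT_sigma (Q : Matrix (Fin s) (Fin s) k) (i : Fin s) (t : TAlg k s) :
    comulT Q (sigma Q i t) =
      TensorProduct.map (sigma Q i).toLinearMap (sigma Q i).toLinearMap (comulT Q t) := by
  induction t using word_induction_left with
  | h1 => simp [comulT_one]
  | hl j x hx =>
    rw [map_mul, sigma_letter, smul_mul_assoc, map_smul, comulT_letter_mul, hx, comulT_letter_mul,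
      map_sigma_leftMul]
  | h0 => simp
  | ha x y hx hy => simp only [map_add, hx, hy]
  | hs c x hx => simp only [map_smul, hx]

/-- Left multiplication by `x_i ⊗ 1 ⊗ 1 + 1 ⊗ x_i ⊗ 1 + 1 ⊗ 1 ⊗ x_i` in the braided tensor cube. -/
def leftMul₃ (Q : Matrix (Fin s) (Fin s) k) (i : Fin s) :
    TAlg k s ⊗[k] (TAlg k s ⊗[k] TAlg k s) →ₗ[k] TAlg k s ⊗[k] (TAlg k s ⊗[k] TAlg k s) :=
  TensorProduct.map (LinearMap.mulLeft k (letter i)) LinearMap.id +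
    TensorProduct.map (sigma Q i).toLinearMap (leftMul Q i)

theorem comulT_coassoc (Q : Matrix (Fin s) (Fin s) k) (t : TAlg k s) :
    TensorProduct.assoc k _ _ _ ((comulT Q).rTensor _ (comulT Q t)) =
      (comulT Q).lTensor _ (comulT Q t) := by
  -- Both iterated coproducts turn multiplication by a letter into `leftMul₃`, so they agree by
  -- induction on the leading letter.
  have h1 : ∀ i y, (comulT Q).lTensor _ (leftMul Q i y) =
      leftMul₃ Q i ((comulT Q).lTensor _ y) := by
    intro i y
    induction y with
    | zero => simp
    | add x y hx hy => simp only [map_add, hx, hy]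
    | tmul a b =>
      simp [leftMul_tmul, leftMul₃, comulT_letter_mul]
  have h2 : ∀ i y, TensorProduct.assoc k _ _ _ ((comulT Q).rTensor _ (leftMul Q i y)) =
      leftMul₃ Q i (TensorProduct.assoc k _ _ _ ((comulT Q).rTensor _ y)) := by
    intro i y
    induction y with
    | zero => simp
    | add x y hx hy => simp only [map_add, hx, hy]
    | tmul a b =>
      simp only [leftMul_tmul, map_add, LinearMap.rTensor_tmul, comulT_letter_mul, comulT_sigma]
      generalize comulT Q a = z
      induction z with
      | zero => simp
      | add x y hx hy =>
        simp only [map_add, TensorProduct.add_tmul] at hx hy ⊢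
        rw [← hx, ← hy]
        abel
      | tmul c d =>
        simp [leftMul_tmul, leftMul₃, TensorProduct.add_tmul, TensorProduct.tmul_add, add_assoc]
  induction t using word_induction_left with
  | h1 => simp [comulT_one]
  | hl j x hx => rw [comulT_letter_mul, h1, h2, hx]
  | h0 => simp
  | ha x y hx hy => simp only [map_add, hx, hy]
  | hs c x hx => simp only [map_smul, hx]

end General

/-! ### Functionals on tensor products over a field -/

section Separation

variable {k M N : Type*} [Field k] [AddCommGroup M] [Module k M] [AddCommGroup N] [Module k N]

/-- Over a field, products of two separating families of functionals separate the points of the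
tensor product. -/
theorem tensor_eq_zero_of_separating {ι κ : Type*} (f : ι → M →ₗ[k] k) (g : κ → N →ₗ[k] k)
    (hf : ∀ m, (∀ i, f i m = 0) → m = 0) (hg : ∀ n, (∀ j, g j n = 0) → n = 0) (y : M ⊗[k] N)
    (hy : ∀ i j, TensorProduct.lid k k (TensorProduct.map (f i) (g j) y) = 0) : y = 0 := by
  set b := Module.Free.chooseBasis k N
  -- Contracting the left factor with `f i` leaves an element of `N` on which every `g j` vanishes.
  have h1 : ∀ i, TensorProduct.lid k N ((f i).rTensor N y) = 0 := by
    intro i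
    refine hg _ fun j => ?_
    rw [← hy i j]
    generalize y = z
    induction z with
    | zero => simp
    | add x y hx hy => simp only [map_add, hx, hy]
    | tmul c d => simp
  have h2 : ∀ i z, TensorProduct.equivFinsuppOfBasisRight b ((f i).rTensor N z) =
      Finsupp.mapRange.linearMap (f i) (TensorProduct.equivFinsuppOfBasisRight b z) := by
    intro i z
    induction z with
    | zero => simp
    | add x y hx hy => simp only [map_add, hx, hy]
    | tmul c d =>
      ext l
      simp [TensorProduct.equivFinsuppOfBasisRight_apply_tmul]
  -- Expanded along a basis of `N`, the coordinates of `y` lie in `M`, and every `f i` kills them.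
  apply (TensorProduct.equivFinsuppOfBasisRight b).injective
  rw [map_zero]
  ext l
  refine hf _ fun i => ?_
  have h3 := h2 i y
  rw [(LinearEquiv.map_eq_zero_iff _).1 (h1 i), map_zero] at h3
  exact (DFunLike.congr_fun h3 l).symm

/-- The common kernel of a family of functionals. -/
def commonKer {ι : Type*} (f : ι → M →ₗ[k] k) : Submodule k M := ⨅ i, LinearMap.ker (f i)

theorem mem_commonKer {ι : Type*} {f : ι → M →ₗ[k] k} {m : M} :
    m ∈ commonKer f ↔ ∀ i, f i m = 0 := by
  simp [commonKer]

/-- The functionals descend to the quotients by their common kernels and separate points there, so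
`tensor_eq_zero_of_separating` applies. -/
theorem map_mkQ_eq_zero_iff {ι κ : Type*} (f : ι → M →ₗ[k] k) (g : κ → N →ₗ[k] k)
    (y : M ⊗[k] N) :
    TensorProduct.map (commonKer f).mkQ (commonKer g).mkQ y = 0 ↔
      ∀ i j, TensorProduct.lid k k (TensorProduct.map (f i) (g j) y) = 0 := by
  have hfl : ∀ i, commonKer f ≤ LinearMap.ker (f i) := fun i => iInf_le _ i
  have hgl : ∀ i, commonKer g ≤ LinearMap.ker (g i) := fun i => iInf_le _ i
  have key : ∀ i j, TensorProduct.map (f i) (g j) y =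
      TensorProduct.map ((commonKer f).liftQ (f i) (hfl i)) ((commonKer g).liftQ (g j) (hgl j))
        (TensorProduct.map (commonKer f).mkQ (commonKer g).mkQ y) := by
    intro i j
    rw [← LinearMap.comp_apply, ← TensorProduct.map_comp, Submodule.liftQ_mkQ,
      Submodule.liftQ_mkQ]
  constructor
  · intro h i j
    rw [key, h, map_zero, map_zero]
  · intro h
    refine tensor_eq_zero_of_separating
      (fun i => (commonKer f).liftQ (f i) (hfl i)) (fun j => (commonKer g).liftQ (g j) (hgl j))
      ?_ ?_ _ fun i j => by rw [← key]; exact h i j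
    · intro m hm
      obtain ⟨m, rfl⟩ := Submodule.mkQ_surjective _ m
      rw [Submodule.mkQ_apply, Submodule.Quotient.mk_eq_zero, mem_commonKer]
      intro i
      have := hm i
      rwa [Submodule.mkQ_apply, Submodule.liftQ_apply] at this
    · intro m hm
      obtain ⟨m, rfl⟩ := Submodule.mkQ_surjective _ m
      rw [Submodule.mkQ_apply, Submodule.Quotient.mk_eq_zero, mem_commonKer]
      intro i
      have := hm i
      rwa [Submodule.mkQ_apply, Submodule.liftQ_apply] at this

/-- By right exactness the range is the kernel of the quotient map on the left factor. As the `g j`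
separate points, their quotient map is injective and stays so after tensoring, which reduces the
claim to `map_mkQ_eq_zero_iff`. -/
theorem mem_range_map_subtype_iff {ι κ : Type*} (f : ι → M →ₗ[k] k) (g : κ → N →ₗ[k] k)
    (hg : ∀ n, (∀ j, g j n = 0) → n = 0) (y : M ⊗[k] N) :
    y ∈ LinearMap.range
        (TensorProduct.map (commonKer f).subtype (LinearMap.id : N →ₗ[k] N)) ↔
      ∀ i j, TensorProduct.lid k k (TensorProduct.map (f i) (g j) y) = 0 := by
  have h0 : commonKer g = ⊥ := by
    rw [eq_bot_iff]
    exact fun n hn => hg n (mem_commonKer.1 hn)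
  have hinj : Function.Injective (commonKer g).mkQ := by
    rw [← LinearMap.ker_eq_bot, Submodule.ker_mkQ, h0]
  rw [← map_mkQ_eq_zero_iff]
  have h1 : TensorProduct.map (commonKer f).mkQ (commonKer g).mkQ y =
      (commonKer g).mkQ.lTensor _ ((commonKer f).mkQ.rTensor N y) := by
    rw [← LinearMap.comp_apply, LinearMap.lTensor_comp_rTensor]
  have h2 := rTensor_mkQ N (commonKer f)
  change _ ∈ LinearMap.range (LinearMap.rTensor N _) ↔ _
  rw [← h2, LinearMap.mem_ker, h1]
  refine ⟨fun h => by rw [h, map_zero], fun h => ?_⟩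
  exact (Module.Flat.lTensor_preserves_injective_linearMap _ hinj) (by rw [h, map_zero])

end Separation

section General

variable {k : Type*} [Field k] {s : ℕ}

/-! ### Skew derivations -/

/-- The skew derivation of `T(V)` for the letter `i`, on a word. -/
def derivWord (Q : Matrix (Fin s) (Fin s) k) (i : Fin s) : List (Fin s) → TAlg k s
  | [] => 0
  | j :: w => letter j * derivWord Q i w + if i = j then sigma Q i (word w) else 0

/-- The skew derivation `∂_i` of `T(V)`: `∂_i (x y) = x ∂_i(y) + ∂_i(x) σ_i(y)` and
`∂_i (x_j) = δ_{i j}`. -/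
def deriv (Q : Matrix (Fin s) (Fin s) k) (i : Fin s) : TAlg k s →ₗ[k] TAlg k s :=
  wordLift (derivWord Q i)

theorem deriv_one (Q : Matrix (Fin s) (Fin s) k) (i : Fin s) : deriv Q i 1 = 0 :=
  wordLift_word _ _

theorem deriv_letter_mul (Q : Matrix (Fin s) (Fin s) k) (i j : Fin s) (t : TAlg k s) :
    deriv Q i (letter j * t) = letter j * deriv Q i t + if i = j then sigma Q i t else 0 := by
  induction t using word_induction with
  | hw w => rw [← word_cons, deriv, wordLift_word, derivWord, wordLift_word]
  | h0 => simp
  | ha x y hx hy =>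
    rw [mul_add, map_add, hx, hy, map_add, map_add, mul_add]
    split_ifs <;> abel
  | hs c x hx =>
    rw [mul_smul_comm, map_smul, hx, map_smul, map_smul, mul_smul_comm, smul_add]
    split_ifs <;> simp

theorem deriv_letter (Q : Matrix (Fin s) (Fin s) k) (i j : Fin s) :
    deriv Q i (letter j) = if i = j then 1 else 0 := by
  have h := deriv_letter_mul Q i j 1
  rwa [mul_one, deriv_one, mul_zero, zero_add, map_one] at h

theorem deriv_mul (Q : Matrix (Fin s) (Fin s) k) (i : Fin s) (t v : TAlg k s) :
    deriv Q i (t * v) = t * deriv Q i v + deriv Q i t * sigma Q i v := by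
  induction t using word_induction_left with
  | h1 => simp [deriv_one]
  | hl j x hx =>
    rw [mul_assoc, deriv_letter_mul, hx, deriv_letter_mul, map_mul]
    split_ifs <;> noncomm_ring
  | h0 => simp
  | ha x y hx hy => simp only [add_mul, map_add, hx, hy]; abel
  | hs c x hx => simp only [smul_mul_assoc, map_smul, hx, smul_add]

theorem deriv_sigma (Q : Matrix (Fin s) (Fin s) k) (i j : Fin s) (t : TAlg k s) :
    deriv Q i (sigma Q j t) = Q j i • sigma Q j (deriv Q i t) := by
  induction t using word_induction_left with
  | h1 => simp [deriv_one]
  | hl l x hx =>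
    rw [map_mul, sigma_letter, smul_mul_assoc, map_smul, deriv_letter_mul, hx, deriv_letter_mul,
      map_add, map_mul, sigma_letter, sigma_sigma]
    split_ifs with h
    · subst h
      rw [smul_add, smul_add, mul_smul_comm, smul_mul_assoc, smul_comm (Q j i)]
    · rw [map_zero, add_zero, add_zero, mul_smul_comm, smul_mul_assoc, smul_comm]
  | h0 => simp
  | ha x y hx hy => simp only [map_add, hx, hy, smul_add]
  | hs c x hx => simp only [map_smul, hx, smul_comm c]

/-- The functional on `T(V)` that applies the skew derivations of a list of letters, from left to
right, and then the counit. -/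
def wordFun (Q : Matrix (Fin s) (Fin s) k) : List (Fin s) → TAlg k s →ₗ[k] k
  | [] => (counit k s).toLinearMap
  | i :: w => wordFun Q w ∘ₗ deriv Q i

theorem wordFun_cons (Q : Matrix (Fin s) (Fin s) k) (i : Fin s) (w : List (Fin s))
    (t : TAlg k s) : wordFun Q (i :: w) t = wordFun Q w (deriv Q i t) := rfl

theorem wordFun_sigma (Q : Matrix (Fin s) (Fin s) k) (i : Fin s) (w : List (Fin s))
    (t : TAlg k s) : wordFun Q w (sigma Q i t) = weight Q i w * wordFun Q w t := by
  induction w generalizing t with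
  | nil =>
    rw [weight_nil, one_mul]
    change counit k s _ = counit k s _
    induction t using word_induction_left with
    | h1 => simp
    | hl j x hx => simp
    | h0 => simp
    | ha x y hx hy => simp only [map_add, hx, hy]
    | hs c x hx => simp only [map_smul, hx]
  | cons j w ih =>
    rw [wordFun_cons, wordFun_cons, deriv_sigma, map_smul, ih, weight_cons, smul_eq_mul, mul_assoc]

/-- ∂_i lowers the degree by α_i; prepending `i` to the resulting words expresses this without
subtraction in ℕ. -/
theorem deriv_word_mem (Q : Matrix (Fin s) (Fin s) k) (i : Fin s) (w : List (Fin s)) :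
    deriv Q i (word w) ∈
      Submodule.span k {t : TAlg k s | ∃ v, wordDeg (i :: v) = wordDeg w ∧ t = word v} := by
  induction w with
  | nil => rw [word_nil, deriv_one]; exact zero_mem _
  | cons j w ih =>
    rw [word_cons, deriv_letter_mul]
    refine add_mem ?_ ?_
    · refine (Submodule.span_le (p := (Submodule.span k _).comap
        (LinearMap.mulLeft k (letter j)))).2 ?_ ih
      rintro _ ⟨v, hv, rfl⟩
      refine Submodule.subset_span ⟨j :: v, ?_, (word_cons j v).symm⟩
      rw [wordDeg_cons, wordDeg_cons j v, wordDeg_cons j w, ← hv, wordDeg_cons i v]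
      abel
    · split_ifs with h
      · subst h
        rw [sigma_word]
        exact Submodule.smul_mem _ _ (Submodule.subset_span ⟨w, rfl, rfl⟩)
      · exact zero_mem _

/-- The functional `wordFun Q v` vanishes on all words that are not permutations of `v`. -/
theorem wordFun_word_eq_zero (Q : Matrix (Fin s) (Fin s) k) (v w : List (Fin s))
    (h : wordDeg v ≠ wordDeg w) : wordFun Q v (word w) = 0 := by
  induction v generalizing w with
  | nil =>
    cases w with
    | nil => exact absurd rfl h
    | cons j w => rw [word_cons]; simp [wordFun]
  | cons i v ih =>
    refine (Submodule.span_le (p := LinearMap.ker (wordFun Q v))).2 ?_ (deriv_word_mem Q i w)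
    rintro _ ⟨v', hv', rfl⟩
    refine ih v' fun h' => h ?_
    rw [← hv', wordDeg_cons, h', ← wordDeg_cons]

open Classical in
/-- The projection of `T(V)` onto the sum of the homogeneous components of degrees satisfying
`p`. -/
def degProj (k : Type*) [Field k] (p : (Fin s → ℕ) → Prop) : TAlg k s →ₗ[k] TAlg k s :=
  wordLift fun w => if p (wordDeg w) then word w else 0

open Classical in
theorem degProj_word (p : (Fin s → ℕ) → Prop) (w : List (Fin s)) :
    degProj k p (word w) = if p (wordDeg w) then word w else 0 := wordLift_word _ _

open Classical in
theorem wordFun_degProj (Q : Matrix (Fin s) (Fin s) k) (p : (Fin s → ℕ) → Prop)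
    (v : List (Fin s)) (t : TAlg k s) :
    wordFun Q v (degProj k p t) = if p (wordDeg v) then wordFun Q v t else 0 := by
  induction t using word_induction with
  | hw w =>
    rw [degProj_word]
    by_cases h : wordDeg v = wordDeg w
    · rw [h]; split_ifs <;> simp
    · have h0 := wordFun_word_eq_zero Q v w h
      split_ifs <;> simp [h0]
  | h0 => simp
  | ha x y hx hy => rw [map_add, map_add, hx, hy]; split_ifs <;> simp
  | hs c x hx => rw [map_smul, map_smul, hx]; split_ifs <;> simp

/-! ### The Nichols ideal as the common kernel of the functionals `wordFun` -/

/-- The common kernel of the functionals `wordFun Q w`, as an ideal. -/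
def derivRadical (Q : Matrix (Fin s) (Fin s) k) : Ideal (TAlg k s) where
  carrier := {t | ∀ w, wordFun Q w t = 0}
  add_mem' ha hb w := by rw [map_add, ha w, hb w, add_zero]
  zero_mem' w := map_zero _
  smul_mem' a t ht w := by
    simp only [Set.mem_ofPred_eq, smul_eq_mul] at ht ⊢
    induction w generalizing a t with
    | nil =>
      have := ht []
      simp only [wordFun, AlgHom.toLinearMap_apply] at this ⊢
      rw [map_mul, this, mul_zero]
    | cons i w ih =>
      -- In a · ∂_i t + ∂_i a · σ_i t both right factors are again killed by every functional, the
      -- second because σ_i only rescales functionals.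
      rw [wordFun_cons, deriv_mul, map_add, ih _ _ fun v => ht (i :: v),
        ih _ _ fun v => by rw [wordFun_sigma, ht v, mul_zero], add_zero]

theorem mem_derivRadical {Q : Matrix (Fin s) (Fin s) k} {t : TAlg k s} :
    t ∈ derivRadical Q ↔ ∀ w, wordFun Q w t = 0 := Iff.rfl

theorem derivRadical_restrictScalars (Q : Matrix (Fin s) (Fin s) k) :
    (derivRadical Q).restrictScalars k = commonKer (wordFun Q) := by
  ext t
  rw [mem_commonKer]
  rfl

theorem derivRadical_isTwoSided (Q : Matrix (Fin s) (Fin s) k) :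
    (derivRadical Q).IsTwoSided := by
  refine ⟨fun {t} a ht w => ?_⟩
  rw [mem_derivRadical] at ht
  induction w generalizing a t with
  | nil =>
    have := ht []
    simp only [wordFun, AlgHom.toLinearMap_apply] at this ⊢
    rw [map_mul, this, zero_mul]
  | cons i w ih =>
    rw [wordFun_cons, deriv_mul, map_add, ih _ ht, ih _ fun v => ht (i :: v), add_zero]

theorem degProj_mem_derivRadical {Q : Matrix (Fin s) (Fin s) k} (p : (Fin s → ℕ) → Prop)
    {t : TAlg k s} (ht : t ∈ derivRadical Q) : degProj k p t ∈ derivRadical Q := by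
  intro w
  rw [wordFun_degProj, ht w, ite_self]

/-! ### Homogeneous components by length -/

theorem sum_wordDeg (w : List (Fin s)) : ∑ i, wordDeg w i = w.length := by
  induction w with
  | nil => simp [wordDeg]
  | cons j w ih =>
    rw [wordDeg_cons]
    simp only [Pi.add_apply, Finset.sum_add_distrib, ih]
    simp [wordDeg, List.count_singleton, add_comm]

/-- The projection of `T(V)` onto `T^n(V)`. -/
def lengthProj (k : Type*) [Field k] (s n : ℕ) : TAlg k s →ₗ[k] TAlg k s :=
  degProj k fun a => ∑ i, a i = n

theorem lengthProj_word (n : ℕ) (w : List (Fin s)) :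
    lengthProj k s n (word w) = if w.length = n then word w else 0 := by
  rw [lengthProj, degProj_word]
  simp only [sum_wordDeg]

theorem lengthProj_mem (n : ℕ) (t : TAlg k s) : lengthProj k s n t ∈ lengthPart k s n := by
  induction t using word_induction with
  | hw w =>
    rw [lengthProj_word]
    split_ifs with h
    · exact Submodule.subset_span ⟨w, h, rfl⟩
    · exact zero_mem _
  | h0 => rw [map_zero]; exact zero_mem _
  | ha x y hx hy => rw [map_add]; exact add_mem hx hy
  | hs c x hx => rw [map_smul]; exact Submodule.smul_mem _ _ hx

/-- Asking for all large `n`, not just one, lets the bounds of two summands be merged by a maximum.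
-/
theorem exists_eq_sum_lengthProj (t : TAlg k s) :
    ∃ N, ∀ n ≥ N, t = ∑ i ∈ Finset.range n, lengthProj k s i t := by
  induction t using word_induction with
  | hw w =>
    refine ⟨w.length + 1, fun n hn => ?_⟩
    simp only [lengthProj_word]
    rw [Finset.sum_ite_eq, if_pos (Finset.mem_range.2 (by omega))]
  | h0 => exact ⟨0, fun n _ => by simp⟩
  | ha x y hx hy =>
    obtain ⟨N, hN⟩ := hx
    obtain ⟨M, hM⟩ := hy
    refine ⟨max N M, fun n hn => ?_⟩
    simp only [map_add, Finset.sum_add_distrib]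
    rw [← hN n (le_trans (le_max_left _ _) hn), ← hM n (le_trans (le_max_right _ _) hn)]
  | hs c x hx =>
    obtain ⟨N, hN⟩ := hx
    refine ⟨N, fun n hn => ?_⟩
    simp only [map_smul, ← Finset.smul_sum]
    rw [← hN n hn]

theorem lengthProj_zero (Q : Matrix (Fin s) (Fin s) k) (t : TAlg k s) :
    lengthProj k s 0 t = wordFun Q [] t • 1 := by
  induction t using word_induction with
  | hw w =>
    rw [lengthProj_word]
    cases w with
    | nil => simp [word_nil, wordFun]
    | cons i w => rw [word_cons]; simp [wordFun]
  | h0 => simp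
  | ha x y hx hy => rw [map_add, map_add, hx, hy, add_smul]
  | hs c x hx => rw [map_smul, map_smul, hx, smul_assoc]

/-- With `lengthProj_zero` this shows that the common kernel of the functionals starts in length 2.
-/
theorem lengthProj_one (Q : Matrix (Fin s) (Fin s) k) (t : TAlg k s) :
    lengthProj k s 1 t = ∑ i, wordFun Q [i] t • letter i := by
  induction t using word_induction with
  | hw w =>
    rw [lengthProj_word]
    match w with
    | [] =>
      simp only [wordFun, word_nil, LinearMap.comp_apply, deriv_one]
      simp
    | [j] =>
      simp only [wordFun, LinearMap.comp_apply]
      rw [word_cons, word_nil, mul_one]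
      simp [deriv_letter]
    | i :: j :: w =>
      simp only [wordFun, LinearMap.comp_apply]
      rw [if_neg (by simp), word_cons, word_cons]
      symm
      refine Finset.sum_eq_zero fun l _ => ?_
      rw [deriv_letter_mul, map_add]
      split_ifs <;> simp
  | h0 => simp
  | ha x y hx hy => simp only [map_add, hx, hy, add_smul, Finset.sum_add_distrib]
  | hs c x hx => simp only [map_smul, hx, smul_assoc, Finset.smul_sum]

/-! ### Duality of comultiplication and concatenation; the largest Hopf ideal -/

theorem lTensor_counit_comulT (Q : Matrix (Fin s) (Fin s) k) (t : TAlg k s) :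
    TensorProduct.rid k _ ((wordFun Q []).lTensor _ (comulT Q t)) = t := by
  have h : ∀ i y, TensorProduct.rid k _ ((wordFun Q []).lTensor _ (leftMul Q i y)) =
      letter i * TensorProduct.rid k _ ((wordFun Q []).lTensor _ y) := by
    intro i y
    induction y with
    | zero => simp
    | add x y hx hy => simp only [map_add, hx, hy, mul_add]
    | tmul a b => simp [leftMul_tmul, wordFun]
  induction t using word_induction_left with
  | h1 => simp [comulT_one, wordFun]
  | hl j x hx => rw [comulT_letter_mul, h, hx]
  | h0 => simp
  | ha x y hx hy => simp only [map_add, hx, hy]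
  | hs c x hx => simp only [map_smul, hx]

/-- `∂_i = (id ⊗ x_i^*) ∘ Δ`. -/
theorem lTensor_wordFun_letter_comulT (Q : Matrix (Fin s) (Fin s) k) (i : Fin s) (t : TAlg k s) :
    TensorProduct.rid k _ ((wordFun Q [i]).lTensor _ (comulT Q t)) = deriv Q i t := by
  have h : ∀ j y, TensorProduct.rid k _ ((wordFun Q [i]).lTensor _ (leftMul Q j y)) =
      letter j * TensorProduct.rid k _ ((wordFun Q [i]).lTensor _ y) +
        if i = j then sigma Q i (TensorProduct.rid k _ ((wordFun Q []).lTensor _ y)) else 0 := by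
    intro j y
    induction y with
    | zero => simp
    | add x y hx hy => simp only [map_add, hx, hy, mul_add]; split_ifs <;> abel
    | tmul a b =>
      have hc : counit k s (sigma Q i b) = counit k s b := by
        have := wordFun_sigma Q i [] b
        rwa [weight_nil, one_mul] at this
      simp only [leftMul_tmul, wordFun, map_add, LinearMap.lTensor_tmul, LinearMap.comp_apply,
        TensorProduct.rid_tmul, deriv_letter_mul, mul_smul_comm, AlgHom.toLinearMap_apply, map_mul,
        counit_letter, zero_mul, zero_add, map_smul]
      split_ifs with hij
      · rw [hc, hij]
      · simp
  induction t using word_induction_left with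
  | h1 => simp [comulT_one, deriv_one, wordFun]
  | hl j x hx => rw [comulT_letter_mul, h, hx, deriv_letter_mul, lTensor_counit_comulT]
  | h0 => simp
  | ha x y hx hy => simp only [map_add, hx, hy]
  | hs c x hx => simp only [map_smul, hx]

/-- Coassociativity in disguise: ∂_i is Δ followed by the i-th coordinate functional on the right
factor. -/
theorem comulT_deriv (Q : Matrix (Fin s) (Fin s) k) (i : Fin s) (t : TAlg k s) :
    comulT Q (deriv Q i t) = (deriv Q i).lTensor _ (comulT Q t) := by
  have h1 : ∀ y : TAlg k s ⊗[k] TAlg k s,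
      comulT Q (TensorProduct.rid k _ ((wordFun Q [i]).lTensor _ y)) =
      (TensorProduct.rid k (TAlg k s)).toLinearMap.lTensor _
        (((wordFun Q [i]).lTensor _).lTensor _
          (TensorProduct.assoc k _ _ _ ((comulT Q).rTensor _ y))) := by
    intro y
    induction y with
    | zero => simp
    | add x y hx hy => simp only [map_add, hx, hy]
    | tmul a b =>
      simp only [LinearMap.lTensor_tmul, LinearMap.rTensor_tmul, TensorProduct.rid_tmul, map_smul]
      generalize comulT Q a = z
      induction z with
      | zero => simp
      | add x y hx hy => simp only [smul_add, hx, hy, TensorProduct.add_tmul, map_add]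
      | tmul c d => simp
  have h2 : ∀ y : TAlg k s ⊗[k] TAlg k s, (TensorProduct.rid k (TAlg k s)).toLinearMap.lTensor _
        (((wordFun Q [i]).lTensor _).lTensor _ ((comulT Q).lTensor _ y)) =
      (deriv Q i).lTensor _ y := by
    intro y
    induction y with
    | zero => simp
    | add x y hx hy => simp only [map_add, hx, hy]
    | tmul a b =>
      simp only [LinearMap.lTensor_tmul, LinearEquiv.coe_coe, lTensor_wordFun_letter_comulT]
  rw [← h2, ← comulT_coassoc, ← h1, lTensor_wordFun_letter_comulT]

/-- Under the functionals `wordFun`, the comultiplication is dual to concatenation. -/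
theorem wordFun_comulT (Q : Matrix (Fin s) (Fin s) k) (v w : List (Fin s)) (t : TAlg k s) :
    TensorProduct.lid k k (TensorProduct.map (wordFun Q v) (wordFun Q w) (comulT Q t)) =
      wordFun Q (w ++ v) t := by
  induction w generalizing t with
  | nil =>
    rw [List.nil_append]
    conv_rhs => rw [← lTensor_counit_comulT Q t]
    generalize comulT Q t = z
    induction z with
    | zero => simp
    | add x y hx hy => simp only [map_add, hx, hy]
    | tmul a b => simp [mul_comm]
  | cons i w ih =>
    rw [List.cons_append, wordFun_cons, ← ih, comulT_deriv]
    congr 1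
    exact (LinearMap.congr_fun (LinearMap.map_comp_lTensor _ _ _ _) _).symm

/-- Homogeneity holds because each functional sees only one degree. The coideal property is the
duality `wordFun_comulT`: all pairs of functionals kill Δ(t), so Δ(t) dies in the tensor square of
the quotient, and the kernel of that projection is J⊗A + A⊗J. -/
theorem derivRadical_isHopfIdeal (Q : Matrix (Fin s) (Fin s) k) :
    IsHopfIdeal Q (derivRadical Q) where
  twoSided := derivRadical_isTwoSided Q
  homogeneous t ht := by
    obtain ⟨N, hN⟩ := exists_eq_sum_lengthProj t
    rw [hN N le_rfl]
    refine sum_mem fun i _ => Submodule.mem_iSup_of_mem i ?_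
    exact ⟨degProj_mem_derivRadical _ ht, lengthProj_mem i t⟩
  degree t ht := by
    obtain ⟨N, hN⟩ := exists_eq_sum_lengthProj t
    rw [hN N le_rfl]
    refine sum_mem fun i _ => ?_
    match i with
    | 0 => rw [lengthProj_zero Q, ht [], zero_smul]; exact zero_mem _
    | 1 =>
      rw [lengthProj_one Q]
      refine sum_mem fun j _ => ?_
      rw [ht [j], zero_smul]; exact zero_mem _
    | i + 2 =>
      exact Submodule.mem_iSup_of_mem (i + 2)
        (Submodule.mem_iSup_of_mem (by omega) (lengthProj_mem _ t))
  coideal t ht := by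
    have h : TensorProduct.map (commonKer (wordFun Q)).mkQ (commonKer (wordFun Q)).mkQ
        (comulT Q t) = 0 := by
      rw [map_mkQ_eq_zero_iff]
      intro v w
      rw [wordFun_comulT]
      exact ht _
    rw [derivRadical_restrictScalars]
    have hex : Function.Exact (commonKer (wordFun Q)).subtype (commonKer (wordFun Q)).mkQ :=
      LinearMap.exact_subtype_mkQ _
    have hker := TensorProduct.map_ker hex (Submodule.mkQ_surjective _) hex
      (Submodule.mkQ_surjective _)
    rw [← LinearMap.mem_ker, hker, sup_comm] at h
    exact h

/-- Functionals of words of length at most 1 vanish since I starts in length 2. For longer words, I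
is stable under ∂_i = (id ⊗ x_i^*) ∘ Δ, because x_i^* kills the right factors in A ⊗ I. -/
theorem wordFun_eq_zero_of_isHopfIdeal {Q : Matrix (Fin s) (Fin s) k} {I : Ideal (TAlg k s)}
    (hI : IsHopfIdeal Q I) (w : List (Fin s)) {t : TAlg k s} (ht : t ∈ I) :
    wordFun Q w t = 0 := by
  have hshort : ∀ v : List (Fin s), v.length < 2 → ∀ t ∈ I, wordFun Q v t = 0 := by
    intro v hv t ht
    have hle : (⨆ n : ℕ, ⨆ _ : 2 ≤ n, lengthPart k s n) ≤ LinearMap.ker (wordFun Q v) := by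
      refine iSup_le fun n => iSup_le fun hn => Submodule.span_le.2 ?_
      rintro _ ⟨w, hw, rfl⟩
      refine wordFun_word_eq_zero Q v w fun h => ?_
      have := congrArg (fun a : Fin s → ℕ => ∑ i, a i) h
      simp only [sum_wordDeg] at this
      omega
    exact hle (hI.degree ht)
  induction w generalizing t with
  | nil => exact hshort [] (by simp) t ht
  | cons i w ih =>
    rw [wordFun_cons]
    refine ih ?_
    rw [← lTensor_wordFun_letter_comulT]
    have hle : coidealSpace (I.restrictScalars k) ≤ (I.restrictScalars k).comap
        ((TensorProduct.rid k _).toLinearMap ∘ₗ (wordFun Q [i]).lTensor _) := by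
      refine sup_le ?_ ?_
      · rintro _ ⟨y, rfl⟩
        induction y with
        | zero => simp
        | add x y hx hy => rw [map_add]; exact add_mem hx hy
        | tmul a b =>
          simp only [Submodule.mem_comap, LinearMap.comp_apply, LinearEquiv.coe_coe, TensorProduct.map_tmul,
            LinearMap.lTensor_tmul, TensorProduct.rid_tmul]
          exact Submodule.smul_mem _ _ a.2
      · rintro _ ⟨y, rfl⟩
        induction y with
        | zero => simp
        | add x y hx hy => rw [map_add]; exact add_mem hx hy
        | tmul a b =>
          simp only [Submodule.mem_comap, LinearMap.comp_apply, LinearEquiv.coe_coe, TensorProduct.map_tmul,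
            LinearMap.lTensor_tmul, TensorProduct.rid_tmul,
            Submodule.subtype_apply]
          rw [hshort [i] (by simp) _ b.2, zero_smul]
          exact zero_mem _
    exact hle (hI.coideal t ht)

theorem nicholsIdeal_eq_derivRadical (Q : Matrix (Fin s) (Fin s) k) :
    nicholsIdeal Q = derivRadical Q :=
  le_antisymm (sSup_le fun _ hI _ ht w => wordFun_eq_zero_of_isHopfIdeal hI w ht)
    (le_sSup (derivRadical_isHopfIdeal Q))

theorem mem_nicholsIdeal {Q : Matrix (Fin s) (Fin s) k} {t : TAlg k s} :
    t ∈ nicholsIdeal Q ↔ ∀ w, wordFun Q w t = 0 := by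
  rw [nicholsIdeal_eq_derivRadical, mem_derivRadical]

end General

section General

variable {k : Type*} [Field k] {s : ℕ}

/-! ### The structure of the Nichols algebra -/

theorem proj_mul (Q : Matrix (Fin s) (Fin s) k) (a b : TAlg k s) :
    proj Q (a * b) = proj Q a * proj Q b :=
  map_mul (Ideal.Quotient.mkₐ k (nicholsIdeal Q)) a b

theorem proj_one (Q : Matrix (Fin s) (Fin s) k) : proj Q 1 = 1 :=
  map_one (Ideal.Quotient.mkₐ k (nicholsIdeal Q))

theorem proj_surjective (Q : Matrix (Fin s) (Fin s) k) : Function.Surjective (proj Q) :=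
  Ideal.Quotient.mkₐ_surjective k (nicholsIdeal Q)

theorem proj_eq_zero_iff (Q : Matrix (Fin s) (Fin s) k) (t : TAlg k s) :
    proj Q t = 0 ↔ t ∈ nicholsIdeal Q := Ideal.Quotient.eq_zero_iff_mem

/-- The linear map on the Nichols algebra induced by a linear map on `T(V)`. -/
def nLift (Q : Matrix (Fin s) (Fin s) k) {M : Type*} [AddCommGroup M] [Module k M]
    (f : TAlg k s →ₗ[k] M) (hf : ∀ t ∈ nicholsIdeal Q, f t = 0) : NicholsAlg Q →ₗ[k] M :=
  ((nicholsIdeal Q).restrictScalars k).liftQ f hf ∘ₗ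
    (Submodule.Quotient.restrictScalarsEquiv k (nicholsIdeal Q)).symm.toLinearMap

/-- The generator `x_i` of the Nichols algebra. -/
def gen (Q : Matrix (Fin s) (Fin s) k) (i : Fin s) : NicholsAlg Q := proj Q (letter i)

theorem sigma_mem_nicholsIdeal {Q : Matrix (Fin s) (Fin s) k} (i : Fin s) {t : TAlg k s}
    (ht : t ∈ nicholsIdeal Q) : sigma Q i t ∈ nicholsIdeal Q := by
  rw [mem_nicholsIdeal] at ht ⊢
  intro w
  rw [wordFun_sigma, ht, mul_zero]

/-- The diagonal automorphism of the Nichols algebra by which `x_i` acts. -/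
def nSigma (Q : Matrix (Fin s) (Fin s) k) (i : Fin s) : NicholsAlg Q →ₐ[k] NicholsAlg Q :=
  Ideal.Quotient.liftₐ (nicholsIdeal Q)
    ((Ideal.Quotient.mkₐ k (nicholsIdeal Q)).comp (sigma Q i))
    fun _ ht => Ideal.Quotient.eq_zero_iff_mem.2 (sigma_mem_nicholsIdeal i ht)

theorem nSigma_proj (Q : Matrix (Fin s) (Fin s) k) (i : Fin s) (t : TAlg k s) :
    nSigma Q i (proj Q t) = proj Q (sigma Q i t) := rfl

theorem nSigma_gen (Q : Matrix (Fin s) (Fin s) k) (i j : Fin s) :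
    nSigma Q i (gen Q j) = Q i j • gen Q j := by
  rw [gen, nSigma_proj, sigma_letter, map_smul]

/-- The skew derivation `∂_i` of the Nichols algebra. -/
def nDeriv (Q : Matrix (Fin s) (Fin s) k) (i : Fin s) : NicholsAlg Q →ₗ[k] NicholsAlg Q :=
  nLift Q (proj Q ∘ₗ deriv Q i) fun t ht => by
    rw [LinearMap.comp_apply, proj_eq_zero_iff, mem_nicholsIdeal]
    exact fun w => mem_nicholsIdeal.1 ht (i :: w)

theorem nDeriv_proj (Q : Matrix (Fin s) (Fin s) k) (i : Fin s) (t : TAlg k s) :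
    nDeriv Q i (proj Q t) = proj Q (deriv Q i t) := rfl

theorem nDeriv_gen (Q : Matrix (Fin s) (Fin s) k) (i j : Fin s) :
    nDeriv Q i (gen Q j) = if i = j then 1 else 0 := by
  rw [gen, nDeriv_proj, deriv_letter]
  split_ifs
  · exact proj_one Q
  · exact map_zero _

theorem nDeriv_one (Q : Matrix (Fin s) (Fin s) k) (i : Fin s) :
    nDeriv Q i 1 = 0 := by
  rw [← proj_one, nDeriv_proj, deriv_one, map_zero]

theorem nDeriv_mul (Q : Matrix (Fin s) (Fin s) k) (i : Fin s) (a b : NicholsAlg Q) :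
    nDeriv Q i (a * b) = a * nDeriv Q i b + nDeriv Q i a * nSigma Q i b := by
  obtain ⟨a, rfl⟩ := proj_surjective Q a
  obtain ⟨b, rfl⟩ := proj_surjective Q b
  rw [← proj_mul, nDeriv_proj, nDeriv_proj, nDeriv_proj, nSigma_proj, deriv_mul, map_add,
    proj_mul, proj_mul]

/-- The functional on the Nichols algebra induced by `wordFun`. -/
def nFun (Q : Matrix (Fin s) (Fin s) k) (w : List (Fin s)) : NicholsAlg Q →ₗ[k] k :=
  nLift Q (wordFun Q w) fun _ ht => mem_nicholsIdeal.1 ht w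

theorem nFun_proj (Q : Matrix (Fin s) (Fin s) k) (w : List (Fin s)) (t : TAlg k s) :
    nFun Q w (proj Q t) = wordFun Q w t := rfl

theorem eq_zero_of_nFun {Q : Matrix (Fin s) (Fin s) k} {x : NicholsAlg Q}
    (h : ∀ w, nFun Q w x = 0) : x = 0 := by
  obtain ⟨t, rfl⟩ := proj_surjective Q x
  rw [proj_eq_zero_iff, mem_nicholsIdeal]
  exact h

theorem nFun_cons (Q : Matrix (Fin s) (Fin s) k) (i : Fin s) (w : List (Fin s))
    (x : NicholsAlg Q) : nFun Q (i :: w) x = nFun Q w (nDeriv Q i x) := by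
  obtain ⟨t, rfl⟩ := proj_surjective Q x
  rfl

/-- An element of the Nichols algebra without constant term that is killed by all skew derivations
is zero. -/
theorem eq_zero_of_nDeriv {Q : Matrix (Fin s) (Fin s) k} {x : NicholsAlg Q}
    (h0 : nFun Q [] x = 0) (h : ∀ i, nDeriv Q i x = 0) : x = 0 := by
  refine eq_zero_of_nFun fun w => ?_
  cases w with
  | nil => exact h0
  | cons i w => rw [nFun_cons, h, map_zero]

theorem nFun_nil_mul (Q : Matrix (Fin s) (Fin s) k) (a b : NicholsAlg Q) :
    nFun Q [] (a * b) = nFun Q [] a * nFun Q [] b := by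
  obtain ⟨a, rfl⟩ := proj_surjective Q a
  obtain ⟨b, rfl⟩ := proj_surjective Q b
  rw [← proj_mul]
  exact map_mul (counit k s) a b

theorem nFun_nil_gen (Q : Matrix (Fin s) (Fin s) k) (i : Fin s) :
    nFun Q [] (gen Q i) = 0 := counit_letter i

/-- Under the functionals `nFun`, the comultiplication is dual to concatenation. -/
theorem nFun_comul (Q : Matrix (Fin s) (Fin s) k) (v w : List (Fin s)) (x : NicholsAlg Q) :
    TensorProduct.lid k k (TensorProduct.map (nFun Q v) (nFun Q w) (comul Q x)) =
      nFun Q (w ++ v) x := by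
  obtain ⟨t, rfl⟩ := proj_surjective Q x
  rw [comul_proj, nFun_proj, ← wordFun_comulT]
  congr 1
  rw [← LinearMap.comp_apply, ← TensorProduct.map_comp]
  rfl

theorem comul_one (Q : Matrix (Fin s) (Fin s) k) : comul Q 1 = 1 ⊗ₜ 1 := by
  rw [← proj_one, comul_proj, comulT_one, TensorProduct.map_tmul]

/-- Left multiplication by `x_i ⊗ 1 + 1 ⊗ x_i` in the braided tensor square. -/
def nLeftMul (Q : Matrix (Fin s) (Fin s) k) (i : Fin s) :
    NicholsAlg Q ⊗[k] NicholsAlg Q →ₗ[k] NicholsAlg Q ⊗[k] NicholsAlg Q :=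
  TensorProduct.map (LinearMap.mulLeft k (gen Q i)) LinearMap.id +
    TensorProduct.map (nSigma Q i).toLinearMap (LinearMap.mulLeft k (gen Q i))

theorem nLeftMul_tmul (Q : Matrix (Fin s) (Fin s) k) (i : Fin s) (a b : NicholsAlg Q) :
    nLeftMul Q i (a ⊗ₜ b) = (gen Q i * a) ⊗ₜ b + nSigma Q i a ⊗ₜ (gen Q i * b) := rfl

/-- Right multiplication by `x_i ⊗ 1 + 1 ⊗ x_i` in the braided tensor square, for a symmetric
braiding matrix. -/
def nRightMul (Q : Matrix (Fin s) (Fin s) k) (i : Fin s) :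
    NicholsAlg Q ⊗[k] NicholsAlg Q →ₗ[k] NicholsAlg Q ⊗[k] NicholsAlg Q :=
  TensorProduct.map (LinearMap.mulRight k (gen Q i)) (nSigma Q i).toLinearMap +
    TensorProduct.map LinearMap.id (LinearMap.mulRight k (gen Q i))

theorem nRightMul_tmul (Q : Matrix (Fin s) (Fin s) k) (i : Fin s) (a b : NicholsAlg Q) :
    nRightMul Q i (a ⊗ₜ b) = (a * gen Q i) ⊗ₜ nSigma Q i b + a ⊗ₜ (b * gen Q i) := rfl

theorem comul_gen_mul (Q : Matrix (Fin s) (Fin s) k) (i : Fin s) (x : NicholsAlg Q) :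
    comul Q (gen Q i * x) = nLeftMul Q i (comul Q x) := by
  obtain ⟨t, rfl⟩ := proj_surjective Q x
  rw [gen, ← proj_mul, comul_proj, comul_proj, comulT_letter_mul]
  generalize comulT Q t = z
  induction z with
  | zero => simp
  | add x y hx hy => simp only [map_add, hx, hy]
  | tmul a b =>
    simp only [leftMul_tmul, map_add, TensorProduct.map_tmul, nLeftMul_tmul, proj_mul, gen,
      nSigma_proj]

theorem comul_mul_gen {Q : Matrix (Fin s) (Fin s) k} (hQ : Q.transpose = Q) (i : Fin s)
    (x : NicholsAlg Q) : comul Q (x * gen Q i) = nRightMul Q i (comul Q x) := by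
  obtain ⟨t, rfl⟩ := proj_surjective Q x
  rw [gen, ← proj_mul, comul_proj, comul_proj, comulT_mul_letter]
  generalize comulT Q t = z
  induction z with
  | zero => simp
  | add x y hx hy => simp only [map_add, hx, hy]
  | tmul a b =>
    simp only [rightMul_tmul, map_add, TensorProduct.map_tmul, nRightMul_tmul, proj_mul, gen,
      nSigma_proj, hQ]

/-! ### Sums of homogeneous components -/

/-- Each functional is homogeneous. If those of degrees outside `p` vanish on the class of t, then t
and its projection to the degrees in `p` differ by an element of the Nichols ideal. -/
theorem iSup_nicholsDegPart (Q : Matrix (Fin s) (Fin s) k) (p : (Fin s → ℕ) → Prop) :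
    ⨆ a : Fin s → ℕ, ⨆ _ : p a, nicholsDegPart Q a =
      commonKer fun w : {w : List (Fin s) // ¬ p (wordDeg w)} => nFun Q w := by
  apply le_antisymm
  · refine iSup_le fun a => iSup_le fun ha => ?_
    rw [nicholsDegPart, Submodule.map_le_iff_le_comap, degPart, Submodule.span_le]
    rintro _ ⟨w, hw, rfl⟩
    change _ ∈ commonKer _
    rw [mem_commonKer]
    rintro ⟨v, hv⟩
    rw [nFun_proj]
    refine wordFun_word_eq_zero Q v w fun h => hv ?_
    rw [h, hw]; exact ha
  · intro x hx
    rw [mem_commonKer] at hx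
    obtain ⟨t, rfl⟩ := proj_surjective Q x
    have h1 : proj Q t = proj Q (degProj k p t) := by
      rw [← sub_eq_zero, ← map_sub, proj_eq_zero_iff, mem_nicholsIdeal]
      intro w
      rw [map_sub, wordFun_degProj]
      split_ifs with h
      · rw [sub_self]
      · rw [sub_zero]; exact hx ⟨w, h⟩
    have h2 : ∀ t, proj Q (degProj k p t) ∈ ⨆ a, ⨆ _ : p a, nicholsDegPart Q a := by
      intro t
      induction t using word_induction with
      | hw w =>
        rw [degProj_word]
        split_ifs with h
        · exact Submodule.mem_iSup_of_mem (wordDeg w) (Submodule.mem_iSup_of_mem h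
            ⟨word w, Submodule.subset_span ⟨w, rfl, rfl⟩, rfl⟩)
        · rw [map_zero]; exact zero_mem _
      | h0 => rw [map_zero, map_zero]; exact zero_mem _
      | ha x y hx hy => rw [map_add, map_add]; exact add_mem hx hy
      | hs c x hx => rw [map_smul, map_smul]; exact Submodule.smul_mem _ _ hx
    rw [h1]
    exact h2 t

/-- The sum of the homogeneous components of the Nichols algebra of degrees satisfying `p`. -/
def degSum (Q : Matrix (Fin s) (Fin s) k) (p : (Fin s → ℕ) → Prop) : Submodule k (NicholsAlg Q) :=
  ⨆ a : Fin s → ℕ, ⨆ _ : p a, nicholsDegPart Q a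

theorem mem_degSum_of_word {Q : Matrix (Fin s) (Fin s) k} {p p' : (Fin s → ℕ) → Prop}
    (f : NicholsAlg Q →ₗ[k] NicholsAlg Q)
    (hf : ∀ w, p (wordDeg w) → ∃ (c : k) (v : List (Fin s)), p' (wordDeg v) ∧
      f (proj Q (word w)) = c • proj Q (word v))
    {x : NicholsAlg Q} (hx : x ∈ degSum Q p) : f x ∈ degSum Q p' := by
  suffices h : degSum Q p ≤ (degSum Q p').comap f from h hx
  refine iSup_le fun a => iSup_le fun ha => ?_
  rw [nicholsDegPart, Submodule.map_le_iff_le_comap, degPart, Submodule.span_le]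
  rintro _ ⟨w, hw, rfl⟩
  obtain ⟨c, v, hv, h⟩ := hf w (by rw [hw]; exact ha)
  change f (proj Q (word w)) ∈ degSum Q p'
  rw [h]
  exact Submodule.smul_mem _ _ (Submodule.mem_iSup_of_mem (wordDeg v) (Submodule.mem_iSup_of_mem hv
    ⟨word v, Submodule.subset_span ⟨v, rfl, rfl⟩, rfl⟩))

theorem nSigma_mem_degSum {Q : Matrix (Fin s) (Fin s) k} {p : (Fin s → ℕ) → Prop} (i : Fin s)
    {x : NicholsAlg Q} (hx : x ∈ degSum Q p) : nSigma Q i x ∈ degSum Q p :=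
  mem_degSum_of_word (nSigma Q i).toLinearMap
    (fun w hw => ⟨weight Q i w, w, hw, by
      rw [AlgHom.toLinearMap_apply, nSigma_proj, sigma_word, map_smul]⟩) hx

theorem gen_mul_mem_degSum {Q : Matrix (Fin s) (Fin s) k} {p p' : (Fin s → ℕ) → Prop} (i : Fin s)
    (h : ∀ a, p a → p' (wordDeg [i] + a)) {x : NicholsAlg Q} (hx : x ∈ degSum Q p) :
    gen Q i * x ∈ degSum Q p' :=
  mem_degSum_of_word (LinearMap.mulLeft k (gen Q i))
    (fun w hw => ⟨1, i :: w, by rw [wordDeg_cons]; exact h _ hw, by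
      rw [one_smul, word_cons, proj_mul]; rfl⟩) hx

theorem mul_gen_mem_degSum {Q : Matrix (Fin s) (Fin s) k} {p p' : (Fin s → ℕ) → Prop} (i : Fin s)
    (h : ∀ a, p a → p' (wordDeg [i] + a)) {x : NicholsAlg Q} (hx : x ∈ degSum Q p) :
    x * gen Q i ∈ degSum Q p' :=
  mem_degSum_of_word (LinearMap.mulRight k (gen Q i))
    (fun w hw => ⟨1, w ++ [i], by rw [wordDeg_append, add_comm]; exact h _ hw, by
      rw [one_smul, word_append, proj_mul]; rfl⟩) hx

theorem one_mem_degSum {Q : Matrix (Fin s) (Fin s) k} {p : (Fin s → ℕ) → Prop}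
    (h : p 0) : (1 : NicholsAlg Q) ∈ degSum Q p := by
  rw [← proj_one]
  exact Submodule.mem_iSup_of_mem 0 (Submodule.mem_iSup_of_mem h
    ⟨1, Submodule.subset_span ⟨[], by funext i; simp [wordDeg], rfl⟩, rfl⟩)

/-! ### Subspaces cut out by sets of words -/

/-- The common kernel of the functionals `nFun` for a set of words. -/
def vanishOn (Q : Matrix (Fin s) (Fin s) k) (S : Set (List (Fin s))) : Submodule k (NicholsAlg Q) :=
  commonKer fun w : S => nFun Q w

theorem mem_vanishOn {Q : Matrix (Fin s) (Fin s) k} {S : Set (List (Fin s))} {x : NicholsAlg Q} :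
    x ∈ vanishOn Q S ↔ ∀ w ∈ S, nFun Q w x = 0 := by
  rw [vanishOn, mem_commonKer, Subtype.forall]

theorem degSum_eq_vanishOn (Q : Matrix (Fin s) (Fin s) k) (p : (Fin s → ℕ) → Prop) :
    degSum Q p = vanishOn Q {w | ¬ p (wordDeg w)} :=
  iSup_nicholsDegPart Q p

theorem comul_mem_range_iff {Q : Matrix (Fin s) (Fin s) k} {S : Set (List (Fin s))}
    {x : NicholsAlg Q} :
    comul Q x ∈ LinearMap.range (TensorProduct.map (vanishOn Q S).subtype
      (LinearMap.id : NicholsAlg Q →ₗ[k] NicholsAlg Q)) ↔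
      ∀ v ∈ S, ∀ w, nFun Q (w ++ v) x = 0 := by
  rw [vanishOn, mem_range_map_subtype_iff _ (nFun Q) fun _ => eq_zero_of_nFun]
  simp only [nFun_comul, Subtype.forall]

theorem map_mkQ_comul_eq_zero_iff {Q : Matrix (Fin s) (Fin s) k} {S S' : Set (List (Fin s))}
    {x : NicholsAlg Q} :
    TensorProduct.map (vanishOn Q S).mkQ (vanishOn Q S').mkQ (comul Q x) = 0 ↔
      ∀ v ∈ S, ∀ w ∈ S', nFun Q (w ++ v) x = 0 := by
  rw [vanishOn, vanishOn, map_mkQ_eq_zero_iff]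
  simp only [nFun_comul, Subtype.forall]

end General

/-! ### The spaces `K_{≥1}` and `K_{>1}` -/

/-- The (reversed) words that have a beginning with fewer letters `x_1` than letters `x_2`. -/
def dipWords : Set (List (Fin 2)) := {s | ∃ w v, s = w ++ v ∧ wordDeg v 0 < wordDeg v 1}

/-- The words that have at most as many letters `x_1` as letters `x_2`. -/
def lowWords : Set (List (Fin 2)) := {s | wordDeg s 0 ≤ wordDeg s 1}

theorem append_mem_dipWords {v : List (Fin 2)} (w : List (Fin 2)) (hv : v ∈ dipWords) :
    w ++ v ∈ dipWords := by
  obtain ⟨w', v', rfl, h⟩ := hv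
  exact ⟨w ++ w', v', (List.append_assoc _ _ _).symm, h⟩

theorem dipWords_append_lowWords {v w : List (Fin 2)} (hw : w ∈ dipWords) (hv : v ∈ lowWords) :
    w ++ v ∈ dipWords := by
  obtain ⟨w', v', rfl, h⟩ := hw
  refine ⟨w', v' ++ v, List.append_assoc _ _ _, ?_⟩
  rw [wordDeg_append]
  exact add_lt_add_of_lt_of_le h hv

theorem append_mem_lowWords {v w : List (Fin 2)} (hw : w ∈ lowWords) (hv : v ∈ lowWords) :
    w ++ v ∈ lowWords := by
  change wordDeg (w ++ v) 0 ≤ wordDeg (w ++ v) 1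
  rw [wordDeg_append]
  exact add_le_add hw hv

theorem append_mem_dipWords_union {v w : List (Fin 2)} (hw : w ∈ dipWords ∪ lowWords)
    (hv : v ∈ dipWords ∪ lowWords) : w ++ v ∈ dipWords ∪ lowWords := by
  rcases hv with hv | hv
  · exact Or.inl (append_mem_dipWords w hv)
  · rcases hw with hw | hw
    · exact Or.inl (dipWords_append_lowWords hw hv)
    · exact Or.inr (append_mem_lowWords hw hv)

theorem BGe_eq_degSum (q : ℂ) : BGe q = degSum (braidMat q) fun a => a 1 ≤ a 0 := rfl

theorem BGt_eq_degSum (q : ℂ) : BGt q = degSum (braidMat q) fun a => a 1 < a 0 := rfl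

/-- The left tensor factor of Δ is paired with the end of the word, hence the condition on suffixes.
-/
theorem KGe_eq_vanishOn (q : ℂ) : KGe q = vanishOn (braidMat q) dipWords := by
  ext x
  rw [KGe, Submodule.mem_comap, BGe_eq_degSum, degSum_eq_vanishOn]
  refine comul_mem_range_iff.trans ?_
  rw [mem_vanishOn]
  constructor
  · rintro h _ ⟨w, v, rfl, hv⟩
    exact h v (not_le.2 hv) w
  · intro h v hv w
    exact h _ ⟨w, v, rfl, not_le.1 hv⟩

theorem KGt_eq_vanishOn (q : ℂ) : KGt q = vanishOn (braidMat q) (dipWords ∪ lowWords) := by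
  ext x
  rw [KGt, Submodule.mem_inf, KGe_eq_vanishOn, BGt_eq_degSum, degSum_eq_vanishOn]
  simp only [mem_vanishOn]
  constructor
  · rintro ⟨h1, h2⟩ w (hw | hw)
    · exact h1 w hw
    · exact h2 w (not_lt.2 hw)
  · intro h
    exact ⟨fun w hw => h w (Or.inl hw), fun w hw => h w (Or.inr (not_lt.1 hw))⟩

/-! ### The induced comultiplication -/

theorem subQIncl_cls (x : B q) (hx : x ∈ KGe q) : subQIncl q (cls q x hx) = (KGt q).mkQ x := rfl

theorem subQIncl_injective (q : ℂ) : Function.Injective (subQIncl q) := by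
  rw [← LinearMap.ker_eq_bot]
  exact Submodule.ker_liftQ_eq_bot _ _ _ (by rw [LinearMap.ker_comp, Submodule.ker_mkQ])

theorem KGt_le_KGe (q : ℂ) : KGt q ≤ KGe q := inf_le_left

/-- The projection of `B(𝕍) / K_{>1}` onto `B(𝕍) / K_{≥1}`. -/
def quotProj (q : ℂ) : B q ⧸ KGt q →ₗ[ℂ] B q ⧸ KGe q :=
  Submodule.mapQ _ _ LinearMap.id (KGt_le_KGe q)

theorem quotProj_surjective (q : ℂ) : Function.Surjective (quotProj q) := by
  intro x
  obtain ⟨x, rfl⟩ := Submodule.mkQ_surjective _ x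
  exact ⟨(KGt q).mkQ x, rfl⟩

theorem exact_subQIncl_quotProj (q : ℂ) : Function.Exact (subQIncl q) (quotProj q) := by
  intro x
  obtain ⟨x, rfl⟩ := Submodule.mkQ_surjective _ x
  constructor
  · intro h
    have hx : x ∈ KGe q := (Submodule.Quotient.mk_eq_zero _).1 h
    exact ⟨cls q x hx, rfl⟩
  · rintro ⟨y, hy⟩
    obtain ⟨y, rfl⟩ := Submodule.mkQ_surjective _ y
    rw [← hy]
    exact (Submodule.Quotient.mk_eq_zero (KGe q)).2 y.2

/-- By exactness it suffices that the left factor dies modulo K_{≥1}: anything followed by a dip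
word is a dip word. -/
theorem map_mkQ_comulB_mem_range_left {x : B q} (hx : x ∈ KGe q) :
    TensorProduct.map (KGt q).mkQ (KGt q).mkQ (comulB q x) ∈
      LinearMap.range ((subQIncl q).rTensor (B q ⧸ KGt q)) := by
  have hex := rTensor_exact (B q ⧸ KGt q) (exact_subQIncl_quotProj q) (quotProj_surjective q)
  refine (hex _).1 ?_
  rw [← LinearMap.comp_apply, LinearMap.rTensor_comp_map]
  change TensorProduct.map (KGe q).mkQ (KGt q).mkQ (comulB q x) = 0
  rw [KGe_eq_vanishOn, mem_vanishOn] at hx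
  rw [KGe_eq_vanishOn, KGt_eq_vanishOn, map_mkQ_comul_eq_zero_iff]
  exact fun v hv w _ => hx _ (append_mem_dipWords w hv)

/-- Here the second word ranges only over what K_{>1} annihilates, so it cannot repair the deficit
of a dip word placed before it. -/
theorem map_mkQ_comulB_mem_range_right {x : B q} (hx : x ∈ KGe q) :
    TensorProduct.map (KGt q).mkQ (KGt q).mkQ (comulB q x) ∈
      LinearMap.range ((subQIncl q).lTensor (B q ⧸ KGt q)) := by
  have hex := lTensor_exact (B q ⧸ KGt q) (exact_subQIncl_quotProj q) (quotProj_surjective q)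
  refine (hex _).1 ?_
  rw [← LinearMap.comp_apply, LinearMap.lTensor_comp_map]
  change TensorProduct.map (KGt q).mkQ (KGe q).mkQ (comulB q x) = 0
  rw [KGe_eq_vanishOn, mem_vanishOn] at hx
  rw [KGe_eq_vanishOn, KGt_eq_vanishOn, map_mkQ_comul_eq_zero_iff]
  rintro v (hv | hv) w hw
  · exact hx _ (append_mem_dipWords w hv)
  · exact hx _ (dipWords_append_lowWords hw hv)

theorem map_mkQ_comulB_eq_zero {x : B q} (hx : x ∈ KGt q) :
    TensorProduct.map (KGt q).mkQ (KGt q).mkQ (comulB q x) = 0 := by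
  rw [KGt_eq_vanishOn, mem_vanishOn] at hx
  rw [KGt_eq_vanishOn, map_mkQ_comul_eq_zero_iff]
  exact fun v hv w hw => hx _ (append_mem_dipWords_union hw hv)

theorem exists_retraction (q : ℂ) :
    ∃ e : B q ⧸ KGt q →ₗ[ℂ] SubQ q, e ∘ₗ subQIncl q = LinearMap.id :=
  LinearMap.exists_leftInverse_of_injective _ (LinearMap.ker_eq_bot.2 (subQIncl_injective q))

theorem map_subQIncl_injective (q : ℂ) :
    Function.Injective (TensorProduct.map (subQIncl q) (subQIncl q)) := by
  obtain ⟨e, he⟩ := exists_retraction q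
  refine Function.LeftInverse.injective (g := TensorProduct.map e e) fun x => ?_
  rw [← LinearMap.comp_apply, ← TensorProduct.map_comp, he, TensorProduct.map_id,
    LinearMap.id_apply]

theorem exists_isInducedComul (q : ℂ) : ∃ δ, IsInducedComul q δ := by
  obtain ⟨e, he⟩ := exists_retraction q
  set Φ : KGe q →ₗ[ℂ] SubQ q ⊗[ℂ] SubQ q :=
    TensorProduct.map e e ∘ₗ TensorProduct.map (KGt q).mkQ (KGt q).mkQ ∘ₗ comulB q ∘ₗ
      (KGe q).subtype with hΦ
  refine ⟨Submodule.liftQ _ Φ ?_, ?_⟩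
  · intro x hx
    change TensorProduct.map e e
      (TensorProduct.map (KGt q).mkQ (KGt q).mkQ (comulB q x.1)) = 0
    rw [map_mkQ_comulB_eq_zero (x := x.1) hx, map_zero]
  · intro x hx
    change TensorProduct.map (subQIncl q) (subQIncl q) (TensorProduct.map e e
      (TensorProduct.map (KGt q).mkQ (KGt q).mkQ (comulB q x))) = _
    -- Retracting and including again is the identity on the range of each one-sided inclusion; the
    -- image of Δ(x) lies in both ranges.
    have h1 : ∀ z ∈ LinearMap.range ((subQIncl q).rTensor (B q ⧸ KGt q)),
        (subQIncl q ∘ₗ e).rTensor _ z = z := by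
      rintro _ ⟨y, rfl⟩
      rw [← LinearMap.rTensor_comp_apply, LinearMap.comp_assoc, he, LinearMap.comp_id]
    have h2 : ∀ z ∈ LinearMap.range ((subQIncl q).lTensor (B q ⧸ KGt q)),
        (subQIncl q ∘ₗ e).lTensor _ z = z := by
      rintro _ ⟨y, rfl⟩
      rw [← LinearMap.lTensor_comp_apply, LinearMap.comp_assoc, he, LinearMap.comp_id]
    rw [← LinearMap.comp_apply, ← TensorProduct.map_comp, ← LinearMap.rTensor_comp_lTensor,
      LinearMap.comp_apply, h2 _ (map_mkQ_comulB_mem_range_right hx),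
      h1 _ (map_mkQ_comulB_mem_range_left hx)]

theorem IsInducedComul.unique {δ δ' : SubQ q →ₗ[ℂ] SubQ q ⊗[ℂ] SubQ q}
    (h : IsInducedComul q δ) (h' : IsInducedComul q δ') : δ' = δ := by
  refine LinearMap.ext fun x => map_subQIncl_injective q ?_
  obtain ⟨x, rfl⟩ := Submodule.mkQ_surjective _ x
  exact (h' x.1 x.2).trans (h x.1 x.2).symm

section General

variable {k : Type*} [Field k] {s : ℕ}

/-! ### Super-letters -/

theorem superLetter_of_isLyndonCut (Q : Matrix (Fin s) (Fin s) k) {u : List (Fin s)} {n : ℕ}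
    (h : IsLyndonCut u n) (hmin : ∀ m < n, ¬ IsLyndonCut u m) :
    superLetter Q u = bracket Q (superLetter Q (u.take n)) (superLetter Q (u.drop n)) := by
  classical
  have hex : ∃ n, IsLyndonCut u n := ⟨n, h⟩
  have hf : Nat.find hex = n := (Nat.find_eq_iff hex).2 ⟨h, hmin⟩
  rw [superLetter, dif_pos hex]
  subst hf
  congr!

theorem superLetter_singleton (Q : Matrix (Fin s) (Fin s) k) (i : Fin s) :
    superLetter Q [i] = letter i := by
  have h : ¬ ∃ n, IsLyndonCut [i] n := by
    rintro ⟨n, h0, h1, _⟩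
    simp at h1
    omega
  rw [superLetter, dif_neg h, letter]

theorem isLyndon_singleton (i : Fin s) : IsLyndon [i] := by
  refine ⟨by simp, fun v w hv hw h => ?_⟩
  have := congrArg List.length h
  rw [List.length_append] at this
  have h1 := List.length_pos_iff.2 hv
  have h2 := List.length_pos_iff.2 hw
  simp at this
  omega

theorem mul_mem_degPart {a b : Fin s → ℕ} {x y : TAlg k s} (hx : x ∈ degPart k a)
    (hy : y ∈ degPart k b) : x * y ∈ degPart k (a + b) := by
  refine Submodule.span_induction₂ (p := fun x y _ _ => x * y ∈ degPart k (a + b))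
    ?_ ?_ ?_ ?_ ?_ ?_ ?_ hx hy
  · rintro _ _ ⟨v, rfl, rfl⟩ ⟨w, rfl, rfl⟩
    exact Submodule.subset_span ⟨v ++ w, wordDeg_append v w, (word_append v w).symm⟩
  · intros; simp
  · intros; simp
  · intro x y z _ _ _ h1 h2; rw [add_mul]; exact add_mem h1 h2
  · intro x y z _ _ _ h1 h2; rw [mul_add]; exact add_mem h1 h2
  · intro r x y _ _ h; rw [smul_mul_assoc]; exact Submodule.smul_mem _ _ h
  · intro r x y _ _ h; rw [mul_smul_comm]; exact Submodule.smul_mem _ _ h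

theorem braiding_of_mem_degPart (Q : Matrix (Fin s) (Fin s) k) {a b : Fin s → ℕ} {x y : TAlg k s}
    (hx : x ∈ degPart k a) (hy : y ∈ degPart k b) :
    braiding Q (x ⊗ₜ y) = chi Q a b • (y ⊗ₜ[k] x) := by
  refine Submodule.span_induction₂
    (p := fun x y _ _ => braiding Q (x ⊗ₜ y) = chi Q a b • (y ⊗ₜ[k] x))
    ?_ ?_ ?_ ?_ ?_ ?_ ?_ hx hy
  · rintro _ _ ⟨v, rfl, rfl⟩ ⟨w, rfl, rfl⟩
    exact braiding_word_word Q v w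
  · intros; simp
  · intros; simp
  · intro x y z _ _ _ h1 h2
    rw [TensorProduct.add_tmul, map_add, h1, h2, TensorProduct.tmul_add, smul_add]
  · intro x y z _ _ _ h1 h2
    rw [TensorProduct.tmul_add, map_add, h1, h2, TensorProduct.add_tmul, smul_add]
  · intro r x y _ _ h
    rw [← TensorProduct.smul_tmul', map_smul, h, TensorProduct.tmul_smul, smul_comm]
  · intro r x y _ _ h
    rw [TensorProduct.tmul_smul, map_smul, h, ← TensorProduct.smul_tmul', smul_comm]

theorem bracket_of_mem_degPart (Q : Matrix (Fin s) (Fin s) k) {a b : Fin s → ℕ} {x y : TAlg k s}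
    (hx : x ∈ degPart k a) (hy : y ∈ degPart k b) :
    bracket Q x y = x * y - chi Q a b • (y * x) := by
  rw [bracket, braiding_of_mem_degPart Q hx hy]
  simp

theorem bracket_mem_degPart (Q : Matrix (Fin s) (Fin s) k) {a b : Fin s → ℕ} {x y : TAlg k s}
    (hx : x ∈ degPart k a) (hy : y ∈ degPart k b) : bracket Q x y ∈ degPart k (a + b) := by
  rw [bracket_of_mem_degPart Q hx hy]
  refine sub_mem (mul_mem_degPart hx hy) (Submodule.smul_mem _ _ ?_)
  rw [add_comm]
  exact mul_mem_degPart hy hx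

end General

/-! ### The Lyndon words `x_1 x_2`, `x_1 x_1 x_2` and `(x_1 x_2)^n x_2` -/

/-- The word `(x_1 x_2)^n x_2`. -/
def yWord (n : ℕ) : List (Fin 2) := (List.replicate n [0, 1]).flatten ++ [1]

theorem yWord_succ (n : ℕ) : yWord (n + 1) = 0 :: 1 :: yWord n := by
  simp [yWord, List.replicate_succ]

theorem yWord_zero : yWord 0 = [1] := rfl

/-- Removing one letter leaves a word beginning with x_2; removing two leaves the previous word,
which is larger (`hlt`); shorter suffixes are suffixes of that word and are handled by induction. -/
theorem isLyndon_yWord (n : ℕ) : IsLyndon (yWord n) := by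
  induction n with
  | zero => exact isLyndon_singleton 1
  | succ n ih =>
    have hlt : ∀ n, yWord (n + 1) < yWord n := by
      intro n
      induction n with
      | zero => rw [yWord_succ, yWord_zero]; decide
      | succ n ih =>
        rw [yWord_succ, yWord_succ n, List.cons_lt_cons_iff, List.cons_lt_cons_iff]
        exact Or.inr ⟨rfl, Or.inr ⟨rfl, by rwa [← yWord_succ]⟩⟩
    refine ⟨by rw [yWord_succ]; simp, fun v w hv hw h => ?_⟩
    match v, hv with
    | [a], _ =>
      rw [yWord_succ] at h ⊢
      simp only [List.cons_append, List.nil_append, List.cons.injEq] at h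
      rw [← h.2, List.cons_lt_cons_iff]
      exact Or.inl (by decide)
    | [a, b], _ =>
      have h' := h
      rw [yWord_succ] at h'
      simp only [List.cons_append, List.nil_append, List.cons.injEq] at h'
      rw [← h'.2.2]
      exact hlt n
    | a :: b :: c :: v, _ =>
      have h' := h
      rw [yWord_succ] at h'
      simp only [List.cons_append, List.cons.injEq] at h'
      exact lt_trans (hlt n) (ih.2 (c :: v) w (by simp) hw h'.2.2)

theorem isLyndon_zero_one : IsLyndon ([0, 1] : List (Fin 2)) := by
  refine ⟨by simp, fun v w hv hw h => ?_⟩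
  match v, hv with
  | [a], _ =>
    simp only [List.cons_append, List.nil_append, List.cons.injEq] at h
    rw [← h.2]; decide
  | a :: b :: v, _ =>
    simp only [List.cons_append, List.cons.injEq] at h
    exact absurd (List.append_eq_nil_iff.1 h.2.2.symm).2 hw

theorem superLetter_zero_one (q : ℂ) :
    superLetter (braidMat q) [0, 1] = bracket (braidMat q) (letter 0) (letter 1) := by
  rw [superLetter_of_isLyndonCut (braidMat q) (n := 1)]
  · simp only [List.take, List.drop, superLetter_singleton]
  · exact ⟨by simp, by simp, isLyndon_singleton 0, isLyndon_singleton 1⟩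
  · intro m hm h
    have := h.1
    omega

theorem X_one (q : ℂ) : X q 1 = letter 0 := superLetter_singleton _ _

theorem X_two (q : ℂ) : X q 2 = bracket (braidMat q) (letter 0) (superLetter (braidMat q) [0, 1]) := by
  change superLetter (braidMat q) [0, 0, 1] = _
  rw [superLetter_of_isLyndonCut (braidMat q) (n := 1)]
  · simp only [List.take, List.drop, superLetter_singleton]
  · exact ⟨by simp, by simp, isLyndon_singleton 0, isLyndon_zero_one⟩
  · intro m hm h
    have := h.1
    omega

theorem Y_one (q : ℂ) : Y q 1 = letter 1 := superLetter_singleton _ _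

theorem Y_eq (q : ℂ) (n : ℕ) : Y q (n + 1) = superLetter (braidMat q) (yWord n) := rfl

theorem Y_add_two (q : ℂ) (n : ℕ) :
    Y q (n + 2) = bracket (braidMat q) (superLetter (braidMat q) [0, 1]) (Y q (n + 1)) := by
  rw [Y_eq, Y_eq, yWord_succ, superLetter_of_isLyndonCut (braidMat q) (n := 2)]
  · simp only [List.take, List.drop]
  · refine ⟨by simp, ?_, isLyndon_zero_one, isLyndon_yWord n⟩
    simp [yWord]
  · intro m hm h
    have h0 := h.1
    obtain rfl : m = 1 := by omega
    have h1 : IsLyndon (1 :: yWord n) := h.2.2.2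
    -- A cut after one letter leaves a word that both begins and ends with x_2; its suffix `[1]` is
    -- also a proper prefix, hence smaller, so the word is not Lyndon.
    have h2 : ∃ v, v ≠ [] ∧ 1 :: yWord n = v ++ [1] :=
      ⟨1 :: (List.replicate n [0, 1]).flatten, by simp, rfl⟩
    obtain ⟨v, hv, h2⟩ := h2
    have h3 := h1.2 v [1] hv (by simp) h2
    rw [List.cons_lt_cons_iff] at h3
    rcases h3 with h3 | ⟨_, h3⟩
    · exact absurd h3 (by decide)
    · exact absurd h3 (List.not_lt_nil _)

/-! ### Degrees -/

theorem chi_braidMat {q : ℂ} (a b : Fin 2 → ℕ) :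
    chi (braidMat q) a b =
      q ^ (a 0 * b 0) * q⁻¹ ^ (a 0 * b 1) * (q⁻¹ ^ (a 1 * b 0) * (-q) ^ (a 1 * b 1)) := by
  simp [chi, braidMat, Fin.prod_univ_two]

theorem letter_mem_degPart_zero : (letter 0 : TAlg ℂ 2) ∈ degPart ℂ ![1, 0] :=
  Submodule.subset_span ⟨[0], by funext i; fin_cases i <;> simp [wordDeg], rfl⟩

theorem letter_mem_degPart_one : (letter 1 : TAlg ℂ 2) ∈ degPart ℂ ![0, 1] :=
  Submodule.subset_span ⟨[1], by funext i; fin_cases i <;> simp [wordDeg], rfl⟩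

theorem superLetter_zero_one_mem (q : ℂ) :
    superLetter (braidMat q) [0, 1] ∈ degPart ℂ ![1, 1] := by
  rw [superLetter_zero_one]
  convert bracket_mem_degPart _ letter_mem_degPart_zero letter_mem_degPart_one using 2
  simp

theorem X_two_mem (q : ℂ) : X q 2 ∈ degPart ℂ ![2, 1] := by
  rw [X_two]
  convert bracket_mem_degPart _ letter_mem_degPart_zero (superLetter_zero_one_mem q) using 2
  simp

theorem Y_mem (q : ℂ) (n : ℕ) : Y q (n + 1) ∈ degPart ℂ ![n, n + 1] := by
  induction n with
  | zero => rw [Y_one]; exact letter_mem_degPart_one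
  | succ n ih =>
    rw [Y_add_two]
    convert bracket_mem_degPart _ (superLetter_zero_one_mem q) ih using 2
    simp [add_comm]

theorem superLetter_zero_one_eq : superLetter (braidMat q) [0, 1] =
    letter 0 * letter 1 - q⁻¹ • (letter 1 * letter 0) := by
  rw [superLetter_zero_one,
    bracket_of_mem_degPart _ letter_mem_degPart_zero letter_mem_degPart_one, chi_braidMat]
  simp

theorem X_two_eq (hq : q ≠ 0) : X q 2 = letter 0 * superLetter (braidMat q) [0, 1] -
    superLetter (braidMat q) [0, 1] * letter 0 := by
  rw [X_two, bracket_of_mem_degPart _ letter_mem_degPart_zero (superLetter_zero_one_mem q),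
    chi_braidMat]
  simp [hq]

/-- All powers of q cancel in χ(α_1 + α_2, deg Y_{n+1}), leaving a sign that alternates with n. -/
theorem Y_add_two_eq (hq : q ≠ 0) (n : ℕ) : Y q (n + 2) =
    superLetter (braidMat q) [0, 1] * Y q (n + 1) +
      (-1 : ℂ) ^ n • (Y q (n + 1) * superLetter (braidMat q) [0, 1]) := by
  have h : chi (braidMat q) ![1, 1] ![n, n + 1] = -(-1 : ℂ) ^ n := by
    rw [chi_braidMat]
    simp only [Matrix.cons_val_zero, Matrix.cons_val_one, one_mul]
    rw [neg_pow q, inv_pow, inv_pow, pow_succ, pow_succ]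
    field_simp
  rw [Y_add_two, bracket_of_mem_degPart _ (superLetter_zero_one_mem q) (Y_mem q n), h, neg_smul,
    sub_neg_eq_add]

theorem bracket_X_one_Y (hq : q ≠ 0) (n : ℕ) : bracket (braidMat q) (X q 1) (Y q (n + 1)) =
    letter 0 * Y q (n + 1) - q⁻¹ • (Y q (n + 1) * letter 0) := by
  have h : chi (braidMat q) ![1, 0] ![n, n + 1] = q⁻¹ := by
    rw [chi_braidMat]
    simp only [Matrix.cons_val_zero, Matrix.cons_val_one, one_mul, zero_mul, pow_zero, mul_one]
    rw [inv_pow, pow_succ]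
    field_simp
  rw [X_one, bracket_of_mem_degPart _ letter_mem_degPart_zero (Y_mem q n), h]

theorem bracket_X_two_Y (hq : q ≠ 0) (n : ℕ) : bracket (braidMat q) (X q 2) (Y q (n + 1)) =
    X q 2 * Y q (n + 1) + ((-1) ^ n * q⁻¹) • (Y q (n + 1) * X q 2) := by
  have h : chi (braidMat q) ![2, 1] ![n, n + 1] = -((-1 : ℂ) ^ n * q⁻¹) := by
    rw [chi_braidMat]
    simp only [Matrix.cons_val_zero, Matrix.cons_val_one, one_mul]
    rw [neg_pow q, inv_pow, inv_pow, pow_succ, mul_add, pow_add, pow_succ, two_mul, pow_add]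
    field_simp
    ring
  rw [bracket_of_mem_degPart _ (X_two_mem q) (Y_mem q n), h, neg_smul, sub_neg_eq_add]

/-! ### Elements of `B(𝕍)` and their skew derivatives -/

/-- The generator `x_1` of `B(𝕍)`. -/
def x1 (q : ℂ) : B q := gen (braidMat q) 0

/-- The generator `x_2` of `B(𝕍)`. -/
def x2 (q : ℂ) : B q := gen (braidMat q) 1

/-- The bracket of `x_1` and `x_2`. -/
def br (q : ℂ) : B q := x1 q * x2 q - q⁻¹ • (x2 q * x1 q)

/-- The class of the super-letter `X_2`. -/
def bX2 (q : ℂ) : B q := x1 q * br q - br q * x1 q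

/-- The class of the super-letter `X_3`. -/
def bX3 (q : ℂ) : B q := bX2 q * br q + br q * bX2 q

/-- The class of the super-letter `Y_{n+1}`. -/
def bY (q : ℂ) (n : ℕ) : B q := proj (braidMat q) (Y q (n + 1))

theorem proj_superLetter_zero_one : proj (braidMat q) (superLetter (braidMat q) [0, 1]) = br q := by
  rw [superLetter_zero_one_eq, map_sub, map_smul, proj_mul, proj_mul]
  rfl

theorem proj_X_two (hq : q ≠ 0) : proj (braidMat q) (X q 2) = bX2 q := by
  rw [X_two_eq hq, map_sub, proj_mul, proj_mul, proj_superLetter_zero_one]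
  rfl

theorem bY_zero : bY q 0 = x2 q := by rw [bY, Y_one]; rfl

theorem bY_succ (hq : q ≠ 0) (n : ℕ) :
    bY q (n + 1) = br q * bY q n + (-1 : ℂ) ^ n • (bY q n * br q) := by
  rw [bY, Y_add_two_eq hq, map_add, map_smul, proj_mul, proj_mul, proj_superLetter_zero_one]
  rfl

theorem L_zero : L q 0 = (theta q)⁻¹ • 1 := by
  rw [L, preL, map_smul, proj_one, one_div]

theorem L'_zero : L' q 0 = (theta q)⁻¹ • 1 := by
  rw [L', preL', map_smul, proj_one, one_div]

theorem L_succ (hq : q ≠ 0) (n : ℕ) :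
    L q (n + 1) = x1 q * bY q n - q⁻¹ • (bY q n * x1 q) := by
  rw [L, preL, bracket_X_one_Y hq, map_sub, map_smul, proj_mul, proj_mul]
  rfl

theorem L_one (hq : q ≠ 0) : L q 1 = br q := by
  rw [L_succ hq, bY_zero, br]

theorem L'_one (hq : q ≠ 0) : L' q 1 = br q := L_one hq

theorem L'_add_two (hq : q ≠ 0) (n : ℕ) :
    L' q (n + 2) = bX2 q * bY q n + ((-1) ^ n * q⁻¹) • (bY q n * bX2 q) := by
  rw [L', preL', bracket_X_two_Y hq, map_add, map_smul, proj_mul, proj_mul, proj_X_two hq]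
  rfl

theorem x1_mul_br : x1 q * br q = br q * x1 q + bX2 q := by rw [bX2]; abel

theorem bX2_mul_br : bX2 q * br q = bX3 q - br q * bX2 q := by rw [bX3]; abel

/-- `L_{n+1} = L'_{n+1} + [u, L_n]` for the bracket `u` of `x_1` and `x_2`. -/
theorem L_succ_eq (hq : q ≠ 0) (n : ℕ) :
    L q (n + 1) = L' q (n + 1) + br q * L q n - (-1 : ℂ) ^ n • (L q n * br q) := by
  cases n with
  | zero => rw [L_one hq, L'_one hq, L_zero]; simp
  | succ n =>
    rw [L'_add_two hq, L_succ hq, L_succ hq, bY_succ hq, bX2]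
    simp only [mul_add, add_mul, mul_sub, sub_mul, smul_mul_assoc, mul_smul_comm, smul_smul,
      mul_assoc, smul_add, smul_sub]
    match_scalars <;> field_simp <;> ring

/-! ### Weights -/

/-- The automorphism `σ_1` of `B(𝕍)`. -/
abbrev sg1 (q : ℂ) : B q →ₐ[ℂ] B q := nSigma (braidMat q) 0

/-- The automorphism `σ_2` of `B(𝕍)`. -/
abbrev sg2 (q : ℂ) : B q →ₐ[ℂ] B q := nSigma (braidMat q) 1

theorem sg1_x1 : sg1 q (x1 q) = q • x1 q := nSigma_gen _ _ _
theorem sg1_x2 : sg1 q (x2 q) = q⁻¹ • x2 q := nSigma_gen _ _ _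
theorem sg2_x1 : sg2 q (x1 q) = q⁻¹ • x1 q := nSigma_gen _ _ _
theorem sg2_x2 : sg2 q (x2 q) = (-q) • x2 q := nSigma_gen _ _ _

theorem sg1_br (hq : q ≠ 0) : sg1 q (br q) = br q := by
  simp only [br, map_sub, map_smul, map_mul, sg1_x1, sg1_x2, smul_mul_assoc, mul_smul_comm,
    smul_smul]
  match_scalars <;> field_simp

theorem sg2_br (hq : q ≠ 0) : sg2 q (br q) = -br q := by
  simp only [br, map_sub, map_smul, map_mul, sg2_x1, sg2_x2, smul_mul_assoc, mul_smul_comm,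
    smul_smul]
  match_scalars <;> field_simp

theorem sg1_bX2 (hq : q ≠ 0) : sg1 q (bX2 q) = q • bX2 q := by
  simp only [bX2, map_sub, map_mul, sg1_x1, sg1_br hq, smul_mul_assoc, mul_smul_comm, smul_sub]

theorem sg2_bX2 (hq : q ≠ 0) : sg2 q (bX2 q) = (-q⁻¹) • bX2 q := by
  simp only [bX2, map_sub, map_mul, sg2_x1, sg2_br hq, smul_mul_assoc, mul_smul_comm, smul_sub,
    mul_neg, neg_mul]
  module

theorem sg2_bX3 (hq : q ≠ 0) : sg2 q (bX3 q) = q⁻¹ • bX3 q := by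
  simp only [bX3, map_add, map_mul, sg2_bX2 hq, sg2_br hq, smul_mul_assoc, mul_smul_comm, smul_add,
    mul_neg, neg_mul]
  module

theorem sg1_bY (hq : q ≠ 0) (n : ℕ) : sg1 q (bY q n) = q⁻¹ • bY q n := by
  induction n with
  | zero => rw [bY_zero, sg1_x2]
  | succ n ih =>
    simp only [bY_succ hq, map_add, map_smul, map_mul, sg1_br hq, ih, smul_mul_assoc,
      mul_smul_comm, smul_add]
    module

theorem sg2_bY (hq : q ≠ 0) (n : ℕ) : sg2 q (bY q n) = (-(-1) ^ n * q) • bY q n := by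
  induction n with
  | zero => rw [bY_zero, sg2_x2]; simp
  | succ n ih =>
    simp only [bY_succ hq, map_add, map_smul, map_mul, sg2_br hq, ih, smul_mul_assoc,
      mul_smul_comm, smul_add, mul_neg, neg_mul, pow_succ]
    module

theorem sg1_L (hq : q ≠ 0) (n : ℕ) : sg1 q (L q n) = L q n := by
  cases n with
  | zero => rw [L_zero, map_smul, map_one]
  | succ n =>
    simp only [L_succ hq, map_sub, map_smul, map_mul, sg1_bY hq, sg1_x1, smul_mul_assoc,
      mul_smul_comm]
    match_scalars <;> field_simp

theorem sg2_L (hq : q ≠ 0) (n : ℕ) : sg2 q (L q n) = (-1 : ℂ) ^ n • L q n := by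
  cases n with
  | zero => rw [L_zero, map_smul, map_one]; simp
  | succ n =>
    simp only [L_succ hq, map_sub, map_smul, map_mul, sg2_bY hq, sg2_x1, smul_mul_assoc,
      mul_smul_comm, pow_succ]
    match_scalars <;> field_simp

theorem L'_succ_eq (hq : q ≠ 0) (n : ℕ) :
    L' q (n + 1) = L q (n + 1) - (br q * L q n - (-1 : ℂ) ^ n • (L q n * br q)) := by
  rw [L_succ_eq hq n]; abel

theorem sg1_L' (hq : q ≠ 0) (n : ℕ) : sg1 q (L' q n) = L' q n := by
  cases n with
  | zero => rw [L'_zero, map_smul, map_one]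
  | succ n => simp only [L'_succ_eq hq, map_sub, map_smul, map_mul, sg1_L hq, sg1_br hq]

theorem sg2_L' (hq : q ≠ 0) (n : ℕ) : sg2 q (L' q n) = (-1 : ℂ) ^ n • L' q n := by
  cases n with
  | zero => rw [L'_zero, map_smul, map_one]; simp
  | succ n =>
    simp only [L'_succ_eq hq, map_sub, map_smul, map_mul, sg2_L hq, sg2_br hq, smul_mul_assoc,
      mul_smul_comm, pow_succ, mul_neg, neg_mul]
    module

/-! ### Skew derivatives -/

/-- The skew derivation `∂_1` of `B(𝕍)`. -/
abbrev d1 (q : ℂ) : B q →ₗ[ℂ] B q := nDeriv (braidMat q) 0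

/-- The skew derivation `∂_2` of `B(𝕍)`. -/
abbrev d2 (q : ℂ) : B q →ₗ[ℂ] B q := nDeriv (braidMat q) 1

theorem d1_x1 : d1 q (x1 q) = 1 := by simp [x1, nDeriv_gen]
theorem d1_x2 : d1 q (x2 q) = 0 := by simp [x2, nDeriv_gen]
theorem d2_x1 : d2 q (x1 q) = 0 := by simp [x1, nDeriv_gen]
theorem d2_x2 : d2 q (x2 q) = 1 := by simp [x2, nDeriv_gen]

theorem d1_mul (a b : B q) : d1 q (a * b) = a * d1 q b + d1 q a * sg1 q b := nDeriv_mul _ _ _ _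
theorem d2_mul (a b : B q) : d2 q (a * b) = a * d2 q b + d2 q a * sg2 q b := nDeriv_mul _ _ _ _

theorem eq_zero_of_d1_d2 {x : B q} (h0 : nFun (braidMat q) [] x = 0) (h1 : d1 q x = 0)
    (h2 : d2 q x = 0) : x = 0 := by
  refine eq_zero_of_nDeriv h0 fun i => ?_
  fin_cases i
  · exact h1
  · exact h2

theorem d1_br : d1 q (br q) = 0 := by
  simp only [br, map_sub, map_smul, d1_mul, d1_x1, d1_x2, sg1_x2, sg1_x1]
  simp

theorem d2_br : d2 q (br q) = (1 - q⁻¹ * q⁻¹) • x1 q := by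
  simp only [br, map_sub, map_smul, d2_mul, d2_x1, d2_x2, sg2_x2, sg2_x1, mul_one, zero_mul,
    mul_zero, one_mul, add_zero, zero_add]
  module

theorem d1_bX2 (hq : q ≠ 0) : d1 q (bX2 q) = 0 := by
  simp only [bX2, map_sub, d1_mul, d1_x1, d1_br, sg1_br hq]
  simp

theorem d2_bX2 (hq : q ≠ 0) :
    d2 q (bX2 q) = ((1 - q⁻¹ * q⁻¹) * (1 - q⁻¹)) • (x1 q * x1 q) := by
  simp only [bX2, map_sub, d2_mul, d2_x1, d2_br, sg2_br hq, sg2_x1, zero_mul, mul_zero, add_zero,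
    zero_add, smul_mul_assoc, mul_smul_comm]
  module

theorem d1_bX3 (hq : q ≠ 0) : d1 q (bX3 q) = 0 := by
  simp only [bX3, map_add, d1_mul, d1_bX2 hq, d1_br]
  simp

theorem d1_bY (hq : q ≠ 0) (n : ℕ) : d1 q (bY q n) = 0 := by
  induction n with
  | zero => rw [bY_zero, d1_x2]
  | succ n ih => simp only [bY_succ hq, map_add, map_smul, d1_mul, ih, d1_br]; simp

/-- ∂_1 kills Y_n, and the coefficient q⁻¹ of the bracket is exactly the weight by which σ_1 scales
Y_n. -/
theorem d1_L (hq : q ≠ 0) (n : ℕ) : d1 q (L q n) = 0 := by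
  cases n with
  | zero => rw [L_zero, map_smul, nDeriv_one, smul_zero]
  | succ n =>
    simp only [L_succ hq, map_sub, map_smul, d1_mul, d1_bY hq, d1_x1, sg1_bY hq, mul_zero,
      zero_mul, mul_one, one_mul, zero_add, add_zero, sub_self]

theorem fun_br : nFun (braidMat q) [] (br q) = 0 := by
  simp [br, x1, x2, nFun_nil_mul, nFun_nil_gen]

theorem fun_bX2 : nFun (braidMat q) [] (bX2 q) = 0 := by
  simp [bX2, nFun_nil_mul, fun_br]

/-! ### Commutation relations -/

theorem x1_mul_bX2 (hq : q ≠ 0) : x1 q * bX2 q = q • (bX2 q * x1 q) := by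
  rw [← sub_eq_zero]
  apply eq_zero_of_d1_d2
  · simp [nFun_nil_mul, fun_bX2]
  · simp only [map_sub, map_smul, d1_mul, d1_x1, d1_bX2 hq, sg1_bX2 hq, mul_zero, zero_mul, mul_one,
      one_mul, zero_add, add_zero, sub_self]
  · simp only [map_sub, map_smul, d2_mul, d2_x1, d2_bX2 hq, sg2_x1, mul_zero, zero_mul,
      zero_add, add_zero, smul_mul_assoc, mul_smul_comm, mul_assoc]
    match_scalars
    field_simp
    ring

theorem x1_mul_bX3 (hq : q ≠ 0) :
    x1 q * bX3 q = q • (bX3 q * x1 q) + (1 + q) • (bX2 q * bX2 q) := by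
  have h1 : x1 q * bX3 q = (x1 q * bX2 q) * br q + (x1 q * br q) * bX2 q := by
    rw [bX3]; noncomm_ring
  rw [h1, x1_mul_bX2 hq, x1_mul_br, smul_mul_assoc, mul_assoc, x1_mul_br, add_mul,
    mul_assoc (br q), x1_mul_bX2 hq]
  simp only [bX3, mul_add, add_mul, smul_add, mul_smul_comm, mul_assoc]
  module

theorem d2_bX3 (hq : q ≠ 0) :
    d2 q (bX3 q) = (-((1 - q⁻¹ * q⁻¹) * theta q)) • (bX2 q * x1 q) := by
  have h1 : x1 q * (x1 q * br q) = br q * (x1 q * x1 q) + (1 + q) • (bX2 q * x1 q) := by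
    rw [x1_mul_br, mul_add, ← mul_assoc, x1_mul_br, add_mul, x1_mul_bX2 hq, mul_assoc]
    module
  simp only [bX3, map_add, d2_mul, d2_bX2 hq, d2_br, sg2_br hq, sg2_bX2 hq, smul_mul_assoc,
    mul_smul_comm, mul_neg, mul_assoc, h1, x1_mul_bX2 hq, theta]
  match_scalars <;> field_simp <;> ring

/-- ∂_1 annihilates X_2 and X_3. After applying ∂_2 and moving every x_1 to the right, only X_3 x_1²
and X_2² x_1 remain, with zero coefficients. -/
theorem bX2_mul_bX3 (hq : q ≠ 0) : bX2 q * bX3 q = q • (bX3 q * bX2 q) := by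
  have h2 : ∀ z, x1 q * (bX2 q * z) = q • (bX2 q * (x1 q * z)) := fun z => by
    rw [← mul_assoc, x1_mul_bX2 hq, smul_mul_assoc, mul_assoc]
  have h1 : x1 q * (x1 q * bX3 q) = (q * q) • (bX3 q * (x1 q * x1 q)) +
      (q * (1 + q) * (1 + q)) • (bX2 q * (bX2 q * x1 q)) := by
    have h3 : x1 q * (bX3 q * x1 q) = q • (bX3 q * (x1 q * x1 q)) +
        (1 + q) • (bX2 q * (bX2 q * x1 q)) := by
      rw [← mul_assoc, x1_mul_bX3 hq]
      simp only [add_mul, smul_mul_assoc, mul_assoc]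
    rw [x1_mul_bX3 hq, mul_add, mul_smul_comm, mul_smul_comm, h3, h2, x1_mul_bX2 hq, mul_smul_comm]
    module
  rw [← sub_eq_zero]
  apply eq_zero_of_d1_d2
  · simp [nFun_nil_mul, fun_bX2]
  · simp only [map_sub, map_smul, d1_mul, d1_bX3 hq, d1_bX2 hq, mul_zero, zero_mul, add_zero,
      smul_zero, sub_zero]
  · simp only [map_sub, map_smul, d2_mul, d2_bX3 hq, d2_bX2 hq, sg2_bX3 hq, sg2_bX2 hq,
      smul_mul_assoc, mul_smul_comm, mul_assoc, h1, x1_mul_bX2 hq, theta]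
    match_scalars <;> field_simp <;> ring

/-! ### The square of `[x_1, x_2]` commutes with all `L_n` -/

theorem x1_mul_L'_two (hq : q ≠ 0) : x1 q * L' q 2 = L' q 2 * x1 q +
    q • (bX2 q * br q) + q⁻¹ • (br q * bX2 q) := by
  have h : x1 q * x2 q = br q + q⁻¹ • (x2 q * x1 q) := by rw [br]; abel
  rw [L'_add_two hq, bY_zero, mul_add, mul_smul_comm, ← mul_assoc, ← mul_assoc, x1_mul_bX2 hq, h,
    smul_mul_assoc, mul_assoc, h]
  simp only [mul_add, add_mul, smul_mul_assoc, mul_smul_comm, mul_assoc, x1_mul_bX2 hq]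
  match_scalars <;> field_simp

theorem L_two_eq (hq : q ≠ 0) : L q 2 = L' q 2 + (2 : ℂ) • (br q * br q) := by
  rw [L_succ_eq hq 1, L_one hq]
  module

theorem x1_mul_br_sq : x1 q * (br q * br q) = br q * (br q * x1 q) + bX3 q := by
  rw [← mul_assoc, x1_mul_br, add_mul, mul_assoc, x1_mul_br, mul_add, bX3]
  abel

theorem x1_mul_L_two (hq : q ≠ 0) : x1 q * L q 2 = L q 2 * x1 q +
    (q + 2) • bX3 q + (q⁻¹ - q) • (br q * bX2 q) := by
  rw [L_two_eq hq, mul_add, mul_smul_comm, x1_mul_L'_two hq, x1_mul_br_sq, bX2_mul_br, add_mul,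
    smul_mul_assoc, mul_assoc]
  module

theorem d2_bY_succ (hq : q ≠ 0) (n : ℕ) : d2 q (bY q (n + 1)) =
    br q * d2 q (bY q n) - (-1 : ℂ) ^ n • (d2 q (bY q n) * br q) -
      ((-1 : ℂ) ^ n * theta q) • L q (n + 1) := by
  rw [bY_succ hq, L_succ hq]
  simp only [map_add, map_smul, d2_mul, sg2_bY hq, sg2_br hq, d2_br, theta, smul_mul_assoc,
    mul_smul_comm, mul_neg, smul_sub]
  match_scalars <;> field_simp

theorem d2_L_succ (hq : q ≠ 0) (n : ℕ) : d2 q (L q (n + 1)) =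
    x1 q * d2 q (bY q n) - (q⁻¹ * q⁻¹) • (d2 q (bY q n) * x1 q) := by
  rw [L_succ hq]
  simp only [map_sub, map_smul, d2_mul, d2_x1, sg2_x1, mul_smul_comm, mul_zero, zero_mul, add_zero,
    zero_add, smul_smul]

theorem d2_L_two (hq : q ≠ 0) : d2 q (L q 2) =
    (-theta q) • (x1 q * br q) + (theta q * q⁻¹ * q⁻¹) • (br q * x1 q) := by
  rw [d2_L_succ hq, d2_bY_succ hq, bY_zero, d2_x2, L_one hq]
  simp only [mul_one, one_mul, pow_zero, one_smul, sub_self, zero_sub, mul_neg, neg_mul,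
    smul_mul_assoc, mul_smul_comm]
  module

/-- The case n = 1 of `bX2_mul_L_succ`. It needs a separate computation, as the expression of L_n by
X_3 and Y_{n-2} starts only at n = 3. -/
theorem bX2_mul_L_two (hq : q ≠ 0) : bX2 q * L q 2 - L q 2 * bX2 q =
    q • (bX3 q * br q) - q⁻¹ • (br q * bX3 q) := by
  have h1 : x1 q * (x1 q * L q 2) = L q 2 * (x1 q * x1 q) +
      ((q + 2) * (q + 1)) • (bX3 q * x1 q) +
      ((q + 2) * (1 + q) + (q⁻¹ - q)) • (bX2 q * bX2 q) +
      ((q⁻¹ - q) * (q + 1)) • (br q * (bX2 q * x1 q)) := by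
    rw [x1_mul_L_two hq, mul_add, mul_add, ← mul_assoc, x1_mul_L_two hq, mul_smul_comm,
      mul_smul_comm, x1_mul_bX3 hq, ← mul_assoc (x1 q), x1_mul_br]
    simp only [add_mul, smul_mul_assoc, mul_smul_comm, mul_assoc, x1_mul_bX2 hq]
    module
  have h2 : bX2 q * (x1 q * br q) = bX3 q * x1 q - br q * (bX2 q * x1 q) + bX2 q * bX2 q := by
    rw [x1_mul_br, mul_add, ← mul_assoc, bX2_mul_br, sub_mul, mul_assoc]
  have h3 : x1 q * (br q * bX2 q) = q • (br q * (bX2 q * x1 q)) + bX2 q * bX2 q := by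
    rw [← mul_assoc, x1_mul_br, add_mul, mul_assoc, x1_mul_bX2 hq, mul_smul_comm]
  have h4 : bX2 q * (br q * x1 q) = bX3 q * x1 q - br q * (bX2 q * x1 q) := by
    rw [← mul_assoc, bX2_mul_br, sub_mul, mul_assoc]
  rw [← sub_eq_zero]
  apply eq_zero_of_d1_d2
  · simp [nFun_nil_mul, fun_bX2, fun_br]
  · simp only [map_sub, map_smul, d1_mul, d1_bX3 hq, d1_bX2 hq, d1_L hq, d1_br, mul_zero, zero_mul,
      add_zero, smul_zero, sub_zero]
  · simp only [map_sub, map_smul, d2_mul, d2_bX3 hq, d2_bX2 hq, d2_br, d2_L_two hq, sg2_bX3 hq,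
      sg2_bX2 hq, sg2_br hq, sg2_L hq, smul_mul_assoc, mul_smul_comm, mul_assoc, mul_add, add_mul,
      mul_neg, neg_mul, h1, h2, h3, h4, x1_mul_bX2 hq, x1_mul_bX3 hq, theta, neg_smul, smul_add]
    match_scalars <;> field_simp <;> ring

/-- Two consecutive brackets with u carry opposite signs, so the terms u Y u cancel and the double
bracket is the commutator with u². -/
theorem br_sq_mul_bY (hq : q ≠ 0) (n : ℕ) :
    br q * br q * bY q n = bY q n * (br q * br q) + bY q (n + 2) := by
  rw [bY_succ hq (n + 1), bY_succ hq n]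
  simp only [mul_add, add_mul, smul_mul_assoc, mul_smul_comm, mul_assoc, smul_add, pow_succ]
  rcases neg_one_pow_eq_or ℂ n with h | h <;> rw [h] <;> module

/-- Apply the derivation [u², ·] to x_1 Y - q⁻¹ Y x_1 = L_{n+1}, where Y = `bY q n`. The result is
zero, and [x_1, u²] = X_3 while [u², Y] is the Y two steps further on. -/
theorem L_add_three_eq (hq : q ≠ 0) (n : ℕ) (h : Commute (br q * br q) (L q (n + 1))) :
    L q (n + 3) = bX3 q * bY q n - q⁻¹ • (bY q n * bX3 q) := by
  have h1 : x1 q * (br q * (br q * bY q n)) =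
      br q * (br q * (x1 q * bY q n)) + bX3 q * bY q n := by
    have := congrArg (· * bY q n) (x1_mul_br_sq (q := q))
    simpa only [mul_assoc, add_mul] using this
  have h2 : bY q n * (br q * (br q * x1 q)) = bY q n * (x1 q * (br q * br q)) - bY q n * bX3 q := by
    rw [x1_mul_br_sq, mul_add]; abel
  have h3 : bY q (n + 2) = br q * br q * bY q n - bY q n * (br q * br q) := by
    rw [br_sq_mul_bY hq]; abel
  have h4 := h.eq
  rw [L_succ hq] at h4
  rw [L_succ hq, h3]
  simp only [mul_sub, sub_mul, smul_mul_assoc, mul_smul_comm, mul_assoc] at h4 ⊢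
  rw [h1, h2]
  have h5 : br q * (br q * (x1 q * bY q n)) = x1 q * (bY q n * (br q * br q)) -
      q⁻¹ • (bY q n * (x1 q * (br q * br q))) + q⁻¹ • (br q * (br q * (bY q n * x1 q))) := by
    rw [← h4]; abel
  rw [h5]
  module

theorem bX2_mul_L_add_three (hq : q ≠ 0) (n : ℕ) (h : Commute (br q * br q) (L q (n + 1))) :
    bX2 q * L q (n + 3) + (-1 : ℂ) ^ n • (L q (n + 3) * bX2 q) =
      q • (bX3 q * L' q (n + 2)) - q⁻¹ • (L' q (n + 2) * bX3 q) := by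
  have h1 : ∀ z, bX2 q * (bX3 q * z) = q • (bX3 q * (bX2 q * z)) := fun z => by
    rw [← mul_assoc, bX2_mul_bX3 hq, smul_mul_assoc, mul_assoc]
  rw [L_add_three_eq hq n h, L'_add_two hq]
  simp only [mul_add, add_mul, mul_sub, sub_mul, smul_mul_assoc, mul_smul_comm, mul_assoc, h1,
    bX2_mul_bX3 hq]
  match_scalars <;> field_simp

/-- L_n - L'_n is the bracket of u with L_{n-1}; bracketing once more gives the commutator of u²
with L_{n-1}, which is zero. -/
theorem br_bracket_L' (hq : q ≠ 0) (n : ℕ) (h : ∀ i < n, Commute (br q * br q) (L q i)) :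
    br q * L' q n - (-1 : ℂ) ^ n • (L' q n * br q) =
      br q * L q n - (-1 : ℂ) ^ n • (L q n * br q) := by
  cases n with
  | zero => rw [L_zero, L'_zero]
  | succ n =>
    have h1 := (h n (Nat.lt_succ_self n)).eq
    rw [mul_assoc] at h1
    rw [L_succ_eq hq]
    simp only [mul_add, add_mul, mul_sub, sub_mul, smul_mul_assoc, mul_smul_comm, mul_assoc,
      smul_add, smul_sub, h1, pow_succ]
    rcases neg_one_pow_eq_or ℂ n with h | h <;> rw [h] <;> module

theorem commute_br_sq_L' (hq : q ≠ 0) (n : ℕ) (h : ∀ i ≤ n, Commute (br q * br q) (L q i)) :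
    Commute (br q * br q) (L' q n) := by
  have hb : Commute (br q * br q) (br q) := (Commute.refl _).mul_left (Commute.refl _)
  cases n with
  | zero => rw [L'_zero]; exact (Commute.one_right _).smul_right _
  | succ n =>
    rw [L'_succ_eq hq]
    refine (h _ le_rfl).sub_right ((hb.mul_right (h n (Nat.le_succ n))).sub_right
      (((h n (Nat.le_succ n)).mul_right hb).smul_right _))

/-- In the recursion `d2_bY_succ`, [u, L'_n] may be replaced by [u, L_n], and L_{n+1} - [u, L_n] =
L'_{n+1}. Commutation is required only for i + 1 < n, so this is available inside the induction that
proves it. -/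
theorem d2_bY_eq (hq : q ≠ 0) (hθ : theta q ≠ 0) (n : ℕ)
    (h : ∀ i, i + 1 < n → Commute (br q * br q) (L q i)) :
    d2 q (bY q n) = ((-1 : ℂ) ^ n * theta q) • L' q n := by
  induction n with
  | zero => rw [bY_zero, d2_x2, L'_zero, smul_smul, pow_zero, one_mul, mul_inv_cancel₀ hθ, one_smul]
  | succ n ih =>
    have h1 := br_bracket_L' hq n fun i hi => h i (Nat.succ_lt_succ hi)
    rw [d2_bY_succ hq, ih fun i hi => h i (by omega), L_succ_eq hq n]
    have h2 : br q * L q n =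
        br q * L' q n - (-1 : ℂ) ^ n • (L' q n * br q) + (-1 : ℂ) ^ n • (L q n * br q) := by
      rw [h1]; abel
    rw [h2]
    simp only [smul_mul_assoc, mul_smul_comm, pow_succ]
    module

/-- The commutation relation which makes `∂_2` vanish on the commutator of `[x_1, x_2]^2` with
`L_{n+1}`. -/
theorem bX2_mul_L_succ (hq : q ≠ 0) (hθ : theta q ≠ 0) (n : ℕ)
    (h : ∀ i < n, Commute (br q * br q) (L q i)) :
    bX2 q * L q (n + 1) + (-1 : ℂ) ^ n • (L q (n + 1) * bX2 q) =
      q • (bX3 q * L' q n) - q⁻¹ • (L' q n * bX3 q) := by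
  match n with
  | 0 =>
    rw [zero_add, L_one hq, L'_zero, pow_zero, one_smul, ← bX3, mul_smul_comm, smul_mul_assoc,
      mul_one, one_mul, smul_smul, smul_smul, ← sub_smul, ← sub_mul]
    -- The normalisation L'_0 = 1/θ absorbs the factor q - q⁻¹.
    change _ = (theta q * (theta q)⁻¹) • _
    rw [mul_inv_cancel₀ hθ, one_smul]
  | 1 =>
    rw [L'_one hq, ← bX2_mul_L_two hq]
    module
  | n + 2 =>
    rw [pow_add, neg_one_sq, mul_one]
    exact bX2_mul_L_add_three hq n (h (n + 1) (Nat.lt_succ_self _))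

/-- ∂_1 kills u and L_{n+1}. For ∂_2, the derivative of u² is a multiple of X_2 and that of L_{n+1}
is a combination of x_1 L'_n and L'_n x_1. By induction u² commutes with L'_n, so moving it past x_1
leaves only X_3 terms, and `bX2_mul_L_succ` is precisely the cancellation left over. -/
theorem commute_br_sq_L (hq : q ≠ 0) (hθ : theta q ≠ 0) (n : ℕ) :
    Commute (br q * br q) (L q n) := by
  induction n using Nat.strong_induction_on with
  | _ n ih =>
    cases n with
    | zero => rw [L_zero]; exact (Commute.one_right _).smul_right _
    | succ n =>
      have hZ := bX2_mul_L_succ hq hθ n fun i hi => ih i (Nat.lt_succ_of_lt hi)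
      have hc := (commute_br_sq_L' hq n fun i hi => ih i (Nat.lt_succ_of_le hi)).eq
      have hd : d2 q (L q (n + 1)) = ((-1 : ℂ) ^ n * theta q) •
          (x1 q * L' q n - (q⁻¹ * q⁻¹) • (L' q n * x1 q)) := by
        rw [d2_L_succ hq, d2_bY_eq hq hθ n fun i hi => ih i (by omega), mul_smul_comm,
          smul_mul_assoc]
        module
      have hx : x1 q * (br q * (br q * L' q n)) =
          br q * (br q * (x1 q * L' q n)) + bX3 q * L' q n := by
        have := congrArg (· * L' q n) (x1_mul_br_sq (q := q))
        simpa only [mul_assoc, add_mul] using this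
      change _ = _
      rw [← sub_eq_zero]
      apply eq_zero_of_d1_d2
      · simp [nFun_nil_mul, fun_br]
      · simp only [map_sub, d1_mul, d1_br, d1_L hq, mul_zero, zero_mul, add_zero, sub_zero]
      · have h2 : bX2 q * L q (n + 1) = q • (bX3 q * L' q n) - q⁻¹ • (L' q n * bX3 q) -
            (-1 : ℂ) ^ n • (L q (n + 1) * bX2 q) := by rw [← hZ]; abel
        have h3 : br q * (br q * (L' q n * x1 q)) =
            L' q n * (x1 q * (br q * br q)) - L' q n * bX3 q := by
          rw [x1_mul_br_sq, mul_add, ← mul_assoc, ← mul_assoc, hc]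
          simp only [mul_assoc]
          abel
        have h4 : br q * (br q * (x1 q * L' q n)) =
            x1 q * (L' q n * (br q * br q)) - bX3 q * L' q n := by
          rw [← hc, mul_assoc, hx]; abel
        have h5 : d2 q (br q * br q) = (-(1 - q⁻¹ * q⁻¹)) • bX2 q := by
          rw [d2_mul, d2_br, sg2_br hq, bX2, mul_smul_comm, mul_neg, smul_mul_assoc]
          module
        rw [map_sub, d2_mul, d2_mul (L q (n + 1)), h5, hd, map_mul, sg2_br hq, sg2_L hq]
        simp only [smul_mul_assoc, mul_smul_comm, mul_sub, sub_mul, mul_assoc, h2, h3, h4, neg_mul,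
          mul_neg, neg_neg, theta, pow_succ]
        rcases neg_one_pow_eq_or ℂ n with h | h <;> rw [h] <;> match_scalars <;> field_simp <;> ring

/-! ### Multiplicative closure of `K_{≥1}` and `K_{>1}` -/

/-- The subspace `S ⊗ B(𝕍)` of `B(𝕍) ⊗ B(𝕍)`. -/
def leftSpan (S : Submodule ℂ (B q)) : Submodule ℂ (B q ⊗[ℂ] B q) :=
  LinearMap.range (TensorProduct.map S.subtype (LinearMap.id : B q →ₗ[ℂ] B q))

theorem tmul_mem_leftSpan {S : Submodule ℂ (B q)} {a : B q} (ha : a ∈ S) (b : B q) :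
    a ⊗ₜ b ∈ leftSpan S := ⟨⟨a, ha⟩ ⊗ₜ b, rfl⟩

theorem leftSpan_mono {S S' : Submodule ℂ (B q)} (h : S ≤ S') : leftSpan S ≤ leftSpan S' := by
  rintro _ ⟨y, rfl⟩
  induction y with
  | zero => simp
  | add x y hx hy => rw [map_add]; exact add_mem hx hy
  | tmul a b => exact tmul_mem_leftSpan (h a.2) b

theorem map_mem_leftSpan {S S' : Submodule ℂ (B q)} {f : B q →ₗ[ℂ] B q} (g : B q →ₗ[ℂ] B q)
    (hf : ∀ a ∈ S, f a ∈ S') {y : B q ⊗[ℂ] B q} (hy : y ∈ leftSpan S) :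
    TensorProduct.map f g y ∈ leftSpan S' := by
  obtain ⟨y, rfl⟩ := hy
  induction y with
  | zero => simp
  | add x y hx hy => rw [map_add, map_add]; exact add_mem hx hy
  | tmul a b => exact tmul_mem_leftSpan (hf a a.2) (g b)

theorem mem_KGe {x : B q} : x ∈ KGe q ↔ comulB q x ∈ leftSpan (BGe q) := Iff.rfl

theorem wordDeg_zero_add (a : Fin 2 → ℕ) :
    (wordDeg [0] + a : Fin 2 → ℕ) 0 = 1 + a 0 ∧ (wordDeg [0] + a : Fin 2 → ℕ) 1 = a 1 := by
  simp [wordDeg]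

theorem wordDeg_one_add (a : Fin 2 → ℕ) :
    (wordDeg [1] + a : Fin 2 → ℕ) 0 = a 0 ∧ (wordDeg [1] + a : Fin 2 → ℕ) 1 = 1 + a 1 := by
  simp [wordDeg]

/-- The sum of the components of `B(𝕍)` of degrees `a` with `a_1 + m ≥ a_2 + n`. -/
def BShift (q : ℂ) (m n : ℕ) : Submodule ℂ (B q) :=
  degSum (braidMat q) fun a => a 1 + n ≤ a 0 + m

theorem BGe_eq_BShift (q : ℂ) : BGe q = BShift q 0 0 := rfl

variable {m n m' n' : ℕ} {a : B q}

/-- The two indices stand for the integer m - n, so bounds can be renormalised after multiplying by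
letters. -/
theorem BShift_mono (h : n' + m ≤ n + m') : BShift q m n ≤ BShift q m' n' := by
  refine iSup_le fun a => iSup_le fun ha => ?_
  exact le_iSup₂_of_le a (by omega) le_rfl

theorem x1_mul_mem_BShift (h : a ∈ BShift q m n) : x1 q * a ∈ BShift q m (n + 1) :=
  gen_mul_mem_degSum 0 (fun a ha => by
    rw [(wordDeg_zero_add a).1, (wordDeg_zero_add a).2]; omega) h

theorem mul_x1_mem_BShift (h : a ∈ BShift q m n) : a * x1 q ∈ BShift q m (n + 1) :=
  mul_gen_mem_degSum 0 (fun a ha => by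
    rw [(wordDeg_zero_add a).1, (wordDeg_zero_add a).2]; omega) h

theorem x2_mul_mem_BShift (h : a ∈ BShift q m n) : x2 q * a ∈ BShift q (m + 1) n :=
  gen_mul_mem_degSum 1 (fun a ha => by
    rw [(wordDeg_one_add a).1, (wordDeg_one_add a).2]; omega) h

theorem mul_x2_mem_BShift (h : a ∈ BShift q m n) : a * x2 q ∈ BShift q (m + 1) n :=
  mul_gen_mem_degSum 1 (fun a ha => by
    rw [(wordDeg_one_add a).1, (wordDeg_one_add a).2]; omega) h

theorem br_mul_mem_BShift (h : a ∈ BShift q m n) : br q * a ∈ BShift q m n := by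
  rw [br, sub_mul, smul_mul_assoc, mul_assoc, mul_assoc]
  exact sub_mem (BShift_mono (by omega) (x1_mul_mem_BShift (x2_mul_mem_BShift h)))
    (Submodule.smul_mem _ _ (BShift_mono (by omega) (x2_mul_mem_BShift (x1_mul_mem_BShift h))))

theorem mul_br_mem_BShift (h : a ∈ BShift q m n) : a * br q ∈ BShift q m n := by
  rw [br, mul_sub, mul_smul_comm, ← mul_assoc, ← mul_assoc]
  exact sub_mem (BShift_mono (by omega) (mul_x2_mem_BShift (mul_x1_mem_BShift h)))
    (Submodule.smul_mem _ _ (BShift_mono (by omega) (mul_x1_mem_BShift (mul_x2_mem_BShift h))))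

theorem nSigma_mem_BShift (i : Fin 2) (h : a ∈ BShift q m n) :
    nSigma (braidMat q) i a ∈ BShift q m n := nSigma_mem_degSum i h

/-! ### Multiplication by the coproducts of x_1 and [x_1, x_2] -/

theorem braidMat_transpose (q : ℂ) : (braidMat q).transpose = braidMat q := by
  ext i j
  fin_cases i <;> fin_cases j <;> rfl

/-- Left multiplication by `Δ([x_1, x_2])` in the braided tensor square. -/
def brLeftMul (q : ℂ) : B q ⊗[ℂ] B q →ₗ[ℂ] B q ⊗[ℂ] B q :=
  TensorProduct.map (LinearMap.mulLeft ℂ (br q)) LinearMap.id +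
    (1 - q⁻¹ * q⁻¹) • TensorProduct.map (LinearMap.mulLeft ℂ (x1 q) ∘ₗ (sg2 q).toLinearMap)
      (LinearMap.mulLeft ℂ (x2 q)) +
    TensorProduct.map ((sg1 q).toLinearMap ∘ₗ (sg2 q).toLinearMap) (LinearMap.mulLeft ℂ (br q))

theorem brLeftMul_tmul (a b : B q) : brLeftMul q (a ⊗ₜ b) = (br q * a) ⊗ₜ b +
    (1 - q⁻¹ * q⁻¹) • ((x1 q * sg2 q a) ⊗ₜ (x2 q * b)) + sg1 q (sg2 q a) ⊗ₜ (br q * b) := rfl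

/-- Right multiplication by `Δ([x_1, x_2])` in the braided tensor square. -/
def brRightMul (q : ℂ) : B q ⊗[ℂ] B q →ₗ[ℂ] B q ⊗[ℂ] B q :=
  TensorProduct.map (LinearMap.mulRight ℂ (br q)) ((sg1 q).toLinearMap ∘ₗ (sg2 q).toLinearMap) +
    (1 - q⁻¹ * q⁻¹) • TensorProduct.map (LinearMap.mulRight ℂ (x1 q))
      (LinearMap.mulRight ℂ (x2 q) ∘ₗ (sg1 q).toLinearMap) +
    TensorProduct.map LinearMap.id (LinearMap.mulRight ℂ (br q))

theorem brRightMul_tmul (a b : B q) : brRightMul q (a ⊗ₜ b) = (a * br q) ⊗ₜ sg1 q (sg2 q b) +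
    (1 - q⁻¹ * q⁻¹) • ((a * x1 q) ⊗ₜ (sg1 q b * x2 q)) + a ⊗ₜ (b * br q) := rfl

theorem x1LeftMul_tmul (a b : B q) : nLeftMul (braidMat q) 0 (a ⊗ₜ b) =
    (x1 q * a) ⊗ₜ b + sg1 q a ⊗ₜ (x1 q * b) := rfl

theorem x1RightMul_tmul (a b : B q) : nRightMul (braidMat q) 0 (a ⊗ₜ b) =
    (a * x1 q) ⊗ₜ sg1 q b + a ⊗ₜ (b * x1 q) := rfl

theorem x2LeftMul_tmul (a b : B q) : nLeftMul (braidMat q) 1 (a ⊗ₜ b) =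
    (x2 q * a) ⊗ₜ b + sg2 q a ⊗ₜ (x2 q * b) := rfl

theorem x2RightMul_tmul (a b : B q) : nRightMul (braidMat q) 1 (a ⊗ₜ b) =
    (a * x2 q) ⊗ₜ sg2 q b + a ⊗ₜ (b * x2 q) := rfl

theorem sg2_sg1 (a : B q) : sg2 q (sg1 q a) = sg1 q (sg2 q a) := by
  obtain ⟨t, rfl⟩ := proj_surjective _ a
  rw [nSigma_proj, nSigma_proj, nSigma_proj, nSigma_proj, sigma_sigma]

theorem comulB_x1_mul (b : B q) :
    comulB q (x1 q * b) = nLeftMul (braidMat q) 0 (comulB q b) := comul_gen_mul _ _ _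

theorem comulB_mul_x1 (b : B q) :
    comulB q (b * x1 q) = nRightMul (braidMat q) 0 (comulB q b) :=
  comul_mul_gen (braidMat_transpose q) _ _

/-- The x_2 ⊗ x_1 contributions of the two products of letters cancel; those of x_1 ⊗ x_2 add up to
1 - q⁻². -/
theorem comulB_br_mul (hq : q ≠ 0) (b : B q) :
    comulB q (br q * b) = brLeftMul q (comulB q b) := by
  have h1 : comulB q (br q * b) =
      nLeftMul (braidMat q) 0 (nLeftMul (braidMat q) 1 (comulB q b)) -
        q⁻¹ • nLeftMul (braidMat q) 1 (nLeftMul (braidMat q) 0 (comulB q b)) := by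
    rw [br, sub_mul, smul_mul_assoc, mul_assoc, mul_assoc, map_sub, map_smul]
    simp only [x1, x2, comulB, comul_gen_mul]
  rw [h1]
  generalize comulB q b = y
  induction y with
  | zero => simp
  | add x y hx hy => simp only [map_add, smul_add, ← hx, ← hy]; abel
  | tmul a b =>
    simp only [x1LeftMul_tmul, x2LeftMul_tmul, map_add, brLeftMul_tmul, br, sub_mul,
      smul_mul_assoc, TensorProduct.sub_tmul, TensorProduct.tmul_sub, mul_assoc, map_mul, sg1_x2,
      sg2_x1, sg2_sg1, TensorProduct.tmul_smul, ← TensorProduct.smul_tmul', smul_add]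
    match_scalars <;> field_simp
    ring

theorem comulB_mul_br (hq : q ≠ 0) (b : B q) :
    comulB q (b * br q) = brRightMul q (comulB q b) := by
  have h1 : comulB q (b * br q) =
      nRightMul (braidMat q) 1 (nRightMul (braidMat q) 0 (comulB q b)) -
        q⁻¹ • nRightMul (braidMat q) 0 (nRightMul (braidMat q) 1 (comulB q b)) := by
    rw [br, mul_sub, mul_smul_comm, ← mul_assoc, ← mul_assoc, map_sub, map_smul]
    simp only [x1, x2, comulB, comul_mul_gen (braidMat_transpose q)]
  rw [h1]
  generalize comulB q b = y
  induction y with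
  | zero => simp
  | add x y hx hy => simp only [map_add, smul_add, ← hx, ← hy]; abel
  | tmul a b =>
    simp only [x1RightMul_tmul, x2RightMul_tmul, map_add, brRightMul_tmul, br, mul_sub,
      mul_smul_comm, TensorProduct.sub_tmul, TensorProduct.tmul_sub, mul_assoc, map_mul, sg1_x2,
      sg2_x1, sg2_sg1, TensorProduct.tmul_smul, ← TensorProduct.smul_tmul', smul_add]
    match_scalars <;> field_simp
    ring

theorem nSigma_comul_mem {S : Submodule ℂ (B q)} (i : Fin 2)
    (hS : ∀ a ∈ S, nSigma (braidMat q) i a ∈ S) (h : comulB q a ∈ leftSpan S) :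
    comulB q (nSigma (braidMat q) i a) ∈ leftSpan S := by
  have h1 : comulB q (nSigma (braidMat q) i a) =
      TensorProduct.map (nSigma (braidMat q) i).toLinearMap (nSigma (braidMat q) i).toLinearMap
        (comulB q a) := by
    obtain ⟨t, rfl⟩ := proj_surjective _ a
    rw [nSigma_proj, comulB, comul_proj, comul_proj, comulT_sigma]
    generalize comulT (braidMat q) t = z
    induction z with
    | zero => simp
    | add x y hx hy => simp only [map_add, hx, hy]
    | tmul c d => simp [nSigma_proj]
  rw [h1]
  exact map_mem_leftSpan _ hS h

/-! Each of the following operators preserves `S ⊗ B(𝕍)`, provided that its left tensor factors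
preserve `S`. -/

theorem x1LeftMul_mem {S S' : Submodule ℂ (B q)} (h1 : ∀ a ∈ S, x1 q * a ∈ S')
    (h2 : ∀ a ∈ S, sg1 q a ∈ S') {y : B q ⊗[ℂ] B q} (hy : y ∈ leftSpan S) :
    nLeftMul (braidMat q) 0 y ∈ leftSpan S' :=
  add_mem (map_mem_leftSpan _ h1 hy) (map_mem_leftSpan _ h2 hy)

theorem x1RightMul_mem {S S' : Submodule ℂ (B q)} (h1 : ∀ a ∈ S, a * x1 q ∈ S')
    (h2 : S ≤ S') {y : B q ⊗[ℂ] B q} (hy : y ∈ leftSpan S) :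
    nRightMul (braidMat q) 0 y ∈ leftSpan S' :=
  add_mem (map_mem_leftSpan _ h1 hy) (map_mem_leftSpan _ h2 hy)

theorem brLeftMul_mem {S : Submodule ℂ (B q)} (h1 : ∀ a ∈ S, br q * a ∈ S)
    (h2 : ∀ a ∈ S, x1 q * a ∈ S) (h3 : ∀ a ∈ S, sg1 q a ∈ S) (h4 : ∀ a ∈ S, sg2 q a ∈ S)
    {y : B q ⊗[ℂ] B q} (hy : y ∈ leftSpan S) : brLeftMul q y ∈ leftSpan S :=
  add_mem (add_mem (map_mem_leftSpan _ h1 hy) (Submodule.smul_mem _ _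
    (map_mem_leftSpan _ (fun a ha => h2 _ (h4 a ha)) hy)))
    (map_mem_leftSpan _ (fun a ha => h3 _ (h4 a ha)) hy)

theorem brRightMul_mem {S : Submodule ℂ (B q)} (h1 : ∀ a ∈ S, a * br q ∈ S)
    (h2 : ∀ a ∈ S, a * x1 q ∈ S) {y : B q ⊗[ℂ] B q} (hy : y ∈ leftSpan S) :
    brRightMul q y ∈ leftSpan S :=
  add_mem (add_mem (map_mem_leftSpan _ h1 hy) (Submodule.smul_mem _ _
    (map_mem_leftSpan _ h2 hy))) (map_mem_leftSpan _ (fun _ ha => ha) hy)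

/-! ### Stability under x_1, [x_1, x_2] and X_2 -/

theorem x1_mul_mem_BGe (h : a ∈ BGe q) : x1 q * a ∈ BGe q := by
  rw [BGe_eq_BShift] at h ⊢
  exact BShift_mono (by omega) (x1_mul_mem_BShift h)

theorem mul_x1_mem_BGe (h : a ∈ BGe q) : a * x1 q ∈ BGe q := by
  rw [BGe_eq_BShift] at h ⊢
  exact BShift_mono (by omega) (mul_x1_mem_BShift h)

theorem br_mul_mem_BGe (h : a ∈ BGe q) : br q * a ∈ BGe q := by
  rw [BGe_eq_BShift] at h ⊢
  exact br_mul_mem_BShift h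

theorem mul_br_mem_BGe (h : a ∈ BGe q) : a * br q ∈ BGe q := by
  rw [BGe_eq_BShift] at h ⊢
  exact mul_br_mem_BShift h

theorem nSigma_mem_BGe (i : Fin 2) (h : a ∈ BGe q) : nSigma (braidMat q) i a ∈ BGe q := by
  rw [BGe_eq_BShift] at h ⊢
  exact nSigma_mem_BShift i h

theorem x1_mul_mem_KGe (h : a ∈ KGe q) : x1 q * a ∈ KGe q := by
  rw [mem_KGe] at h ⊢
  rw [comulB_x1_mul]
  exact x1LeftMul_mem (fun _ => x1_mul_mem_BGe) (fun _ => nSigma_mem_BGe 0) h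

theorem mul_x1_mem_KGe (h : a ∈ KGe q) : a * x1 q ∈ KGe q := by
  rw [mem_KGe] at h ⊢
  rw [comulB_mul_x1]
  exact x1RightMul_mem (fun _ => mul_x1_mem_BGe) le_rfl h

theorem br_mul_mem_KGe (hq : q ≠ 0) (h : a ∈ KGe q) : br q * a ∈ KGe q := by
  rw [mem_KGe] at h ⊢
  rw [comulB_br_mul hq]
  exact brLeftMul_mem (fun _ => br_mul_mem_BGe) (fun _ => x1_mul_mem_BGe)
    (fun _ => nSigma_mem_BGe 0) (fun _ => nSigma_mem_BGe 1) h

theorem mul_br_mem_KGe (hq : q ≠ 0) (h : a ∈ KGe q) : a * br q ∈ KGe q := by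
  rw [mem_KGe] at h ⊢
  rw [comulB_mul_br hq]
  exact brRightMul_mem (fun _ => mul_br_mem_BGe) (fun _ => mul_x1_mem_BGe) h

theorem nSigma_mem_KGe (i : Fin 2) (h : a ∈ KGe q) : nSigma (braidMat q) i a ∈ KGe q :=
  nSigma_comul_mem i (fun _ => nSigma_mem_BGe i) h

theorem KGe_le_BGe (q : ℂ) : KGe q ≤ BGe q := by
  rw [KGe_eq_vanishOn, BGe_eq_degSum, degSum_eq_vanishOn]
  intro x hx
  rw [mem_vanishOn] at hx ⊢
  exact fun w hw => hx w ⟨[], w, rfl, not_le.1 hw⟩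

theorem mem_KGt : a ∈ KGt q ↔ a ∈ KGe q ∧ a ∈ BShift q 0 1 := Iff.rfl

theorem mem_BShift_of_mem_KGe (h : a ∈ KGe q) : a ∈ BShift q 0 0 := KGe_le_BGe q h

/-- A factor x_1 raises the excess of x_1 over x_2; this discards most terms in the computation of
Δ. -/
theorem x1_mul_mem_KGt (h : a ∈ KGe q) : x1 q * a ∈ KGt q :=
  mem_KGt.2 ⟨x1_mul_mem_KGe h, x1_mul_mem_BShift (mem_BShift_of_mem_KGe h)⟩

theorem mul_x1_mem_KGt (h : a ∈ KGe q) : a * x1 q ∈ KGt q :=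
  mem_KGt.2 ⟨mul_x1_mem_KGe h, mul_x1_mem_BShift (mem_BShift_of_mem_KGe h)⟩

theorem br_mul_mem_KGt (hq : q ≠ 0) (h : a ∈ KGt q) : br q * a ∈ KGt q := by
  rw [mem_KGt] at h ⊢
  exact ⟨br_mul_mem_KGe hq h.1, br_mul_mem_BShift h.2⟩

theorem mul_br_mem_KGt (hq : q ≠ 0) (h : a ∈ KGt q) : a * br q ∈ KGt q := by
  rw [mem_KGt] at h ⊢
  exact ⟨mul_br_mem_KGe hq h.1, mul_br_mem_BShift h.2⟩

theorem nSigma_mem_KGt (i : Fin 2) (h : a ∈ KGt q) : nSigma (braidMat q) i a ∈ KGt q := by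
  rw [mem_KGt] at h ⊢
  exact ⟨nSigma_mem_KGe i h.1, nSigma_mem_BShift i h.2⟩

theorem bX2_mul_mem_KGt (hq : q ≠ 0) (h : a ∈ KGe q) : bX2 q * a ∈ KGt q := by
  rw [bX2, sub_mul, mul_assoc, mul_assoc]
  exact sub_mem (x1_mul_mem_KGt (br_mul_mem_KGe hq h)) (br_mul_mem_KGt hq (x1_mul_mem_KGt h))

theorem mul_bX2_mem_KGt (hq : q ≠ 0) (h : a ∈ KGe q) : a * bX2 q ∈ KGt q := by
  rw [bX2, mul_sub, ← mul_assoc, ← mul_assoc]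
  exact sub_mem (mul_br_mem_KGt hq (mul_x1_mem_KGt h)) (mul_x1_mem_KGt (mul_br_mem_KGe hq h))

theorem x1LeftMul_mem_KGt {y : B q ⊗[ℂ] B q} (hy : y ∈ leftSpan (KGt q)) :
    nLeftMul (braidMat q) 0 y ∈ leftSpan (KGt q) :=
  x1LeftMul_mem (fun _ h => x1_mul_mem_KGt (KGt_le_KGe q h)) (fun _ => nSigma_mem_KGt 0) hy

theorem x1RightMul_mem_KGt {y : B q ⊗[ℂ] B q} (hy : y ∈ leftSpan (KGt q)) :
    nRightMul (braidMat q) 0 y ∈ leftSpan (KGt q) :=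
  x1RightMul_mem (fun _ h => mul_x1_mem_KGt (KGt_le_KGe q h)) le_rfl hy

theorem brLeftMul_mem_KGt (hq : q ≠ 0) {y : B q ⊗[ℂ] B q} (hy : y ∈ leftSpan (KGt q)) :
    brLeftMul q y ∈ leftSpan (KGt q) :=
  brLeftMul_mem (fun _ => br_mul_mem_KGt hq) (fun _ h => x1_mul_mem_KGt (KGt_le_KGe q h))
    (fun _ => nSigma_mem_KGt 0) (fun _ => nSigma_mem_KGt 1) hy

theorem brRightMul_mem_KGt (hq : q ≠ 0) {y : B q ⊗[ℂ] B q} (hy : y ∈ leftSpan (KGt q)) :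
    brRightMul q y ∈ leftSpan (KGt q) :=
  brRightMul_mem (fun _ => mul_br_mem_KGt hq) (fun _ h => mul_x1_mem_KGt (KGt_le_KGe q h)) hy

/-! ### The comultiplication modulo `K_{>1} ⊗ B(𝕍)` -/

/-- The projection of `B(𝕍) ⊗ B(𝕍)` onto its quotient by `K_{>1} ⊗ B(𝕍)`. -/
def modGt (q : ℂ) : B q ⊗[ℂ] B q →ₗ[ℂ] (B q ⊗[ℂ] B q) ⧸ leftSpan (KGt q) :=
  (leftSpan (KGt q)).mkQ

theorem modGt_eq_iff {y z : B q ⊗[ℂ] B q} :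
    modGt q y = modGt q z ↔ y - z ∈ leftSpan (KGt q) :=
  Submodule.Quotient.eq _

theorem modGt_eq_zero {y : B q ⊗[ℂ] B q} (h : y ∈ leftSpan (KGt q)) : modGt q y = 0 :=
  (Submodule.Quotient.mk_eq_zero _).2 h

theorem modGt_tmul {a : B q} (h : a ∈ KGt q) (b : B q) : modGt q (a ⊗ₜ b) = 0 :=
  modGt_eq_zero (tmul_mem_leftSpan h b)

theorem modGt_congr {T : B q ⊗[ℂ] B q →ₗ[ℂ] B q ⊗[ℂ] B q}
    (hT : ∀ y ∈ leftSpan (KGt q), T y ∈ leftSpan (KGt q)) {y z : B q ⊗[ℂ] B q}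
    (h : modGt q y = modGt q z) : modGt q (T y) = modGt q (T z) := by
  rw [modGt_eq_iff] at h ⊢
  rw [← map_sub]
  exact hT _ h

/-- The left tensor factor at `Y_{j+1}` of the comultiplication of `Y_{j+m+1}`. -/
def coef (q : ℂ) (j m : ℕ) : B q :=
  theta q • if Even j then (-1 : ℂ) ^ m • L' q m else L q m

theorem sg1_coef (hq : q ≠ 0) (j m : ℕ) : sg1 q (coef q j m) = coef q j m := by
  rw [coef, map_smul]
  split_ifs
  · rw [map_smul, sg1_L' hq]
  · rw [sg1_L hq]

theorem sg2_coef (hq : q ≠ 0) (j m : ℕ) : sg2 q (coef q j m) = (-1 : ℂ) ^ m • coef q j m := by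
  rw [coef, map_smul]
  split_ifs
  · rw [map_smul, sg2_L' hq, smul_comm (theta q)]
  · rw [sg2_L hq, smul_comm (theta q)]

theorem coef_zero (hθ : theta q ≠ 0) (j : ℕ) : coef q j 0 = 1 := by
  rw [coef, L_zero, L'_zero, pow_zero, one_smul, ite_self, smul_smul, mul_inv_cancel₀ hθ, one_smul]

/-- The last summand accounts for the contribution that Y ⊗ 1 makes to the term with right factor
x_2 (`br_bracket_bY_one`). -/
theorem coef_zero_succ (hq : q ≠ 0) (hθ : theta q ≠ 0) (m : ℕ) :
    coef q 0 (m + 1) = br q * coef q 0 m - (-1 : ℂ) ^ m • (coef q 0 m * br q) -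
      ((-1 : ℂ) ^ m * theta q) • L q (m + 1) := by
  have h := br_bracket_L' hq m fun i _ => commute_br_sq_L hq hθ i
  rw [coef, coef, if_pos Even.zero, if_pos Even.zero, L_succ_eq hq m]
  have h2 : br q * L q m =
      br q * L' q m - (-1 : ℂ) ^ m • (L' q m * br q) + (-1 : ℂ) ^ m • (L q m * br q) := by
    rw [h]; abel
  rw [h2]
  simp only [mul_smul_comm, smul_mul_assoc, pow_succ]
  module

/-- For both parities this is `L_succ_eq`, read as a formula for L' or for L; in the latter case [u,
L_m] is first replaced by [u, L'_m] where needed, which relies on u² commuting with the L_i. -/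
theorem coef_succ_succ (hq : q ≠ 0) (hθ : theta q ≠ 0) (j m : ℕ) :
    coef q (j + 1) (m + 1) =
      br q * coef q (j + 1) m - (-1 : ℂ) ^ m • (coef q (j + 1) m * br q) -
        (-1 : ℂ) ^ m • coef q j (m + 1) := by
  have h := br_bracket_L' hq m fun i _ => commute_br_sq_L hq hθ i
  have h2 : br q * L q m =
      br q * L' q m - (-1 : ℂ) ^ m • (L' q m * br q) + (-1 : ℂ) ^ m • (L q m * br q) := by
    rw [h]; abel
  simp only [coef, Nat.even_add_one, L_succ_eq hq m, ite_not]
  split_ifs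
  · simp only [mul_smul_comm, smul_mul_assoc, pow_succ]
    rcases neg_one_pow_eq_or ℂ m with h | h <;> rw [h] <;> module
  · simp only [mul_smul_comm, smul_mul_assoc, pow_succ, h2]
    rcases neg_one_pow_eq_or ℂ m with h | h <;> rw [h] <;> module

theorem L'_mem_KGe_of (hq : q ≠ 0) {n : ℕ} (h : ∀ i ≤ n, L q i ∈ KGe q) : L' q n ∈ KGe q := by
  cases n with
  | zero => rw [L'_zero]; exact Submodule.smul_mem _ _ (one_mem_KGe q)
  | succ n =>
    rw [L'_succ_eq hq]
    have hn := h n (Nat.le_succ n)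
    exact sub_mem (h _ le_rfl) (sub_mem (br_mul_mem_KGe hq hn)
      (Submodule.smul_mem _ _ (mul_br_mem_KGe hq hn)))

theorem coef_mem_KGe_of (hq : q ≠ 0) (j : ℕ) {m : ℕ} (h : ∀ i ≤ m, L q i ∈ KGe q) :
    coef q j m ∈ KGe q := by
  refine Submodule.smul_mem _ _ ?_
  split_ifs
  · exact Submodule.smul_mem _ _ (L'_mem_KGe_of hq h)
  · exact h m le_rfl

/-- The x_1 ⊗ x_2 parts vanish because a ∈ K_{≥1}. The weights of a and Y make the rest split into a
bracket on the left factor and one on the right. -/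
theorem modGt_br_bracket (hq : q ≠ 0) (j m : ℕ) {a : B q} (ha : a ∈ KGe q) (h1 : sg1 q a = a)
    (h2 : sg2 q a = (-1 : ℂ) ^ m • a) :
    modGt q ((brLeftMul q + (-1 : ℂ) ^ (j + m) • brRightMul q) (a ⊗ₜ bY q j)) =
      modGt q ((br q * a - (-1 : ℂ) ^ m • (a * br q)) ⊗ₜ bY q j +
        (-1 : ℂ) ^ m • (a ⊗ₜ bY q (j + 1))) := by
  have e1 : sg1 q (sg2 q (bY q j)) = (-(-1 : ℂ) ^ j) • bY q j := by
    rw [sg2_bY hq, map_smul, sg1_bY hq, smul_smul]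
    congr 1
    field_simp
  simp only [LinearMap.add_apply, LinearMap.smul_apply, brLeftMul_tmul, brRightMul_tmul, h2, h1,
    map_smul, e1, map_add, bY_succ hq, TensorProduct.tmul_add, TensorProduct.tmul_smul,
    TensorProduct.sub_tmul, ← TensorProduct.smul_tmul', mul_smul_comm, map_sub, smul_add,
    modGt_tmul (x1_mul_mem_KGt ha), modGt_tmul (mul_x1_mem_KGt ha), pow_add, smul_zero, add_zero]
  rcases neg_one_pow_eq_or ℂ m with h | h <;> rcases neg_one_pow_eq_or ℂ j with h' | h' <;>
    rw [h, h'] <;> module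

/-- No membership of Y in K_{≥1} is available here; instead the x_1 ⊗ x_2 parts from left and right
multiplication assemble to L_{n+1} ⊗ x_2. -/
theorem br_bracket_bY_one (hq : q ≠ 0) (n : ℕ) :
    (brLeftMul q + (-1 : ℂ) ^ n • brRightMul q) (bY q n ⊗ₜ 1) =
      bY q (n + 1) ⊗ₜ 1 - ((-1 : ℂ) ^ n * theta q) • (L q (n + 1) ⊗ₜ bY q 0) := by
  simp only [LinearMap.add_apply, LinearMap.smul_apply, brLeftMul_tmul, brRightMul_tmul,
    map_one, bY_succ hq, L_succ hq, bY_zero, sg2_bY hq, sg1_bY hq, map_smul, mul_one, one_mul,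
    TensorProduct.add_tmul, TensorProduct.sub_tmul, ← TensorProduct.smul_tmul', mul_smul_comm,
    smul_add, smul_sub, theta]
  match_scalars <;> field_simp
  ring

theorem modGt_comulB_bY (hq : q ≠ 0) (hθ : theta q ≠ 0) (n : ℕ) (h : ∀ i ≤ n, L q i ∈ KGe q) :
    modGt q (comulB q (bY q n)) = modGt q (bY q n ⊗ₜ 1 +
      ∑ p ∈ Finset.HasAntidiagonal.antidiagonal n, coef q p.1 p.2 ⊗ₜ bY q p.1) := by
  induction n with
  | zero =>
    have h1 : comulB q (x2 q) = x2 q ⊗ₜ 1 + 1 ⊗ₜ x2 q := by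
      have := comul_gen_mul (braidMat q) 1 1
      rw [mul_one, comul_one] at this
      rw [x2, comulB, this, nLeftMul_tmul]
      simp
    rw [Finset.Nat.antidiagonal_zero, Finset.sum_singleton, coef_zero hθ, bY_zero, h1]
  | succ n ih =>
    have ih := ih fun i hi => h i (Nat.le_succ_of_le hi)
    have h1 : comulB q (bY q (n + 1)) =
        (brLeftMul q + (-1 : ℂ) ^ n • brRightMul q) (comulB q (bY q n)) := by
      rw [bY_succ hq, map_add, map_smul, comulB_br_mul hq, comulB_mul_br hq]
      rfl
    have hT : ∀ y ∈ leftSpan (KGt q),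
        (brLeftMul q + (-1 : ℂ) ^ n • brRightMul q) y ∈ leftSpan (KGt q) := fun y hy =>
      add_mem (brLeftMul_mem_KGt hq hy) (Submodule.smul_mem _ _ (brRightMul_mem_KGt hq hy))
    -- The bracket of u with the coefficient of index m - 1. The value 0 at m = 0 lets the sum
    -- extend over the antidiagonal of n + 1.
    let W : ℕ → ℕ → B q := fun j m => match m with
      | 0 => 0
      | m + 1 => br q * coef q j m - (-1 : ℂ) ^ m • (coef q j m * br q)
    have h2 : ∀ p ∈ Finset.HasAntidiagonal.antidiagonal n,
        modGt q ((brLeftMul q + (-1 : ℂ) ^ n • brRightMul q) (coef q p.1 p.2 ⊗ₜ bY q p.1)) =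
        modGt q (W p.1 (p.2 + 1) ⊗ₜ bY q p.1 +
          (-1 : ℂ) ^ p.2 • (coef q p.1 p.2 ⊗ₜ bY q (p.1 + 1))) := by
      intro p hp
      have hp' := Finset.HasAntidiagonal.mem_antidiagonal.1 hp
      rw [← hp']
      exact modGt_br_bracket hq p.1 p.2
        (coef_mem_KGe_of hq _ fun i hi => h i (by omega)) (sg1_coef hq _ _) (sg2_coef hq _ _)
    -- Both sides arise from the antidiagonal of n + 1, by removing one endpoint or the other; the
    -- removed m = 0 term vanishes.
    have h3 : ∑ p ∈ Finset.HasAntidiagonal.antidiagonal n, W p.1 (p.2 + 1) ⊗ₜ[ℂ] bY q p.1 =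
        W 0 (n + 1) ⊗ₜ bY q 0 +
          ∑ p ∈ Finset.HasAntidiagonal.antidiagonal n, W (p.1 + 1) p.2 ⊗ₜ[ℂ] bY q (p.1 + 1) := by
      have e1 := Finset.Nat.sum_antidiagonal_succ
        (f := fun p : ℕ × ℕ => W p.1 p.2 ⊗ₜ[ℂ] bY q p.1) (n := n)
      have e2 := Finset.Nat.sum_antidiagonal_succ'
        (f := fun p : ℕ × ℕ => W p.1 p.2 ⊗ₜ[ℂ] bY q p.1) (n := n)
      rw [e1] at e2
      rw [e2]
      simp [W]
    have h4 : ∀ j m, coef q (j + 1) m = W (j + 1) m + (-1 : ℂ) ^ m • coef q j m := by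
      intro j m
      cases m with
      | zero => simp only [W, coef_zero hθ]; simp
      | succ m =>
        rw [coef_succ_succ hq hθ, pow_succ]
        simp only [W]
        module
    have h5 : coef q 0 (n + 1) = W 0 (n + 1) - ((-1 : ℂ) ^ n * theta q) • L q (n + 1) :=
      coef_zero_succ hq hθ n
    rw [h1, modGt_congr hT ih, map_add, map_add, br_bracket_bY_one hq, map_sum, map_sum,
      Finset.sum_congr rfl h2, ← map_sum, Finset.sum_add_distrib, h3,
      Finset.Nat.sum_antidiagonal_succ, ← map_add]
    simp only [h4, h5, TensorProduct.add_tmul, TensorProduct.sub_tmul, Finset.sum_add_distrib,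
      ← TensorProduct.smul_tmul']
    congr 1
    abel

theorem modGt_comulB_L_succ (hq : q ≠ 0) (hθ : theta q ≠ 0) (n : ℕ)
    (h : ∀ i ≤ n, L q i ∈ KGe q) :
    modGt q (comulB q (L q (n + 1))) = modGt q (L q (n + 1) ⊗ₜ 1 +
      ∑ p ∈ Finset.HasAntidiagonal.antidiagonal n, coef q p.1 p.2 ⊗ₜ L q (p.1 + 1)) := by
  set T : B q ⊗[ℂ] B q →ₗ[ℂ] B q ⊗[ℂ] B q :=
    nLeftMul (braidMat q) 0 - q⁻¹ • nRightMul (braidMat q) 0 with hTdef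
  have h1 : comulB q (L q (n + 1)) = T (comulB q (bY q n)) := by
    rw [L_succ hq, map_sub, map_smul, comulB_x1_mul, comulB_mul_x1]
    rfl
  have hT : ∀ y ∈ leftSpan (KGt q), T y ∈ leftSpan (KGt q) := fun y hy =>
    sub_mem (x1LeftMul_mem_KGt hy) (Submodule.smul_mem _ _ (x1RightMul_mem_KGt hy))
  have h2 : ∀ p ∈ Finset.HasAntidiagonal.antidiagonal n, modGt q (T (coef q p.1 p.2 ⊗ₜ bY q p.1)) =
      modGt q (coef q p.1 p.2 ⊗ₜ L q (p.1 + 1)) := by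
    intro p hp
    have hp' := Finset.HasAntidiagonal.mem_antidiagonal.1 hp
    have ha : coef q p.1 p.2 ∈ KGe q := coef_mem_KGe_of hq _ fun i hi => h i (by omega)
    simp only [hTdef, LinearMap.sub_apply, LinearMap.smul_apply, x1LeftMul_tmul, x1RightMul_tmul,
      sg1_coef hq, L_succ hq, TensorProduct.tmul_sub, TensorProduct.tmul_smul, map_sub, map_add,
      map_smul, modGt_tmul (x1_mul_mem_KGt ha), modGt_tmul (mul_x1_mem_KGt ha), zero_add]
  have h3 : T (bY q n ⊗ₜ 1) = L q (n + 1) ⊗ₜ 1 := by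
    simp only [hTdef, LinearMap.sub_apply, LinearMap.smul_apply, x1LeftMul_tmul, x1RightMul_tmul,
      sg1_bY hq, L_succ hq, map_one, mul_one, one_mul, TensorProduct.sub_tmul,
      ← TensorProduct.smul_tmul']
    module
  rw [h1, modGt_congr hT (modGt_comulB_bY hq hθ n h), map_add, map_add, h3, map_sum, map_sum,
    Finset.sum_congr rfl h2, ← map_sum, ← map_add]

theorem bY_mem_BShift (hq : q ≠ 0) (n : ℕ) : bY q n ∈ BShift q 1 0 := by
  induction n with
  | zero =>
    rw [bY_zero, ← mul_one (x2 q)]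
    exact x2_mul_mem_BShift (one_mem_degSum (le_refl _))
  | succ n ih =>
    rw [bY_succ hq]
    exact add_mem (br_mul_mem_BShift ih) (Submodule.smul_mem _ _ (mul_br_mem_BShift ih))

theorem L_succ_mem_BGe (hq : q ≠ 0) (n : ℕ) : L q (n + 1) ∈ BGe q := by
  rw [L_succ hq, BGe_eq_BShift]
  have h := bY_mem_BShift hq n
  exact sub_mem (BShift_mono (by omega) (x1_mul_mem_BShift h))
    (Submodule.smul_mem _ _ (BShift_mono (by omega) (mul_x1_mem_BShift h)))

/-- The formula for Δ(L_{n+1}) assumes membership only up to index n, and all its left factors lie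
in B_{≥1}, as does the discarded part in K_{>1} ⊗ B(𝕍). -/
theorem L_mem_KGe (hq : q ≠ 0) (hθ : theta q ≠ 0) (n : ℕ) : L q n ∈ KGe q := by
  induction n using Nat.strong_induction_on with
  | _ n ih =>
    cases n with
    | zero => rw [L_zero]; exact Submodule.smul_mem _ _ (one_mem_KGe q)
    | succ n =>
      have h : ∀ i ≤ n, L q i ∈ KGe q := fun i hi => ih i (Nat.lt_succ_of_le hi)
      have h1 := modGt_eq_iff.1 (modGt_comulB_L_succ hq hθ n h)
      rw [mem_KGe]
      have h2 := leftSpan_mono ((KGt_le_KGe q).trans (KGe_le_BGe q)) h1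
      refine (Submodule.sub_mem_iff_left _ ?_).1 h2
      refine add_mem (tmul_mem_leftSpan (L_succ_mem_BGe hq n) 1) (sum_mem fun p hp => ?_)
      have hp' := Finset.HasAntidiagonal.mem_antidiagonal.1 hp
      exact tmul_mem_leftSpan
        (KGe_le_BGe q (coef_mem_KGe_of hq _ fun i hi => h i (by omega))) _

theorem L'_mem_KGe (hq : q ≠ 0) (hθ : theta q ≠ 0) (n : ℕ) : L' q n ∈ KGe q :=
  L'_mem_KGe_of hq fun i _ => L_mem_KGe hq hθ i

theorem coef_mem_KGe (hq : q ≠ 0) (hθ : theta q ≠ 0) (j m : ℕ) : coef q j m ∈ KGe q :=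
  coef_mem_KGe_of hq j fun i _ => L_mem_KGe hq hθ i

/-! ### The comultiplication of L'_n -/

/-- Left multiplication by `Δ(X_2)` in the braided tensor square. -/
def bX2LeftMul (q : ℂ) : B q ⊗[ℂ] B q →ₗ[ℂ] B q ⊗[ℂ] B q :=
  nLeftMul (braidMat q) 0 ∘ₗ brLeftMul q - brLeftMul q ∘ₗ nLeftMul (braidMat q) 0

/-- Right multiplication by `Δ(X_2)` in the braided tensor square. -/
def bX2RightMul (q : ℂ) : B q ⊗[ℂ] B q →ₗ[ℂ] B q ⊗[ℂ] B q :=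
  brRightMul q ∘ₗ nRightMul (braidMat q) 0 - nRightMul (braidMat q) 0 ∘ₗ brRightMul q

theorem comulB_bX2_mul (hq : q ≠ 0) (b : B q) :
    comulB q (bX2 q * b) = bX2LeftMul q (comulB q b) := by
  rw [bX2, sub_mul, mul_assoc, mul_assoc, map_sub, comulB_x1_mul, comulB_br_mul hq,
    comulB_br_mul hq, comulB_x1_mul]
  rfl

theorem comulB_mul_bX2 (hq : q ≠ 0) (b : B q) :
    comulB q (b * bX2 q) = bX2RightMul q (comulB q b) := by
  rw [bX2, mul_sub, ← mul_assoc, ← mul_assoc, map_sub, comulB_mul_br hq, comulB_mul_x1,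
    comulB_mul_x1, comulB_mul_br hq]
  rfl

theorem bX2LeftMul_tmul (hq : q ≠ 0) (a b : B q) : bX2LeftMul q (a ⊗ₜ b) = (bX2 q * a) ⊗ₜ b +
    theta q • ((x1 q * sg1 q (sg2 q a)) ⊗ₜ (br q * b)) +
    ((1 - q⁻¹ * q⁻¹) * (1 - q⁻¹)) • ((x1 q * (x1 q * sg2 q a)) ⊗ₜ (x2 q * b)) +
    sg1 q (sg1 q (sg2 q a)) ⊗ₜ (bX2 q * b) := by
  have e : br q * b = x1 q * (x2 q * b) - q⁻¹ • (x2 q * (x1 q * b)) := by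
    rw [br, sub_mul, smul_mul_assoc, mul_assoc, mul_assoc]
  simp only [bX2LeftMul, LinearMap.sub_apply, LinearMap.comp_apply, x1LeftMul_tmul,
    brLeftMul_tmul, map_add, map_smul, map_mul, sg1_br hq, sg1_x1, sg2_x1, sg2_sg1, bX2, sub_mul,
    mul_assoc, TensorProduct.sub_tmul, TensorProduct.tmul_sub, smul_mul_assoc, mul_smul_comm,
    ← TensorProduct.smul_tmul', smul_add, theta]
  -- Only this occurrence of `br` is expanded into letters, to match the products of x_1 and x_2 in
  -- the right factors.
  rw [show (x1 q * (sg1 q) ((sg2 q) a)) ⊗ₜ[ℂ] (br q * b) =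
    (x1 q * (sg1 q) ((sg2 q) a)) ⊗ₜ[ℂ] (x1 q * (x2 q * b)) -
      q⁻¹ • ((x1 q * (sg1 q) ((sg2 q) a)) ⊗ₜ[ℂ] (x2 q * (x1 q * b))) by
    rw [e, TensorProduct.tmul_sub, TensorProduct.tmul_smul]]
  match_scalars <;> field_simp <;> ring

theorem bX2RightMul_tmul (hq : q ≠ 0) (a b : B q) : bX2RightMul q (a ⊗ₜ b) =
    (a * bX2 q) ⊗ₜ sg1 q (sg1 q (sg2 q b)) +
    theta q • ((a * x1 q) ⊗ₜ (sg1 q b * br q)) +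
    ((1 - q⁻¹ * q⁻¹) * (1 - q⁻¹)) • ((a * (x1 q * x1 q)) ⊗ₜ (sg1 q (sg1 q b) * x2 q)) +
    a ⊗ₜ (b * bX2 q) := by
  have e : sg1 q b * br q = sg1 q b * (x1 q * x2 q) - q⁻¹ • (sg1 q b * (x2 q * x1 q)) := by
    rw [br, mul_sub, mul_smul_comm]
  simp only [bX2RightMul, LinearMap.sub_apply, LinearMap.comp_apply, x1RightMul_tmul,
    brRightMul_tmul, map_add, map_smul, map_mul, sg1_br hq, sg1_x1, sg1_x2, sg2_x1, sg2_sg1, bX2,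
    mul_sub, mul_assoc, TensorProduct.sub_tmul, TensorProduct.tmul_sub, smul_mul_assoc,
    mul_smul_comm, TensorProduct.tmul_smul, smul_add, theta]
  rw [show (a * x1 q) ⊗ₜ[ℂ] (sg1 q b * br q) =
    (a * x1 q) ⊗ₜ[ℂ] (sg1 q b * (x1 q * x2 q)) -
      q⁻¹ • ((a * x1 q) ⊗ₜ[ℂ] (sg1 q b * (x2 q * x1 q))) by
    rw [e, TensorProduct.tmul_sub, TensorProduct.tmul_smul]]
  match_scalars <;> field_simp <;> ring

/-- The left tensor factor at `L'_{j+1}` of the comultiplication of `L'_{j+m+1}`. -/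
def coef' (q : ℂ) (j m : ℕ) : B q :=
  theta q • if Even j then (-1 : ℂ) ^ m • L q m else L' q m

theorem coef'_succ (j m : ℕ) : coef' q (j + 1) m = (-1 : ℂ) ^ m • coef q j m := by
  simp only [coef, coef', Nat.even_add_one, ite_not]
  split_ifs
  · rw [smul_comm, smul_smul ((-1 : ℂ) ^ m), ← mul_pow]
    simp
  · rw [smul_comm]

/-- Bracketing the formula for Y_{n+1} with X_2 sends Y_{j+1} to L'_{j+2}. This shift of j exchanges
the parities, hence `coef'`, and leaves the j = 0 term to come from Y_{n+1} ⊗ 1. -/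
theorem modGt_comulB_L'_succ (hq : q ≠ 0) (hθ : theta q ≠ 0) (n : ℕ) :
    modGt q (comulB q (L' q (n + 1))) = modGt q (L' q (n + 1) ⊗ₜ 1 +
      ∑ p ∈ Finset.HasAntidiagonal.antidiagonal n, coef' q p.1 p.2 ⊗ₜ L' q (p.1 + 1)) := by
  have hK := coef_mem_KGe hq hθ
  cases n with
  | zero =>
    have h := modGt_comulB_L_succ hq hθ 0 fun i _ => L_mem_KGe hq hθ i
    rw [Finset.Nat.antidiagonal_zero, Finset.sum_singleton] at h ⊢
    rw [coef_zero hθ] at h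
    rw [coef', if_pos Even.zero, L_zero, pow_zero, one_smul, smul_smul, mul_inv_cancel₀ hθ,
      one_smul]
    exact h
  | succ n =>
    set T : B q ⊗[ℂ] B q →ₗ[ℂ] B q ⊗[ℂ] B q :=
      bX2LeftMul q + ((-1) ^ n * q⁻¹) • bX2RightMul q with hTdef
    have h1 : comulB q (L' q (n + 2)) = T (comulB q (bY q n)) := by
      rw [L'_add_two hq, map_add, map_smul, comulB_bX2_mul hq, comulB_mul_bX2 hq]
      rfl
    have hT : ∀ y ∈ leftSpan (KGt q), T y ∈ leftSpan (KGt q) := fun y hy =>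
      add_mem (sub_mem (x1LeftMul_mem_KGt (brLeftMul_mem_KGt hq hy))
        (brLeftMul_mem_KGt hq (x1LeftMul_mem_KGt hy)))
        (Submodule.smul_mem _ _ (sub_mem (brRightMul_mem_KGt hq (x1RightMul_mem_KGt hy))
          (x1RightMul_mem_KGt (brRightMul_mem_KGt hq hy))))
    have h2 : ∀ p ∈ Finset.HasAntidiagonal.antidiagonal n,
        modGt q (T (coef q p.1 p.2 ⊗ₜ bY q p.1)) =
          modGt q (coef' q (p.1 + 1) p.2 ⊗ₜ L' q (p.1 + 2)) := by
      rintro ⟨j, m⟩ hp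
      obtain rfl := Finset.HasAntidiagonal.mem_antidiagonal.1 hp
      have ha := hK j m
      simp only [hTdef, LinearMap.add_apply, LinearMap.smul_apply, bX2LeftMul_tmul hq,
        bX2RightMul_tmul hq, sg2_coef hq, sg1_coef hq, map_smul, mul_smul_comm, L'_add_two hq,
        coef'_succ, TensorProduct.tmul_add, TensorProduct.tmul_smul, map_add,
        ← TensorProduct.smul_tmul', modGt_tmul (x1_mul_mem_KGt ha),
        modGt_tmul (mul_x1_mem_KGt ha), modGt_tmul (bX2_mul_mem_KGt hq ha),
        modGt_tmul (mul_bX2_mem_KGt hq ha), modGt_tmul (x1_mul_mem_KGt (x1_mul_mem_KGe ha)),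
        ← mul_assoc (coef q j m), modGt_tmul (mul_x1_mem_KGt (mul_x1_mem_KGe ha)), smul_zero,
        zero_add, add_zero, pow_add]
      rcases neg_one_pow_eq_or ℂ m with h | h <;> rw [h] <;> module
    have h3 : modGt q (T (bY q n ⊗ₜ 1)) =
        modGt q (L' q (n + 2) ⊗ₜ 1 + coef' q 0 (n + 1) ⊗ₜ L' q 1) := by
      have hL := L_mem_KGe hq hθ (n + 1)
      -- The x_1 ⊗ u part of Δ(X_2) gives L_{n+1} ⊗ u; the x_1² ⊗ x_2 part factors through x_1
      -- L_{n+1} and L_{n+1} x_1, which lie in K_{>1}.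
      have e : T (bY q n ⊗ₜ 1) = L' q (n + 2) ⊗ₜ 1 + coef' q 0 (n + 1) ⊗ₜ L' q 1 -
          ((-1 : ℂ) ^ n * theta q * (1 - q⁻¹)) •
            ((x1 q * L q (n + 1) + q⁻¹ • (L q (n + 1) * x1 q)) ⊗ₜ x2 q) := by
        simp only [hTdef, LinearMap.add_apply, LinearMap.smul_apply, bX2LeftMul_tmul hq,
          bX2RightMul_tmul hq, sg2_bY hq, sg1_bY hq, map_smul, map_one, mul_smul_comm,
          L'_add_two hq, L_succ hq, L'_one hq, coef', if_pos Even.zero, TensorProduct.add_tmul,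
          TensorProduct.sub_tmul, ← TensorProduct.smul_tmul', mul_one, one_mul, mul_sub, sub_mul,
          smul_mul_assoc, smul_add, smul_sub, theta, pow_succ, mul_assoc]
        match_scalars <;> field_simp <;> ring
      rw [e, map_sub, map_smul, modGt_tmul (add_mem (x1_mul_mem_KGt hL)
        (Submodule.smul_mem _ _ (mul_x1_mem_KGt hL))), smul_zero, sub_zero]
    rw [h1, modGt_congr hT (modGt_comulB_bY hq hθ n fun i _ => L_mem_KGe hq hθ i), map_add,
      map_add, h3, map_sum, map_sum, Finset.sum_congr rfl h2, ← map_sum, ← map_add,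
      Finset.Nat.sum_antidiagonal_succ, add_assoc]

/-! ### Splitting the sums by parity -/

theorem sum_range_two_mul {M : Type*} [AddCommMonoid M] (f : ℕ → M) (n : ℕ) :
    ∑ j ∈ Finset.range (2 * n), f j =
      ∑ i ∈ Finset.range n, f (2 * i) + ∑ i ∈ Finset.range n, f (2 * i + 1) := by
  induction n with
  | zero => simp
  | succ n ih =>
    rw [Nat.mul_succ, Finset.sum_range_succ, Finset.sum_range_succ, ih, Finset.sum_range_succ,
      Finset.sum_range_succ]
    abel

theorem sum_Icc_one {M : Type*} [AddCommMonoid M] (f : ℕ → M) (n : ℕ) :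
    ∑ j ∈ Finset.Icc 1 n, f j = ∑ i ∈ Finset.range n, f (i + 1) := by
  induction n with
  | zero => simp
  | succ n ih => rw [Finset.sum_Icc_succ_top (by omega), ih, Finset.sum_range_succ]

/-- The indices add up to an odd number, so even first indices meet odd exponents and produce the
minus sign. The final term has odd first index, hence `R 0`. -/
theorem sum_parity_even (c : ℂ) (P R T : ℕ → B q) (n : ℕ) :
    ∑ p ∈ Finset.HasAntidiagonal.antidiagonal (2 * n + 1),
        (c • if Even p.1 then (-1 : ℂ) ^ p.2 • P p.2 else R p.2) ⊗ₜ[ℂ] T (p.1 + 1) =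
      -∑ j ∈ Finset.Icc 1 (n + 1), c • (P (2 * (n + 1) - (2 * j - 1)) ⊗ₜ[ℂ] T (2 * j - 1)) +
        ∑ j ∈ Finset.Icc 1 n, c • (R (2 * (n + 1) - 2 * j) ⊗ₜ[ℂ] T (2 * j)) +
        (c • R 0) ⊗ₜ[ℂ] T (2 * (n + 1)) := by
  rw [Finset.Nat.sum_antidiagonal_eq_sum_range_succ
    (fun i j => (c • if Even i then (-1 : ℂ) ^ j • P j else R j) ⊗ₜ[ℂ] T (i + 1)),
    show (2 * n + 1).succ = 2 * (n + 1) by omega, sum_range_two_mul, sum_Icc_one, sum_Icc_one,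
    Finset.sum_range_succ (fun i => (c • if Even (2 * i + 1) then _ else _) ⊗ₜ[ℂ] _), ← add_assoc,
    ← Finset.sum_neg_distrib]
  congr 1
  · congr 1
    · refine Finset.sum_congr rfl fun i hi => ?_
      have hi := Finset.mem_range.1 hi
      rw [if_pos (even_two_mul i), show 2 * n + 1 - 2 * i = 2 * (n - i) + 1 by omega,
        show 2 * (n + 1) - (2 * (i + 1) - 1) = 2 * (n - i) + 1 by omega,
        show 2 * (i + 1) - 1 = 2 * i + 1 by omega, pow_succ, pow_mul, neg_one_sq, one_pow, one_mul,
        neg_one_smul, smul_neg, TensorProduct.neg_tmul, TensorProduct.smul_tmul']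
    · refine Finset.sum_congr rfl fun i hi => ?_
      rw [if_neg (Nat.not_even_two_mul_add_one i),
        show 2 * n + 1 - (2 * i + 1) = 2 * (n + 1) - 2 * (i + 1) by omega,
        TensorProduct.smul_tmul']
      rfl
  · rw [if_neg (Nat.not_even_two_mul_add_one n), Nat.sub_self]
    rfl

/-- Now even first indices meet even exponents and no sign survives; the final term has even first
index, hence `P 0`. -/
theorem sum_parity_odd (c : ℂ) (P R T : ℕ → B q) (n : ℕ) :
    ∑ p ∈ Finset.HasAntidiagonal.antidiagonal (2 * n),
        (c • if Even p.1 then (-1 : ℂ) ^ p.2 • P p.2 else R p.2) ⊗ₜ[ℂ] T (p.1 + 1) =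
      ∑ j ∈ Finset.Icc 1 n, c • (P (2 * n + 1 - (2 * j - 1)) ⊗ₜ[ℂ] T (2 * j - 1)) +
        ∑ j ∈ Finset.Icc 1 n, c • (R (2 * n + 1 - 2 * j) ⊗ₜ[ℂ] T (2 * j)) +
        (c • P 0) ⊗ₜ[ℂ] T (2 * n + 1) := by
  rw [Finset.Nat.sum_antidiagonal_eq_sum_range_succ
    (fun i j => (c • if Even i then (-1 : ℂ) ^ j • P j else R j) ⊗ₜ[ℂ] T (i + 1)),
    Nat.succ_eq_add_one, Finset.sum_range_succ, sum_range_two_mul, sum_Icc_one, sum_Icc_one]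
  congr 1
  · congr 1
    · refine Finset.sum_congr rfl fun i hi => ?_
      have hi := Finset.mem_range.1 hi
      rw [if_pos (even_two_mul i), show 2 * n - 2 * i = 2 * (n - i) by omega,
        show 2 * n + 1 - (2 * (i + 1) - 1) = 2 * (n - i) by omega,
        show 2 * (i + 1) - 1 = 2 * i + 1 by omega, pow_mul, neg_one_sq, one_pow, one_smul,
        TensorProduct.smul_tmul']
    · refine Finset.sum_congr rfl fun i hi => ?_
      rw [if_neg (Nat.not_even_two_mul_add_one i),
        show 2 * n - (2 * i + 1) = 2 * n + 1 - 2 * (i + 1) by omega, TensorProduct.smul_tmul']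
      rfl
  · rw [if_pos (even_two_mul n), Nat.sub_self, pow_zero, one_smul]

/-- The induced comultiplication can be computed modulo `K_{>1} ⊗ B(𝕍)`. -/
theorem IsInducedComul.apply_cls {δ : SubQ q →ₗ[ℂ] SubQ q ⊗[ℂ] SubQ q} (hδ : IsInducedComul q δ)
    {x : B q} (hx : x ∈ KGe q) {y : B q ⊗[ℂ] B q} (h : modGt q (comulB q x) = modGt q y)
    {z : SubQ q ⊗[ℂ] SubQ q}
    (hz : TensorProduct.map (subQIncl q) (subQIncl q) z =
      TensorProduct.map (KGt q).mkQ (KGt q).mkQ y) : δ (cls q x hx) = z := by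
  apply map_subQIncl_injective q
  rw [hδ x hx, hz, ← sub_eq_zero, ← map_sub]
  obtain ⟨w, hw⟩ := modGt_eq_iff.1 h
  rw [← hw, ← LinearMap.comp_apply, ← TensorProduct.map_comp]
  have h0 : (KGt q).mkQ ∘ₗ (KGt q).subtype = 0 := by
    ext a
    exact (Submodule.Quotient.mk_eq_zero _).2 a.2
  rw [h0, TensorProduct.map_zero_left, LinearMap.zero_apply]

theorem theta_ne_zero (hq0 : q ≠ 0) (hq : ∀ m : ℕ, 0 < m → q ^ m ≠ 1) : theta q ≠ 0 := by
  intro h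
  apply hq 2 (by omega)
  rw [theta, sub_eq_zero] at h
  rw [pow_two]
  nth_rewrite 2 [h]
  exact mul_inv_cancel₀ hq0

/-- Stated for abstract sequences because L and L' enter symmetrically: each formula arises from the
other by exchanging them. -/
theorem IsInducedComul.apply_even {δ : SubQ q →ₗ[ℂ] SubQ q ⊗[ℂ] SubQ q}
    (hδ : IsInducedComul q δ) {P T : ℕ → B q} (hP : ∀ n, P n ∈ KGe q) (hT : ∀ n, T n ∈ KGe q)
    (hT0 : theta q • T 0 = 1) {n : ℕ} (hn : 1 ≤ n)
    (h : ∀ m, modGt q (comulB q (T (m + 1))) = modGt q (T (m + 1) ⊗ₜ 1 +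
      ∑ p ∈ Finset.HasAntidiagonal.antidiagonal m,
        (theta q • if Even p.1 then (-1 : ℂ) ^ p.2 • P p.2 else T p.2) ⊗ₜ[ℂ] T (p.1 + 1))) :
    δ (cls q (T (2 * n)) (hT _)) =
      cls q (T (2 * n)) (hT _) ⊗ₜ[ℂ] oneQ q
        - ∑ j ∈ Finset.Icc 1 n, theta q •
          (cls q (P (2 * n - (2 * j - 1))) (hP _) ⊗ₜ[ℂ] cls q (T (2 * j - 1)) (hT _))
        + ∑ j ∈ Finset.Icc 1 (n - 1), theta q •
          (cls q (T (2 * n - 2 * j)) (hT _) ⊗ₜ[ℂ] cls q (T (2 * j)) (hT _))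
        + oneQ q ⊗ₜ[ℂ] cls q (T (2 * n)) (hT _) := by
  obtain ⟨n, rfl⟩ := Nat.exists_eq_add_of_le' hn
  refine hδ.apply_cls (hT _) (h (2 * n + 1)) ?_
  rw [sum_parity_even, hT0]
  simp only [map_add, map_sum, map_smul, map_neg, TensorProduct.map_tmul, subQIncl_cls,
    oneQ, Nat.add_sub_cancel, sub_eq_add_neg, add_assoc]
  rfl

theorem IsInducedComul.apply_odd {δ : SubQ q →ₗ[ℂ] SubQ q ⊗[ℂ] SubQ q}
    (hδ : IsInducedComul q δ) {P T : ℕ → B q} (hP : ∀ n, P n ∈ KGe q) (hT : ∀ n, T n ∈ KGe q)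
    (hP0 : theta q • P 0 = 1) (n : ℕ)
    (h : ∀ m, modGt q (comulB q (T (m + 1))) = modGt q (T (m + 1) ⊗ₜ 1 +
      ∑ p ∈ Finset.HasAntidiagonal.antidiagonal m,
        (theta q • if Even p.1 then (-1 : ℂ) ^ p.2 • P p.2 else T p.2) ⊗ₜ[ℂ] T (p.1 + 1))) :
    δ (cls q (T (2 * n + 1)) (hT _)) =
      cls q (T (2 * n + 1)) (hT _) ⊗ₜ[ℂ] oneQ q
        + ∑ j ∈ Finset.Icc 1 n, theta q •
          (cls q (P (2 * n + 1 - (2 * j - 1))) (hP _) ⊗ₜ[ℂ] cls q (T (2 * j - 1)) (hT _))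
        + ∑ j ∈ Finset.Icc 1 n, theta q •
          (cls q (T (2 * n + 1 - 2 * j)) (hT _) ⊗ₜ[ℂ] cls q (T (2 * j)) (hT _))
        + oneQ q ⊗ₜ[ℂ] cls q (T (2 * n + 1)) (hT _) := by
  refine hδ.apply_cls (hT _) (h (2 * n)) ?_
  rw [sum_parity_odd, hP0]
  simp only [map_add, map_sum, map_smul, TensorProduct.map_tmul, subQIncl_cls, oneQ, add_assoc]

theorem theta_smul_L_zero (hθ : theta q ≠ 0) : theta q • L q 0 = 1 := by
  rw [L_zero, smul_smul, mul_inv_cancel₀ hθ, one_smul]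

theorem theta_smul_L'_zero (hθ : theta q ≠ 0) : theta q • L' q 0 = 1 := by
  rw [L'_zero, smul_smul, mul_inv_cancel₀ hθ, one_smul]

end Nichols

end

theorem mainTheorem10 (q : ℂ) (hq0 : q ≠ 0) (hq : ∀ m : ℕ, 0 < m → q ^ m ≠ 1) :
    ∃ (hL : ∀ n, Nichols.L q n ∈ Nichols.KGe q) (hL' : ∀ n, Nichols.L' q n ∈ Nichols.KGe q)
      (δ : Nichols.SubQ q →ₗ[ℂ] Nichols.SubQ q ⊗[ℂ] Nichols.SubQ q),
      Nichols.IsInducedComul q δ ∧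
      (∀ δ' : Nichols.SubQ q →ₗ[ℂ] Nichols.SubQ q ⊗[ℂ] Nichols.SubQ q,
        Nichols.IsInducedComul q δ' → δ' = δ) ∧
      let l : ℕ → Nichols.SubQ q := fun n => Nichols.cls q (Nichols.L q n) (hL n)
      let l' : ℕ → Nichols.SubQ q := fun n => Nichols.cls q (Nichols.L' q n) (hL' n)
      let e : Nichols.SubQ q := Nichols.oneQ q
      let θ : ℂ := Nichols.theta q
      (∀ n : ℕ, 1 ≤ n → δ (l (2 * n)) =
        l (2 * n) ⊗ₜ[ℂ] e
          - ∑ j ∈ Finset.Icc 1 n, θ • (l' (2 * n - (2 * j - 1)) ⊗ₜ[ℂ] l (2 * j - 1))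
          + ∑ j ∈ Finset.Icc 1 (n - 1), θ • (l (2 * n - 2 * j) ⊗ₜ[ℂ] l (2 * j))
          + e ⊗ₜ[ℂ] l (2 * n)) ∧
      (∀ n : ℕ, 1 ≤ n → δ (l' (2 * n)) =
        l' (2 * n) ⊗ₜ[ℂ] e
          - ∑ j ∈ Finset.Icc 1 n, θ • (l (2 * n - (2 * j - 1)) ⊗ₜ[ℂ] l' (2 * j - 1))
          + ∑ j ∈ Finset.Icc 1 (n - 1), θ • (l' (2 * n - 2 * j) ⊗ₜ[ℂ] l' (2 * j))
          + e ⊗ₜ[ℂ] l' (2 * n)) ∧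
      (∀ n : ℕ, δ (l (2 * n + 1)) =
        l (2 * n + 1) ⊗ₜ[ℂ] e
          + ∑ j ∈ Finset.Icc 1 n, θ • (l' (2 * n + 1 - (2 * j - 1)) ⊗ₜ[ℂ] l (2 * j - 1))
          + ∑ j ∈ Finset.Icc 1 n, θ • (l (2 * n + 1 - 2 * j) ⊗ₜ[ℂ] l (2 * j))
          + e ⊗ₜ[ℂ] l (2 * n + 1)) ∧
      (∀ n : ℕ, δ (l' (2 * n + 1)) =
        l' (2 * n + 1) ⊗ₜ[ℂ] e
          + ∑ j ∈ Finset.Icc 1 n, θ • (l (2 * n + 1 - (2 * j - 1)) ⊗ₜ[ℂ] l' (2 * j - 1))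
          + ∑ j ∈ Finset.Icc 1 n, θ • (l' (2 * n + 1 - 2 * j) ⊗ₜ[ℂ] l' (2 * j))
          + e ⊗ₜ[ℂ] l' (2 * n + 1)) := by
  have hθ := Nichols.theta_ne_zero hq0 hq
  have hL := Nichols.L_mem_KGe hq0 hθ
  have hL' := Nichols.L'_mem_KGe hq0 hθ
  have cL := fun m => Nichols.modGt_comulB_L_succ hq0 hθ m fun i _ => hL i
  have cL' := Nichols.modGt_comulB_L'_succ hq0 hθ
  obtain ⟨δ, hδ⟩ := Nichols.exists_isInducedComul q
  have h0 := Nichols.theta_smul_L_zero hθ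
  have h0' := Nichols.theta_smul_L'_zero hθ
  exact ⟨hL, hL', δ, hδ, fun _ h => hδ.unique h,
    fun _ hn => hδ.apply_even hL' hL h0 hn cL, fun _ hn => hδ.apply_even hL hL' h0' hn cL',
    fun n => hδ.apply_odd hL' hL h0' n cL, fun n => hδ.apply_odd hL hL' h0 n cL'⟩
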